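/- **Theorem.** Let $d\ge 1$. There is a constant $c_d>0$, depending only on $d$, such that the following holds for all integers $D>d$ and $k\ge 2$, all reals $0\le s<k$, $1\le p<\infty$ and $\tau_{\min}>0$, and all $1\le q\le\infty$. If $f_{\min}>0$ is small enough and $f_{\max},L_k,L_s$ are large enough (thresholds depending only on $d,D,k,s,p,q,\tau_{\min}$), then for every sample size $n$, every convex nondecreasing $g:\mathbb R\to[0,\infty]$ with $g(0)=0$, and every loss $\mathcal L:\mathcal P\times\mathcal P\to[0,\infty]$ that is measurable for the Borel $\sigma$-algebra of the total variation distance and satisfies $\mathcal L(\mu,\nu)\ge g(\mathrm{TV}(\mu,\nu))$ for all $\mu,\nu\in\mathcal P$, one has $$\mathcal R_n(\mu,\mathcal Q^{s,k}_d,\mathcal L)\;\ge\; g(c_d).$$ Here: * $\mathcal P$ is the set of finite Borel measures on $\mathbb R^D$ and $\mathrm{TV}(\mu,\nu)=\sup_A|\mu(A)-\nu(A)|$, the supremum being over Borel sets. * $\mathcal M^k_d$ is the set of connected, closed, smooth $d$-dimensional submanifolds $M\subset\mathbb R^D$ without boundary, of reach larger than $\tau_{\min}$ (the reach is the distance from $M$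 to the set of points with at least two nearest points in $M$), such that with $r_0=\min(\tau_{\min},L_k)/4$, for every $x\in M$ the projection $y\mapsto\pi_{T_xM}(y-x)$ from $M$ to $T_xM$ is a local diffeomorphism at $x$ with an inverse $\Psi_x$ defined on the ball of $T_xM$ of centre $0$ and radius $r_0$, and $\|d^i\Psi_x\|_{\mathrm{op}}\le L_k$ on this ball for $0\le i\le k$. * $\mathrm{vol}_M$ is the Riemannian volume measure of $M$ (the $d$-dimensional Hausdorff measure on $M$). * $H^k_p(M)$ is the completion of $\mathcal C^\infty(M)$ for the norm $\max_{0\le i\le k}\big(\int\|d^if\|_{\mathrm{op}}^p\,d\mathrm{vol}_M\big)^{1/p}$, where $d^if$ is the $i$-th covariant differential. For $0<s<k$, $B^s_{p,q}(M)=(L_p(M),H^k_p(M))_{s/k,q}$ is the real interpolation space, with norm $\|f\|_{B^s_{p,q}(M)}=\big(\int_0^\infty(\lambda^{-s/k}K(f,\lambda))^q\frac{d\lambda}{\lambda}\big)^{1/q}$ (a supremum if $q=\infty$), where $K(f,\lambda)=\inf\{\|f_0\|_{L_p(M)}+\lambda\|f_1\|_{H^k_p(M)}:\ f=f_0+f_1\}$.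 * $\mathcal Q^{s,k}_d$ is the set of probability measures $\mu$ on $\mathbb R^D$ that, for some $M\in\mathcal M^k_d$, have a density $f$ with respect to $\mathrm{vol}_M$ with $f_{\min}\le f\le f_{\max}$ almost everywhere and, if $s>0$, $\|f\|_{B^s_{p,q}(M)}\le L_s$. * $\mathcal R_n(\mu,\mathcal Q^{s,k}_d,\mathcal L)=\inf_{\hat\mu}\sup_{\mu\in\mathcal Q^{s,k}_d}\mathbb E\,\mathcal L(\hat\mu(X_1,\dots,X_n),\mu)$, where $X_1,\dots,X_n$ are i.i.d. of law $\mu$. The infimum is over all maps $\hat\mu:(\mathbb R^D)^n\to\mathcal P$ for which $\mathcal L(\hat\mu(X_1,\dots,X_n),\mu)$ is a random variable for every $\mu\in\mathcal Q^{s,k}_d$; these include all maps that are measurable for the Borel $\sigma$-algebra of the total variation distance. -/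

import Mathlib

open MeasureTheory Set Filter Topology
open scoped ENNReal NNReal ContDiff

namespace ManifoldModel

noncomputable section

/-- The ambient Euclidean space `ℝ^D`. -/
abbrev Space (D : ℕ) : Type := EuclideanSpace ℝ (Fin D)

/-! ### Submanifolds of `ℝ^D` -/

section Manifolds

variable {D : ℕ}

/-- `M` is a smooth (`C^∞`) embedded `d`-dimensional submanifold of `ℝ^D` without boundary: around
each of its points, a smooth diffeomorphism between open subsets of `ℝ^D` maps `M` to the
coordinate subspace `{y | y_d = ⋯ = y_{D-1} = 0}`. -/
def IsSmoothSubmanifold (d : ℕ) (M : Set (Space D)) : Prop :=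
  ∀ x ∈ M, ∃ φ : OpenPartialHomeomorph (Space D) (Space D),
    x ∈ φ.source ∧ ContDiffOn ℝ ∞ φ φ.source ∧ ContDiffOn ℝ ∞ φ.symm φ.target ∧
    ∀ y ∈ φ.source, (y ∈ M ↔ ∀ i : Fin D, d ≤ (i : ℕ) → φ y i = 0)

/-- The points having at least two nearest points in `M`. -/
def medialAxis (M : Set (Space D)) : Set (Space D) :=
  {x | ∃ y ∈ M, ∃ z ∈ M, y ≠ z ∧ dist x y = Metric.infDist x M ∧ dist x z = Metric.infDist x M}

/-- The reach of `M`: the distance between `M` and its medial axis (`⊤` if the latter is empty). -/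
def reach (M : Set (Space D)) : ℝ≥0∞ :=
  ⨅ x ∈ medialAxis M, Metric.infEDist x M

/-- The tangent space `T_x M`, as a linear subspace of `ℝ^D`. For a submanifold the tangent cone
already is this subspace. -/
def tangentPlane (M : Set (Space D)) (x : Space D) : Submodule ℝ (Space D) :=
  Submodule.span ℝ (tangentConeAt ℝ M x)

/-- `ψ`, defined on the open ball of radius `r` of `T_x M`, is the inverse of the local
diffeomorphism at `x` given by the projection `y ↦ π_x (y - x)` from `M` to `T_x M`. -/
structure IsLocalParam (M : Set (Space D)) (x : Space D) (r : ℝ)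
    (ψ : tangentPlane M x → Space D) : Prop where
  map_zero : ψ 0 = x
  smooth : ContDiffOn ℝ ∞ ψ (Metric.ball 0 r)
  mem : ∀ u ∈ Metric.ball (0 : tangentPlane M x) r, ψ u ∈ M
  proj : ∀ u ∈ Metric.ball (0 : tangentPlane M x) r,
    (tangentPlane M x).orthogonalProjectionOnto (ψ u - x) = u
  /-- the image is a relatively open subset of `M` -/
  image_open : ∃ V : Set (Space D), IsOpen V ∧ ψ '' Metric.ball 0 r = M ∩ V

/-- The class `𝓜^k_{d,τ,L}` of closed connected smooth `d`-dimensional submanifolds of reach larger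
than `τ`, whose local inverse projections `Ψ_x`, on the ball of radius `r₀ = min τ L / 4`, have all
their derivatives of order `0, …, k` bounded by `L` in operator norm. -/
def manifoldClass (D d k : ℕ) (τ L : ℝ) : Set (Set (Space D)) :=
  {M | IsSmoothSubmanifold d M ∧ IsConnected M ∧ IsClosed M ∧ ENNReal.ofReal τ < reach M ∧
    ∀ x ∈ M, ∃ ψ : tangentPlane M x → Space D, IsLocalParam M x (min τ L / 4) ψ ∧
      ∀ i ≤ k, ∀ u ∈ Metric.ball (0 : tangentPlane M x) (min τ L / 4),
        ‖iteratedFDeriv ℝ i ψ u‖ ≤ L}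

/-- The volume measure `vol_M`: the `d`-dimensional Hausdorff measure (normalized to be Lebesgue
measure on `ℝ^d`) restricted to `M`. -/
def volM (d : ℕ) (M : Set (Space D)) : Measure (Space D) :=
  (Measure.euclideanHausdorffMeasure d).restrict M

/-! ### Sobolev and Besov norms on a submanifold -/

/-- The `i`-th differential (iterated Levi-Civita covariant derivative) of a function on `M`, as an
`i`-linear form on `ℝ^D` that depends only on the tangential parts of its arguments:
`d^{i+1} f (x) [w₀, …, w_i] = (D_{π_x w₀} (d^i f)) (x) [π_x w₁, …, π_x w_i]`, where `D` is the
derivative along `M`. -/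
def differential (M : Set (Space D)) (f : Space D → ℝ) :
    (i : ℕ) → Space D → ContinuousMultilinearMap ℝ (fun _ : Fin i => Space D) ℝ
  | 0 => fun x => ContinuousMultilinearMap.constOfIsEmpty ℝ (fun _ : Fin 0 => Space D) (f x)
  | i + 1 => fun x =>
      (fderivWithin ℝ (differential M f i) M x).uncurryLeft.compContinuousLinearMap
        (fun _ : Fin (i + 1) => (tangentPlane M x).starProjection)

/-- The norm `max_{i ≤ l} (∫ ‖d^i f‖^p d vol_M)^{1/p}` of a smooth function `f` on `M`. -/
def smoothSobolevNorm (d l : ℕ) (p : ℝ) (M : Set (Space D)) (f : Space D → ℝ) : ℝ≥0∞ :=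
  ⨆ i : Fin (l + 1), eLpNorm (differential M f i) (ENNReal.ofReal p) (volM d M)

/-- `u` is a sequence in `C^∞(M)` that is Cauchy for the norm of `H^l_p(M)` and converges to `f`
in `L_p(M)`. -/
structure IsSobolevApprox (d l : ℕ) (p : ℝ) (M : Set (Space D)) (f : Space D → ℝ)
    (u : ℕ → Space D → ℝ) : Prop where
  smooth : ∀ n, ContDiffOn ℝ ∞ (u n) M
  finite : ∀ n, smoothSobolevNorm d l p M (u n) < ⊤
  cauchy : ∀ ε : ℝ≥0∞, 0 < ε → ∃ N, ∀ m ≥ N, ∀ n ≥ N,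
    smoothSobolevNorm d l p M (u m - u n) < ε
  tendsto : Tendsto (fun n => eLpNorm (u n - f) (ENNReal.ofReal p) (volM d M)) atTop (𝓝 0)

/-- The Sobolev space `H^l_p(M)`, the completion of `C^∞(M)`, realized inside `L_p(M)`. -/
def MemSobolev (d l : ℕ) (p : ℝ) (M : Set (Space D)) (f : Space D → ℝ) : Prop :=
  MemLp f (ENNReal.ofReal p) (volM d M) ∧ ∃ u, IsSobolevApprox d l p M f u

/-- The norm of the completion `H^l_p(M)`: the limit of the norms of an approximating sequence. -/
def sobolevNorm (d l : ℕ) (p : ℝ) (M : Set (Space D)) (f : Space D → ℝ) : ℝ≥0∞ :=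
  ⨅ (u : ℕ → Space D → ℝ) (_ : IsSobolevApprox d l p M f u),
    limsup (fun n => smoothSobolevNorm d l p M (u n)) atTop

/-- The `K`-functional of the pair `(L_p(M), H^l_p(M))`. -/
def kFunctional (d l : ℕ) (p : ℝ) (M : Set (Space D)) (f : Space D → ℝ) (t : ℝ) : ℝ≥0∞ :=
  ⨅ (f₀ : Space D → ℝ) (f₁ : Space D → ℝ) (_ : MemLp f₀ (ENNReal.ofReal p) (volM d M))
    (_ : MemSobolev d l p M f₁) (_ : f =ᵐ[volM d M] f₀ + f₁),
    eLpNorm f₀ (ENNReal.ofReal p) (volM d M) + ENNReal.ofReal t * sobolevNorm d l p M f₁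

/-- The norm of the Besov space `B^s_{p,q}(M) = (L_p(M), H^k_p(M))_{s/k,q}`: the `L_q` norm of
`t ↦ t^{-s/k} K(f,t)` on `(0,∞)` for the measure `dt/t`. It is `⊤` outside the space. -/
def besovNorm (d k : ℕ) (s p : ℝ) (q : ℝ≥0∞) (M : Set (Space D)) (f : Space D → ℝ) : ℝ≥0∞ :=
  eLpNorm (fun t : ℝ => ENNReal.ofReal (t ^ (-(s / k))) * kFunctional d k p M f t) q
    ((volume.restrict (Ioi (0 : ℝ))).withDensity fun t => ENNReal.ofReal t⁻¹)

/-! ### The noise-free model -/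

/-- The set `𝒬^s(M)` of probability measures on `ℝ^D` with a density `f` with respect to `vol_M`
such that `fmin ≤ f ≤ fmax` almost everywhere and, if `s > 0`, of Besov norm at most `Ls`. -/
def modelOn (d k : ℕ) (s p : ℝ) (q : ℝ≥0∞) (Ls fmin fmax : ℝ) (M : Set (Space D)) :
    Set (ProbabilityMeasure (Space D)) :=
  {μ | ∃ f : Space D → ℝ, Measurable f ∧
    (μ : Measure (Space D)) = (volM d M).withDensity (fun x => ENNReal.ofReal (f x)) ∧
    (∀ᵐ x ∂(volM d M), fmin ≤ f x ∧ f x ≤ fmax) ∧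
    (0 < s → besovNorm d k s p q M f ≤ ENNReal.ofReal Ls)}

end Manifolds

/-- The noise-free model `𝒬^{s,k}_d`: the union of the sets `𝒬^s(M)` for `M` in the class
`𝓜^k_{d,τ,Lk}`. -/
def noiseFreeModel (D d k : ℕ) (s p : ℝ) (q : ℝ≥0∞) (τ Lk Ls fmin fmax : ℝ) :
    Set (ProbabilityMeasure (Space D)) :=
  ⋃ M ∈ manifoldClass D d k τ Lk, modelOn d k s p q Ls fmin fmax M

/-! ### Total variation -/

section TotalVariation

variable {X : Type*} [MeasurableSpace X]

/-- The total variation distance `sup_A |μ(A) - ν(A)|` between finite measures. -/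
def tvDist (μ ν : FiniteMeasure X) : ℝ :=
  ⨆ A : {A : Set X // MeasurableSet A}, |(μ A : ℝ) - (ν A : ℝ)|

theorem tvDist_bddAbove (μ ν : FiniteMeasure X) :
    BddAbove (range fun A : {A : Set X // MeasurableSet A} => |(μ A : ℝ) - (ν A : ℝ)|) := by
  refine ⟨(μ.mass : ℝ) + ν.mass, ?_⟩
  rintro _ ⟨A, rfl⟩
  have h1 : (μ A : ℝ) ≤ μ.mass := by exact_mod_cast μ.apply_le_mass A
  have h2 : (ν A : ℝ) ≤ ν.mass := by exact_mod_cast ν.apply_le_mass A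
  have h3 : (0 : ℝ) ≤ μ A := NNReal.coe_nonneg _
  have h4 : (0 : ℝ) ≤ ν A := NNReal.coe_nonneg _
  exact abs_le.2 ⟨by linarith, by linarith⟩

instance : Nonempty {A : Set X // MeasurableSet A} := ⟨⟨∅, MeasurableSet.empty⟩⟩

/-- The space of finite measures with the total variation distance. -/
abbrev tvSpace : PseudoMetricSpace (FiniteMeasure X) where
  dist := tvDist
  dist_self μ := by simp [tvDist]
  dist_comm μ ν := by simp only [tvDist, abs_sub_comm]
  dist_triangle μ ν ρ := by
    refine ciSup_le fun A => ?_
    exact (abs_sub_le _ (ν A : ℝ) _).trans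
      (add_le_add (le_ciSup (tvDist_bddAbove μ ν) A) (le_ciSup (tvDist_bddAbove ν ρ) A))

/-- The topology of the total variation distance on finite measures (Mathlib's own topology on
`FiniteMeasure X` is the weak one). -/
abbrev tvTopology : TopologicalSpace (FiniteMeasure X) :=
  (tvSpace (X := X)).toUniformSpace.toTopologicalSpace

/-- The Borel `σ`-algebra of the total variation distance on pairs of finite measures. -/
abbrev tvBorel : MeasurableSpace (FiniteMeasure X × FiniteMeasure X) :=
  @borel _ (@instTopologicalSpaceProd _ _ tvTopology tvTopology)

end TotalVariation

/-! ### Minimax risk -/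

/-- The minimax risk for the estimation of `ϑ` on the model `Q` with respect to the loss `ℓ`, from
`n` i.i.d. observations: the infimum over the estimators `T` of the supremum over `ξ ∈ Q` of the
expected loss `𝔼 ℓ(T(X₁, …, X_n), ϑ(ξ))`, where `X₁, …, X_n` are i.i.d. of law `ξ`. Every map `T` of
the sample whose losses are random variables under the model counts as an estimator; this includes
all the measurable maps, for any `σ`-algebra on `E` for which the functions `ℓ(·, ϑ(ξ))` are
measurable. -/
def minimaxRisk {X E : Type*} [MeasurableSpace X] (n : ℕ) (Q : Set (ProbabilityMeasure X))
    (ϑ : ProbabilityMeasure X → E) (ℓ : E → E → ℝ≥0∞) : ℝ≥0∞ :=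
  ⨅ (T : (Fin n → X) → E)
    (_ : ∀ ξ ∈ Q, AEMeasurable (fun x => ℓ (T x) (ϑ ξ))
      (Measure.pi fun _ : Fin n => (ξ : Measure X))),
    ⨆ ξ ∈ Q, ∫⁻ x, ℓ (T x) (ϑ ξ) ∂(Measure.pi fun _ : Fin n => (ξ : Measure X))

end

end ManifoldModel

open ManifoldModel

/-! The bound is constant in `n` because total variation sees the support: two uniform laws on
hypersurfaces that differ by an arbitrarily small bump are mutually singular over that bump. The
amplitude `η` of the bumps costs nothing in the risk and may depend on `n`, so all regularity
constraints can be met with constants independent of `n`.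

Take the round `d`-sphere of radius `4τ` in a `(d+1)`-dimensional coordinate subspace. Cut it by
rotations in the first two coordinates into `4m` overlapping sectors with `m ≥ 2n`, and group
disjoint sectors into `m` cells of two. A sign vector `ε` selects one sector per cell, and a rotated
copy of one fixed bump is placed there: the surface is `‖y‖² = R² + η H_ε(y)`. Since all bumps are
congruent, the volume does not depend on `ε`, so changing the sign of a cell changes the uniform law
only inside that cell. The bumps carry at least a fifth of the volume: the `4m` sectors cover the
sphere up to a null set, and an outward bump only increases volume, because radial projection
contracts outside the ball (`IsSectorBump.volume_bounds`). Changing at least half of the signs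
therefore moves the law by at least `1/10` in total variation (`IsSectorBump.tvDist_ge`).

The statistical half is a Bayes argument with uniform prior on `ε` (`le_minimaxRisk_of_cells`). A
sample of size `n` hits at most half of the cells. Given the set `J` of hit cells, `ε` and the
vector with all signs off `J` switched give the same sample law, so by the triangle inequality and
convexity of `g` the estimator loses at least `g(1/20)` on average over the pair.

The geometric half shows that small perturbations lie in the manifold class with uniform constants
(`exists_eventually_mem_manifoldClass`). Each surface is a graph over its tangent planes whose
height solves an implicit equation, jointly smooth in the base point, `η` and the tangent vector. At
`η = 0` this is the round sphere whatever the bump, so compactness gives one derivative bound for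
all small `η`. The Besov constraint is easy: the densities are constants, bounded above and below.
-/

namespace ManifoldModel

/-! ### Bayes lower bound over a family of signs -/

/-- Switch all the signs whose index is outside `J`. -/
def flipOff {m : ℕ} (J : Finset (Fin m)) (ε : Fin m → Bool) : Fin m → Bool :=
  fun j => if j ∈ J then ε j else !(ε j)

theorem flipOff_flipOff {m : ℕ} (J : Finset (Fin m)) (ε : Fin m → Bool) :
    flipOff J (flipOff J ε) = ε := by
  funext j
  by_cases h : j ∈ J <;> simp [flipOff, h]

/-- The involution `flipOff J` as an equivalence. -/
def flipOffEquiv {m : ℕ} (J : Finset (Fin m)) : (Fin m → Bool) ≃ (Fin m → Bool) where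
  toFun := flipOff J
  invFun := flipOff J
  left_inv := flipOff_flipOff J
  right_inv := flipOff_flipOff J

/-- The set of samples that hit exactly the cells `W j`, `j ∈ J`. -/
def hitSet {X : Type*} (n : ℕ) {m : ℕ} (W : Fin m → Set X) (J : Finset (Fin m)) :
    Set (Fin n → X) :=
  {x | ∀ j, (∃ i, x i ∈ W j) ↔ j ∈ J}

theorem measurableSet_hitSet {X : Type*} [MeasurableSpace X] (n : ℕ) {m : ℕ} {W : Fin m → Set X}
    (hW : ∀ j, MeasurableSet (W j)) (J : Finset (Fin m)) : MeasurableSet (hitSet n W J) := by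
  have h : hitSet n W J = ⋂ j, {x : Fin n → X | (∃ i, x i ∈ W j) ↔ j ∈ J} := by
    ext x; simp [hitSet]
  rw [h]
  refine MeasurableSet.iInter fun j => ?_
  have h1 : MeasurableSet {x : Fin n → X | ∃ i, x i ∈ W j} := by
    have : {x : Fin n → X | ∃ i, x i ∈ W j} = ⋃ i, (fun x => x i) ⁻¹' (W j) := by ext x; simp
    rw [this]
    exact MeasurableSet.iUnion fun i => (measurable_pi_apply i) (hW j)
  by_cases hj : j ∈ J
  · simpa [hj] using h1
  · simpa only [hj, iff_false] using! h1.compl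

/-- Choosing a sample index for each hit cell is injective, the cells being disjoint. -/
theorem card_le_of_mem_hitSet {X : Type*} {n m : ℕ} {W : Fin m → Set X}
    (hWd : Pairwise (Function.onFun Disjoint W)) {J : Finset (Fin m)} {x : Fin n → X}
    (hx : x ∈ hitSet n W J) : J.card ≤ n := by
  have h : ∀ j : J, ∃ i, x i ∈ W j := fun j => (hx j).2 j.2
  choose f hf using h
  have hinj : Function.Injective f := by
    intro a b hab
    by_contra hne
    exact Set.disjoint_left.1 (hWd fun h => hne (Subtype.ext h)) (hf a) (hab ▸ hf b)
  simpa using Fintype.card_le_of_injective f hinj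

/-- Each sample hits exactly one set of cells, so the hit sets form a finite measurable partition.
-/
theorem lintegral_eq_sum_hitSet {X : Type*} [MeasurableSpace X] {n m : ℕ} {W : Fin m → Set X}
    (hW : ∀ j, MeasurableSet (W j)) (ν : Measure (Fin n → X)) (φ : (Fin n → X) → ℝ≥0∞) :
    ∫⁻ x, φ x ∂ν = ∑ J : Finset (Fin m), ∫⁻ x in hitSet n W J, φ x ∂ν := by
  classical
  rw [← tsum_fintype (L := .unconditional _),
    ← lintegral_iUnion (measurableSet_hitSet n hW) ?_, ← setLIntegral_univ]
  · congr 2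
    symm
    rw [eq_univ_iff_forall]
    intro x
    exact mem_iUnion.2 ⟨Finset.univ.filter fun j => ∃ i, x i ∈ W j, fun j => by simp⟩
  · intro J J' hne
    refine Set.disjoint_left.2 fun x hx hx' => hne ?_
    ext j
    exact (hx j).symm.trans (hx' j)

/-- If the marginals agree off the cells `W j`, `j ∉ J`, then the laws of the samples agree on the
event that only the cells `W j`, `j ∈ J`, are hit. -/
theorem pi_restrict_hitSet_congr {X : Type*} [MeasurableSpace X] {n m : ℕ} {W : Fin m → Set X}
    (J : Finset (Fin m)) (μ μ' : Measure X)
    [IsProbabilityMeasure μ] [IsProbabilityMeasure μ']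
    (h : μ.restrict (⋃ j ∈ Jᶜ, W j)ᶜ = μ'.restrict (⋃ j ∈ Jᶜ, W j)ᶜ) :
    (Measure.pi fun _ : Fin n => μ).restrict (hitSet n W J) =
      (Measure.pi fun _ : Fin n => μ').restrict (hitSet n W J) := by
  -- A sample that misses the cells off `J` lies in a box, and restricting a product measure to a
  -- box amounts to restricting its factors.
  have hsub : hitSet n W J ⊆ Set.pi univ fun _ : Fin n => (⋃ j ∈ Jᶜ, W j)ᶜ := by
    intro x hx i _ hi
    obtain ⟨j, hj, hij⟩ := mem_iUnion₂.1 hi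
    exact (Finset.mem_compl.1 hj) ((hx j).1 ⟨i, hij⟩)
  rw [← Measure.restrict_restrict_of_subset (μ := Measure.pi fun _ : Fin n => μ) hsub,
    ← Measure.restrict_restrict_of_subset (μ := Measure.pi fun _ : Fin n => μ') hsub,
    Measure.restrict_pi_pi, Measure.restrict_pi_pi, h]

/-- By the triangle inequality `c` is at most the average of the two distances to `ρ`; monotonicity
and midpoint convexity of `g` then apply. No single estimate can be close to both laws. -/
theorem tvDist_triangle_half {X : Type*} [MeasurableSpace X] (g : ℝ → ℝ≥0∞)
    (hg : ConvexOn ℝ≥0 Set.univ g) (hmono : Monotone g) {c : ℝ} (ρ μ ν : FiniteMeasure X)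
    (h : 2 * c ≤ tvDist μ ν) : 2 * g c ≤ g (tvDist ρ μ) + g (tvDist ρ ν) := by
  have htri : tvDist μ ν ≤ tvDist ρ μ + tvDist ρ ν := by
    have h1 := (tvSpace (X := X)).dist_triangle μ ρ ν
    have h2 := (tvSpace (X := X)).dist_comm μ ρ
    change tvDist μ ν ≤ tvDist μ ρ + tvDist ρ ν at h1
    change tvDist μ ρ = tvDist ρ μ at h2
    linarith
  have hhalf : ((2⁻¹ : ℝ≥0) : ℝ) = 2⁻¹ := by norm_num
  have hsum : (2⁻¹ : ℝ≥0) + 2⁻¹ = 1 := by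
    rw [← two_mul]
    exact mul_inv_cancel₀ two_ne_zero
  have hc := hg.2 (mem_univ (tvDist ρ μ)) (mem_univ (tvDist ρ ν)) (zero_le (a := (2⁻¹ : ℝ≥0)))
    (zero_le (a := (2⁻¹ : ℝ≥0))) hsum
  have h3 : g c ≤ (2⁻¹ : ℝ≥0) • g (tvDist ρ μ) + (2⁻¹ : ℝ≥0) • g (tvDist ρ ν) := by
    refine (hmono ?_).trans hc
    simp only [NNReal.smul_def, hhalf, smul_eq_mul]
    linarith
  calc 2 * g c ≤ 2 * ((2⁻¹ : ℝ≥0) • g (tvDist ρ μ) + (2⁻¹ : ℝ≥0) • g (tvDist ρ ν)) := by gcongr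
    _ = g (tvDist ρ μ) + g (tvDist ρ ν) := by
      simp only [ENNReal.smul_def, smul_eq_mul]
      rw [mul_add, ← mul_assoc, ← mul_assoc, ENNReal.coe_inv two_ne_zero, ENNReal.coe_ofNat,
        ENNReal.mul_inv_cancel two_ne_zero ENNReal.ofNat_ne_top, one_mul, one_mul]

/-- A lower bound for the minimax risk under the total variation loss: a family of laws indexed by
signs `ε`, such that the sign `ε j` only influences the law on the cell `W j`, and such that
switching at least half of the signs moves the law by at least `2 c`. -/
theorem le_minimaxRisk_of_cells {X : Type*} [MeasurableSpace X] {n m : ℕ} (hmn : 2 * n ≤ m)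
    (Q : Set (ProbabilityMeasure X)) (μ : (Fin m → Bool) → ProbabilityMeasure X)
    (hQ : ∀ ε, μ ε ∈ Q) (W : Fin m → Set X) (hW : ∀ j, MeasurableSet (W j))
    (hWd : Pairwise (Function.onFun Disjoint W))
    (hres : ∀ (J : Finset (Fin m)) (ε ε' : Fin m → Bool), (∀ j ∈ J, ε j = ε' j) →
      (μ ε : Measure X).restrict (⋃ j ∈ Jᶜ, W j)ᶜ = (μ ε' : Measure X).restrict (⋃ j ∈ Jᶜ, W j)ᶜ)
    {c : ℝ} (htv : ∀ (J : Finset (Fin m)) (ε : Fin m → Bool), m ≤ 2 * Jᶜ.card →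
      2 * c ≤ tvDist (μ ε).toFiniteMeasure (μ (flipOff J ε)).toFiniteMeasure)
    (g : ℝ → ℝ≥0∞) (ℓ : FiniteMeasure X → FiniteMeasure X → ℝ≥0∞)
    (hg : ConvexOn ℝ≥0 Set.univ g) (hmono : Monotone g)
    (hℓ : ∀ μ ν : FiniteMeasure X, g (tvDist μ ν) ≤ ℓ μ ν) :
    g c ≤ minimaxRisk n Q ProbabilityMeasure.toFiniteMeasure ℓ := by
  classical
  refine le_iInf₂ fun T hT => ?_
  set ν : (Fin m → Bool) → Measure (Fin n → X) :=
    fun ε => Measure.pi fun _ : Fin n => (μ ε : Measure X) with hν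
  set L : (Fin m → Bool) → (Fin n → X) → ℝ≥0∞ :=
    fun ε x => ℓ (T x) (μ ε).toFiniteMeasure with hL
  set S := ⨆ ξ ∈ Q, ∫⁻ x, ℓ (T x) ξ.toFiniteMeasure ∂(Measure.pi fun _ : Fin n => (ξ : Measure X))
  have hS : ∀ ε, ∫⁻ x, L ε x ∂(ν ε) ≤ S := fun ε =>
    le_iSup₂ (f := fun (ξ : ProbabilityMeasure X) (_ : ξ ∈ Q) =>
      ∫⁻ x, ℓ (T x) ξ.toFiniteMeasure ∂(Measure.pi fun _ : Fin n => (ξ : Measure X))) (μ ε) (hQ ε)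
  have hswap : ∀ J ε, (ν (flipOff J ε)).restrict (hitSet n W J) =
      (ν ε).restrict (hitSet n W J) := fun J ε =>
    pi_restrict_hitSet_congr J _ _ (hres J _ _ fun j hj => by simp [flipOff, hj])
  have hJ : ∀ J : Finset (Fin m), 2 * ∑ ε, g c * ν ε (hitSet n W J) ≤
      2 * ∑ ε, ∫⁻ x in hitSet n W J, L ε x ∂(ν ε) := by
    intro J
    -- A nonempty hit set forces `J.card ≤ n ≤ m / 2`, so at least half of the signs are unseen;
    -- this is where `2 * n ≤ m` enters.
    rcases (hitSet n W J).eq_empty_or_nonempty with he | ⟨x₀, hx₀⟩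
    · simp [he]
    have hcard : m ≤ 2 * Jᶜ.card := by
      have := card_le_of_mem_hitSet hWd hx₀
      rw [Finset.card_compl, Fintype.card_fin]
      omega
    -- Reindexing by the involution exchanges the two vectors of a pair, while the sample law on the
    -- hit set stays the same.
    have hflip : ∑ ε, ∫⁻ x in hitSet n W J, L ε x ∂(ν ε) =
        ∑ ε, ∫⁻ x in hitSet n W J, L (flipOff J ε) x ∂(ν ε) := by
      rw [← Equiv.sum_comp (flipOffEquiv J)]
      refine Finset.sum_congr rfl fun ε _ => ?_
      change ∫⁻ x in hitSet n W J, L (flipOff J ε) x ∂(ν (flipOff J ε)) = _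
      rw [hswap]
    calc 2 * ∑ ε, g c * ν ε (hitSet n W J)
        = ∑ ε, ∫⁻ _ in hitSet n W J, 2 * g c ∂(ν ε) := by
          simp [Finset.mul_sum, mul_assoc]
      _ ≤ ∑ ε, ∫⁻ x in hitSet n W J, (L ε x + L (flipOff J ε) x) ∂(ν ε) := by
          gcongr with ε _ x
          exact (tvDist_triangle_half g hg hmono (T x) _ _ (htv J ε hcard)).trans
            (add_le_add (hℓ _ _) (hℓ _ _))
      _ = ∑ ε, (∫⁻ x in hitSet n W J, L ε x ∂(ν ε) +
            ∫⁻ x in hitSet n W J, L (flipOff J ε) x ∂(ν ε)) := by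
          refine Finset.sum_congr rfl fun ε _ => ?_
          exact lintegral_add_left' (hT (μ ε) (hQ ε)).restrict _
      _ = 2 * ∑ ε, ∫⁻ x in hitSet n W J, L ε x ∂(ν ε) := by
          rw [Finset.sum_add_distrib, ← hflip, two_mul]
  have hJ' : ∀ J : Finset (Fin m), ∑ ε, g c * ν ε (hitSet n W J) ≤
      ∑ ε, ∫⁻ x in hitSet n W J, L ε x ∂(ν ε) := fun J =>
    (ENNReal.mul_le_mul_iff_right two_ne_zero ENNReal.ofNat_ne_top).1 (hJ J)
  -- The Bayes risk for the uniform prior is at most the supremum over the model; the number of sign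
  -- vectors is kept as a common factor.
  have htot : ∑ _ε : Fin m → Bool, g c ≤ ∑ _ε : Fin m → Bool, S := by
    calc ∑ _ε : Fin m → Bool, g c
        = ∑ ε, ∫⁻ _, g c ∂(ν ε) := by simp [hν]
      _ = ∑ ε, ∑ J : Finset (Fin m), g c * ν ε (hitSet n W J) := by
          refine Finset.sum_congr rfl fun ε _ => ?_
          rw [lintegral_eq_sum_hitSet hW]
          simp
      _ = ∑ J : Finset (Fin m), ∑ ε, g c * ν ε (hitSet n W J) := Finset.sum_comm
      _ ≤ ∑ J : Finset (Fin m), ∑ ε, ∫⁻ x in hitSet n W J, L ε x ∂(ν ε) :=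
          Finset.sum_le_sum fun J _ => hJ' J
      _ = ∑ ε, ∑ J : Finset (Fin m), ∫⁻ x in hitSet n W J, L ε x ∂(ν ε) := Finset.sum_comm
      _ = ∑ ε, ∫⁻ x, L ε x ∂(ν ε) := by
          refine Finset.sum_congr rfl fun ε _ => ?_
          rw [← lintegral_eq_sum_hitSet hW]
      _ ≤ ∑ _ε : Fin m → Bool, S := Finset.sum_le_sum fun ε _ => hS ε
  simp only [Finset.sum_const, nsmul_eq_mul] at htot
  exact (ENNReal.mul_le_mul_iff_right (by simp) (ENNReal.natCast_ne_top _)).1 htot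

/-! ### Besov norms of constant functions -/

theorem differential_const_succ {D : ℕ} (M : Set (Space D)) (a : ℝ) (i : ℕ) :
    differential M (fun _ => a) (i + 1) = 0 := by
  induction i with
  | zero =>
    funext x
    have h : differential M (fun _ => a) 0 =
        fun _ => ContinuousMultilinearMap.constOfIsEmpty ℝ (fun _ : Fin 0 => Space D) a := rfl
    ext v
    simp [differential]
  | succ i ih =>
    funext x
    rw [differential, ih]
    ext v
    simp

theorem smoothSobolevNorm_const_le {D : ℕ} (d l : ℕ) (p : ℝ) (M : Set (Space D)) (a : ℝ) :
    smoothSobolevNorm d l p M (fun _ => a) ≤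
      eLpNorm (fun _ : Space D => a) (ENNReal.ofReal p) (volM d M) := by
  refine iSup_le fun ⟨i, hi⟩ => ?_
  rcases i with _ | i
  · refine (eLpNorm_congr_norm_ae (Eventually.of_forall fun x => ?_)).le
    simp [differential]
  · rw [differential_const_succ]
    refine eLpNorm_mono fun x => ?_
    rw [Pi.zero_apply, norm_zero]
    exact norm_nonneg _

theorem isSobolevApprox_const {D : ℕ} (d l : ℕ) (p : ℝ) (M : Set (Space D)) (a : ℝ)
    [IsFiniteMeasure (volM d M)] :
    IsSobolevApprox d l p M (fun _ => a) (fun _ _ => a) where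
  smooth _ := contDiffOn_const
  finite _ := (smoothSobolevNorm_const_le d l p M a).trans_lt (memLp_const a).2
  cauchy ε hε := by
    refine ⟨0, fun m _ n _ => ?_⟩
    have h : ((fun _ => a) - fun _ => a : Space D → ℝ) = fun _ => (0 : ℝ) := by
      funext x
      simp
    rw [h]
    exact (smoothSobolevNorm_const_le d l p M 0).trans_lt (by simpa using hε)
  tendsto := by simp

theorem sobolevNorm_const_le {D : ℕ} (d l : ℕ) (p : ℝ) (M : Set (Space D)) (a : ℝ)
    [IsFiniteMeasure (volM d M)] :
    sobolevNorm d l p M (fun _ => a) ≤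
      eLpNorm (fun _ : Space D => a) (ENNReal.ofReal p) (volM d M) := by
  refine (iInf₂_le _ (isSobolevApprox_const d l p M a)).trans ?_
  rw [limsup_const]
  exact smoothSobolevNorm_const_le d l p M a

/-- For `t ≥ 1` the constant is put entirely in the `L_p` component, for `t ≤ 1` entirely in the
Sobolev component; its Sobolev norm is at most its `L_p` norm because its differentials of positive
order vanish. -/
theorem kFunctional_const_le {D : ℕ} (d l : ℕ) (p : ℝ) (M : Set (Space D)) (a t : ℝ)
    [IsFiniteMeasure (volM d M)] :
    kFunctional d l p M (fun _ => a) t ≤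
      ENNReal.ofReal (min 1 t) *
        eLpNorm (fun _ : Space D => a) (ENNReal.ofReal p) (volM d M) := by
  have hmem : ∀ b : ℝ, MemSobolev d l p M (fun _ => b) := fun b =>
    ⟨memLp_const b, _, isSobolevApprox_const d l p M b⟩
  unfold kFunctional
  rcases le_total 1 t with ht | ht
  · rw [min_eq_left ht, ENNReal.ofReal_one, one_mul]
    have hz : sobolevNorm d l p M (fun _ => (0 : ℝ)) = 0 := by
      have := sobolevNorm_const_le d l p M 0
      simpa using this
    refine iInf_le_of_le (fun _ => a) ?_
    refine iInf_le_of_le (fun _ => 0) ?_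
    refine iInf_le_of_le (memLp_const a) ?_
    refine iInf_le_of_le (hmem 0) ?_
    refine iInf_le_of_le (Eventually.of_forall fun x => by simp) ?_
    rw [hz, mul_zero, add_zero]
  · rw [min_eq_right ht]
    refine iInf_le_of_le (fun _ => 0) ?_
    refine iInf_le_of_le (fun _ => a) ?_
    refine iInf_le_of_le (memLp_const 0) ?_
    refine iInf_le_of_le (hmem a) ?_
    refine iInf_le_of_le (Eventually.of_forall fun x => by simp) ?_
    simpa using mul_le_mul_right (sobolevNorm_const_le d l p M a) (ENNReal.ofReal t)

/-- The integrand is `t ^ (-σ)` on `(0, 1]`, integrable since `σ < 1`, and `t ^ (-σ - 1)` beyond,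
integrable since `σ > 0`. -/
theorem lintegral_rpow_neg_mul_min_lt_top {σ : ℝ} (h0 : 0 < σ) (h1 : σ < 1) :
    ∫⁻ t in Ioi (0 : ℝ), ENNReal.ofReal (t⁻¹ * (t ^ (-σ) * min 1 t)) < ⊤ := by
  have hsplit : Ioi (0 : ℝ) = Ioc 0 1 ∪ Ioi 1 := (Ioc_union_Ioi_eq_Ioi zero_le_one).symm
  have hA : IntegrableOn (fun t : ℝ => t ^ (-σ)) (Ioc 0 1) :=
    (intervalIntegrable_iff_integrableOn_Ioc_of_le zero_le_one).1
      (intervalIntegral.intervalIntegrable_rpow' (by linarith))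
  have hB : IntegrableOn (fun t : ℝ => t ^ (-σ - 1)) (Ioi 1) :=
    integrableOn_Ioi_rpow_of_lt (by linarith) zero_lt_one
  rw [hsplit]
  refine (lintegral_union_le _ _ _).trans_lt (ENNReal.add_lt_top.2 ⟨?_, ?_⟩)
  · refine lt_of_le_of_lt (setLIntegral_mono' measurableSet_Ioc fun t ht => ?_) hA.2
    rw [← ofReal_norm, Real.norm_of_nonneg (Real.rpow_nonneg ht.1.le _), min_eq_right ht.2]
    refine ENNReal.ofReal_le_ofReal (le_of_eq ?_)
    field_simp [ht.1.ne']
  · refine lt_of_le_of_lt (setLIntegral_mono' measurableSet_Ioi fun t ht => ?_) hB.2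
    have ht0 : 0 < t := zero_lt_one.trans ht
    rw [← ofReal_norm, Real.norm_of_nonneg (Real.rpow_nonneg ht0.le _), min_eq_left (mem_Ioi.1 ht).le,
      Real.rpow_sub_one ht0.ne', mul_one]
    refine ENNReal.ofReal_le_ofReal (le_of_eq ?_)
    field_simp

theorem rpow_neg_mul_min_le_one {σ t : ℝ} (h0 : 0 < σ) (h1 : σ < 1) (ht : 0 < t) :
    t ^ (-σ) * min 1 t ≤ 1 := by
  rcases le_total 1 t with h | h
  · rw [min_eq_left h, mul_one]
    exact Real.rpow_le_one_of_one_le_of_nonpos h (by linarith)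
  · rw [min_eq_right h]
    calc t ^ (-σ) * t = t ^ (-σ + 1) := by rw [Real.rpow_add_one ht.ne']
      _ ≤ 1 := Real.rpow_le_one ht.le h (by linarith)

/-- The function is at most `1`, which settles `q = ⊤`; for finite `q ≥ 1` its `q`-th power is then
at most itself, which reduces to the integral for `q = 1`. -/
theorem eLpNorm_rpow_neg_mul_min_lt_top {σ : ℝ} (h0 : 0 < σ) (h1 : σ < 1) {q : ℝ≥0∞}
    (hq : 1 ≤ q) :
    eLpNorm (fun t : ℝ => t ^ (-σ) * min 1 t) q
      ((volume.restrict (Ioi (0 : ℝ))).withDensity fun t => ENNReal.ofReal t⁻¹) < ⊤ := by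
  have hpos : ∀ t : ℝ, 0 < t → 0 ≤ t ^ (-σ) * min 1 t := fun t ht => by positivity
  have hae : ∀ᵐ t ∂((volume.restrict (Ioi (0 : ℝ))).withDensity fun t => ENNReal.ofReal t⁻¹),
      0 < t :=
    (withDensity_absolutelyContinuous _ _).ae_le (ae_restrict_mem measurableSet_Ioi)
  have hle : ∀ᵐ t ∂((volume.restrict (Ioi (0 : ℝ))).withDensity fun t => ENNReal.ofReal t⁻¹),
      ‖t ^ (-σ) * min 1 t‖ₑ ≤ 1 := by
    filter_upwards [hae] with t ht
    rw [← ofReal_norm, Real.norm_of_nonneg (hpos t ht)]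
    exact ENNReal.ofReal_le_one.2 (rpow_neg_mul_min_le_one h0 h1 ht)
  rcases eq_or_ne q ⊤ with rfl | hqt
  · rw [eLpNorm_exponent_top]
    exact (essSup_le_of_ae_le 1 hle).trans_lt ENNReal.one_lt_top
  · have hq0 : q ≠ 0 := (zero_lt_one.trans_le hq).ne'
    rw [eLpNorm_lt_top_iff_lintegral_rpow_enorm_lt_top hq0 hqt]
    have hq1 : 1 ≤ q.toReal := by
      rw [← ENNReal.toReal_one]
      exact ENNReal.toReal_mono hqt hq
    calc ∫⁻ t, ‖t ^ (-σ) * min 1 t‖ₑ ^ q.toReal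
          ∂((volume.restrict (Ioi (0 : ℝ))).withDensity fun t => ENNReal.ofReal t⁻¹)
        ≤ ∫⁻ t, ‖t ^ (-σ) * min 1 t‖ₑ
          ∂((volume.restrict (Ioi (0 : ℝ))).withDensity fun t => ENNReal.ofReal t⁻¹) := by
          refine lintegral_mono_ae ?_
          filter_upwards [hle] with t ht
          exact ENNReal.rpow_le_self_of_le_one ht hq1
      _ = ∫⁻ t in Ioi (0 : ℝ), ENNReal.ofReal (t⁻¹ * (t ^ (-σ) * min 1 t)) := by
          rw [lintegral_withDensity_eq_lintegral_mul _ (by fun_prop) (by fun_prop)]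
          refine setLIntegral_congr_fun measurableSet_Ioi fun t ht => ?_
          have ht' : 0 < t := ht
          simp only [Pi.mul_apply]
          rw [← ofReal_norm, Real.norm_of_nonneg (hpos t ht), ← ENNReal.ofReal_mul (by positivity)]
      _ < ⊤ := lintegral_rpow_neg_mul_min_lt_top h0 h1

/-- The Besov norm of a constant function is controlled by its `L_p` norm. -/
theorem exists_besovNorm_const_le {k : ℕ} {s : ℝ} {q : ℝ≥0∞} (hs : 0 < s) (hsk : s < k)
    (hq : 1 ≤ q) :
    ∃ N : ℝ≥0∞, N < ⊤ ∧ ∀ {D : ℕ} (d : ℕ) (p : ℝ) (M : Set (Space D)) (a : ℝ)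
      [IsFiniteMeasure (volM d M)], besovNorm d k s p q M (fun _ => a) ≤
        eLpNorm (fun _ : Space D => a) (ENNReal.ofReal p) (volM d M) * N := by
  have hk : (0 : ℝ) < k := hs.trans hsk
  refine ⟨_, eLpNorm_rpow_neg_mul_min_lt_top (div_pos hs hk) ((div_lt_one hk).2 hsk) hq, ?_⟩
  intro D d p M a _
  set A := eLpNorm (fun _ : Space D => a) (ENNReal.ofReal p) (volM d M) with hA
  have hAt : A ≠ ⊤ := (memLp_const a).2.ne
  have hAe : A = ‖A.toReal‖ₑ := by
    rw [← ofReal_norm, Real.norm_of_nonneg ENNReal.toReal_nonneg, ENNReal.ofReal_toReal hAt]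
  rw [hAe, ← eLpNorm_const_smul]
  refine eLpNorm_mono_enorm_ae ?_
  filter_upwards [(withDensity_absolutelyContinuous _ _).ae_le (ae_restrict_mem measurableSet_Ioi)]
    with t ht
  have ht' : 0 < t := ht
  rw [Pi.smul_apply, smul_eq_mul, enorm_mul, ← hAe, enorm_eq_self, enorm_mul,
    ← ofReal_norm (t ^ _), ← ofReal_norm (min 1 t), Real.norm_of_nonneg (by positivity),
    Real.norm_of_nonneg (by positivity), mul_left_comm]
  refine mul_le_mul_right ?_ _
  rw [mul_comm]
  exact kFunctional_const_le d k p M a t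

/-! ### Smooth dependence on parameters -/

/-- The root of a smooth equation that is strictly monotone in the last variable is a smooth
function of the parameters. -/
theorem exists_contDiffOn_root {X : Type*} [NormedAddCommGroup X] [NormedSpace ℝ X]
    [CompleteSpace X] {Θ : X × ℝ → ℝ} (hΘ : ContDiff ℝ ∞ Θ) {Ω : Set X} (hΩ : IsOpen Ω)
    {a b : ℝ} (hab : a < b) (ha : ∀ p ∈ Ω, 0 < Θ (p, a)) (hb : ∀ p ∈ Ω, Θ (p, b) < 0)
    (hd : ∀ p ∈ Ω, ∀ t ∈ Icc a b, deriv (fun s => Θ (p, s)) t < 0) :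
    ∃ t : X → ℝ, ContDiffOn ℝ ∞ t Ω ∧
      ∀ p ∈ Ω, t p ∈ Ioo a b ∧ Θ (p, t p) = 0 ∧ ∀ s ∈ Icc a b, Θ (p, s) = 0 → s = t p := by
  have hdiff : Differentiable ℝ Θ := hΘ.differentiable (by simp)
  have hderiv : ∀ p t, HasDerivAt (fun s => Θ (p, s)) (fderiv ℝ Θ (p, t) (0, 1)) t := by
    intro p t
    have h1 : HasDerivAt (fun s : ℝ => ((p, s) : X × ℝ)) (0, 1) t :=
      (hasDerivAt_const t p).prodMk (hasDerivAt_id t)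
    exact (hdiff (p, t)).hasFDerivAt.comp_hasDerivAt t h1
  have hanti : ∀ p ∈ Ω, StrictAntiOn (fun s => Θ (p, s)) (Icc a b) := by
    intro p hp
    refine strictAntiOn_of_deriv_neg (convex_Icc a b)
      (fun t _ => (hderiv p t).continuousAt.continuousWithinAt) fun t ht => ?_
    exact hd p hp t (interior_subset ht)
  have hex : ∀ p ∈ Ω, ∃ t ∈ Ioo a b, Θ (p, t) = 0 := by
    intro p hp
    have hc : ContinuousOn (fun s => Θ (p, s)) (Icc a b) :=
      fun t _ => (hderiv p t).continuousAt.continuousWithinAt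
    obtain ⟨t, ht, h0⟩ := intermediate_value_Ioo' hab.le hc ⟨hb p hp, ha p hp⟩
    exact ⟨t, ht, h0⟩
  choose! t ht h0 using hex
  have huniq : ∀ p ∈ Ω, ∀ s ∈ Icc a b, Θ (p, s) = 0 → s = t p := fun p hp s hs hs0 =>
    (hanti p hp).injOn hs (Ioo_subset_Icc_self (ht p hp)) (hs0.trans (h0 p hp).symm)
  refine ⟨t, fun p hp => ?_, fun p hp => ⟨ht p hp, h0 p hp, huniq p hp⟩⟩
  have hinv : (fderiv ℝ Θ (p, t p) ∘L .inr ℝ X ℝ).IsInvertible := by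
    have hne := (hd p hp (t p) (Ioo_subset_Icc_self (ht p hp))).ne
    rw [(hderiv p (t p)).deriv] at hne
    refine ⟨ContinuousLinearEquiv.unitsEquivAut ℝ (Units.mk0 _ hne), ?_⟩
    ext
    simp
  have hcd : ContDiffAt ℝ ∞ Θ (p, t p) := hΘ.contDiffAt
  have himp := hcd.contDiffAt_implicitFunction (by simp) hinv
  refine ContDiffAt.contDiffWithinAt (himp.congr_of_eventuallyEq ?_)
  have hself : hcd.implicitFunction (by simp) hinv p = t p :=
    hcd.implicitFunction_apply_self (by simp) hinv
  -- The local implicit function stays in `(a, b)` near `p`, so uniqueness of the root there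
  -- identifies it with the global `t`.
  have hIoo : ∀ᶠ y in 𝓝 p, hcd.implicitFunction (by simp) hinv y ∈ Ioo a b :=
    himp.continuousAt.eventually_mem (by
      rw [hself]
      exact Ioo_mem_nhds (ht p hp).1 (ht p hp).2)
  filter_upwards [hIoo, hcd.eventually_apply_implicitFunction (by simp) hinv, hΩ.mem_nhds hp]
    with y hy hy0 hyΩ
  exact (huniq y hyΩ _ (Ioo_subset_Icc_self hy) (hy0.trans (h0 p hp))).symm

/-- Partial iterated derivatives of a jointly smooth function are jointly smooth. -/
theorem contDiffOn_iteratedFDeriv_partial {X V W : Type*} [NormedAddCommGroup X] [NormedSpace ℝ X]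
    [NormedAddCommGroup V] [NormedSpace ℝ V] [NormedAddCommGroup W] [NormedSpace ℝ W]
    {f : X × V → W} {Ω : Set (X × V)} (hΩ : IsOpen Ω) (hf : ContDiffOn ℝ ∞ f Ω) (i : ℕ) :
    ContDiffOn ℝ ∞ (fun p : X × V => iteratedFDeriv ℝ i (fun v => f (p.1, v)) p.2) Ω := by
  induction i with
  | zero =>
    simp only [iteratedFDeriv_zero_eq_comp, Function.comp_apply]
    exact (continuousMultilinearCurryFin0 ℝ V W).symm.contDiff.comp_contDiffOn hf
  | succ i ih =>
    simp only [iteratedFDeriv_succ_eq_comp_left, Function.comp_apply]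
    refine ContDiff.comp_contDiffOn (LinearIsometryEquiv.contDiff (𝕜 := ℝ)
      (E := V →L[ℝ] V [×i]→L[ℝ] W) (F := V [×(i + 1)]→L[ℝ] W) (n := ∞)
      (continuousMultilinearCurryLeftEquiv ℝ (fun _ : Fin (i + 1) => V) W).symm) fun p hp => ?_
    refine ContDiffAt.contDiffWithinAt ?_
    have h1 : ContDiffAt ℝ ∞ (fun p : X × V => iteratedFDeriv ℝ i (fun v => f (p.1, v)) p.2)
        (p.1, p.2) := (ih p hp).contDiffAt (hΩ.mem_nhds hp)
    -- The differentiation variable is separated from the parameter `p` and afterwards specialised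
    -- to `p.2`.
    have h2 : ContDiffAt ℝ ∞ (Function.uncurry fun (p : X × V) (v : V) =>
        iteratedFDeriv ℝ i (fun v => f (p.1, v)) v) (p, p.2) :=
      h1.comp (p, p.2) (f := fun z : (X × V) × V => (z.1.1, z.2)) (by fun_prop)
    exact ContDiffAt.fderiv h2 contDiffAt_snd (by simp)

/-- The inclusion of `T` has norm at most `1`. Derivatives on the varying tangent planes are thus
controlled by derivatives in the fixed ambient space, where compactness arguments can be run. -/
theorem norm_iteratedFDeriv_comp_subtype_le {V W : Type*} [NormedAddCommGroup V]
    [NormedSpace ℝ V] [NormedAddCommGroup W] [NormedSpace ℝ W] (T : Submodule ℝ V) {f : V → W}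
    {s : Set V} (hs : IsOpen s) (hf : ContDiffOn ℝ ∞ f s) (i : ℕ) {u : T} (hu : (u : V) ∈ s) :
    ‖iteratedFDeriv ℝ i (fun v : T => f v) u‖ ≤ ‖iteratedFDeriv ℝ i f u‖ := by
  have hs' : IsOpen (T.subtypeL ⁻¹' s) := hs.preimage T.subtypeL.continuous
  have h := T.subtypeL.iteratedFDerivWithin_comp_right hf hs.uniqueDiffOn hs'.uniqueDiffOn
    (x := u) hu (i := i) (by exact_mod_cast le_top)
  rw [iteratedFDerivWithin_of_isOpen i hs' hu, iteratedFDerivWithin_of_isOpen i hs (x := T.subtypeL u) hu] at h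
  have h' : iteratedFDeriv ℝ i (fun v : T => f v) u =
      (iteratedFDeriv ℝ i f u).compContinuousLinearMap fun _ => T.subtypeL := h
  rw [h']
  refine (ContinuousMultilinearMap.norm_compContinuousLinearMap_le _ _).trans ?_
  refine mul_le_of_le_one_right (norm_nonneg _) (Finset.prod_le_one (fun _ _ => norm_nonneg _) ?_)
  exact fun _ _ => T.norm_subtypeL_le

/-! ### Perturbed spheres and their heights over tangent planes -/

open scoped Gradient RealInnerProductSpace

noncomputable section

/-- The coordinate subspace of `ℝ^D` of dimension `d + 1`. -/
def coordSubspace (d D : ℕ) : Submodule ℝ (Space D) where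
  carrier := {y | ∀ i : Fin D, d < (i : ℕ) → y i = 0}
  add_mem' {a b} ha hb i hi := by simp [ha i hi, hb i hi]
  zero_mem' i _ := by simp
  smul_mem' c a ha i hi := by simp [ha i hi]

variable {d D : ℕ} {H : Space D → ℝ} {R η : ℝ}

/-- The perturbed sphere `‖y‖² = R² + η H(y)` in the coordinate subspace. -/
def perturbedSphere (d : ℕ) (H : Space D → ℝ) (R η : ℝ) : Set (Space D) :=
  {y | y ∈ coordSubspace d D ∧ ‖y‖ ^ 2 = R ^ 2 + η * H y}

/-- A normal vector of the perturbed sphere inside the coordinate subspace. -/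
def normalVec (d : ℕ) (H : Space D → ℝ) (η : ℝ) (x : Space D) : Space D :=
  x - (η / 2) • (coordSubspace d D).starProjection (∇ H x)

/-- The perturbation `η H` is small in `C²` with respect to the radius `R`. -/
structure IsTame (H : Space D → ℝ) (R η : ℝ) : Prop where
  pos : 0 < R
  smooth : ContDiff ℝ ∞ H
  bound : ∀ y, |η * H y| ≤ R ^ 2 / 100
  grad : ∀ y, |η| * ‖∇ H y‖ ≤ R / 100
  lip : ∀ y z, |η * (H z - H y)| ≤ R / 100 * ‖z - y‖
  taylor : ∀ y z, |η * (H z - H y - ⟪∇ H y, z - y⟫)| ≤ ‖z - y‖ ^ 2 / 100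

theorem contDiff_gradient (hH : ContDiff ℝ ∞ H) : ContDiff ℝ ∞ (∇ H) :=
  (InnerProductSpace.toDual ℝ (Space D)).symm.contDiff.comp (hH.fderiv_right (by simp))

theorem norm_gradient (y : Space D) : ‖∇ H y‖ = ‖fderiv ℝ H y‖ :=
  LinearIsometryEquiv.norm_map _ _

theorem exists_bound_lipschitz {E F : Type*} [NormedAddCommGroup E] [NormedSpace ℝ E]
    [NormedAddCommGroup F] [NormedSpace ℝ F] {f : E → F} (hf : ContDiff ℝ ∞ f)
    (hc : HasCompactSupport f) :
    ∃ C : ℝ, (∀ y, ‖f y‖ ≤ C) ∧ ∀ y z, ‖f z - f y‖ ≤ C * ‖z - y‖ := by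
  have hf1 : ContDiff ℝ ∞ (fderiv ℝ f) := hf.fderiv_right (by simp)
  obtain ⟨C₀, hC₀⟩ := hc.exists_bound_of_continuous hf.continuous
  obtain ⟨C₁, hC₁⟩ := (hc.fderiv ℝ).exists_bound_of_continuous hf1.continuous
  refine ⟨max C₀ C₁, fun y => (hC₀ y).trans (le_max_left _ _), fun y z => ?_⟩
  exact convex_univ.norm_image_sub_le_of_norm_fderiv_le
    (fun w _ => hf.differentiable (by simp) w) (fun w _ => (hC₁ w).trans (le_max_right _ _))
    (mem_univ y) (mem_univ z)

theorem exists_bound_fderiv (hH : ContDiff ℝ ∞ H) (hc : HasCompactSupport H) :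
    ∃ C : ℝ, 1 ≤ C ∧ (∀ y, |H y| ≤ C) ∧ (∀ y, ‖fderiv ℝ H y‖ ≤ C) ∧
      ∀ y z, ‖fderiv ℝ H z - fderiv ℝ H y‖ ≤ C * ‖z - y‖ := by
  have hH1 : ContDiff ℝ ∞ (fderiv ℝ H) := hH.fderiv_right (by simp)
  obtain ⟨C₀, hC₀, -⟩ := exists_bound_lipschitz hH hc
  obtain ⟨C₁, hC₁, hL₁⟩ := exists_bound_lipschitz hH1 (hc.fderiv ℝ)
  have hC1 : C₁ ≤ max 1 (max C₀ C₁) := (le_max_right _ _).trans (le_max_right _ _)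
  refine ⟨max 1 (max C₀ C₁), le_max_left _ _,
    fun y => (hC₀ y).trans ((le_max_left _ _).trans (le_max_right _ _)),
    fun y => (hC₁ y).trans hC1, fun y z => (hL₁ y z).trans ?_⟩
  exact mul_le_mul_of_nonneg_right hC1 (norm_nonneg _)

/-- The Lipschitz field is the mean value inequality; the Taylor field is the same inequality
applied to `H` minus its differential at `y`, on the ball of radius `‖z - y‖`. -/
theorem isTame_of_bounds (hH : ContDiff ℝ ∞ H) (hR : 0 < R) {C : ℝ} (h0 : ∀ y, |H y| ≤ C)
    (h1 : ∀ y, ‖fderiv ℝ H y‖ ≤ C) (h2 : ∀ y z, ‖fderiv ℝ H z - fderiv ℝ H y‖ ≤ C * ‖z - y‖)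
    (k1 : |η| * C ≤ R ^ 2 / 100) (k2 : |η| * C ≤ R / 100) (k3 : |η| * C ≤ 1 / 100) :
    IsTame H R η := by
  have hdiff : Differentiable ℝ H := hH.differentiable (by simp)
  have hη0 := abs_nonneg η
  refine ⟨hR, hH, fun y => ?_, fun y => ?_, fun y z => ?_, fun y z => ?_⟩
  · rw [abs_mul]
    exact (mul_le_mul_of_nonneg_left (h0 y) hη0).trans k1
  · rw [norm_gradient]
    exact (mul_le_mul_of_nonneg_left (h1 y) hη0).trans k2
  · have h := convex_univ.norm_image_sub_le_of_norm_fderiv_le (f := H) (C := C)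
      (fun w _ => hdiff w) (fun w _ => h1 w) (mem_univ y) (mem_univ z)
    rw [abs_mul]
    calc |η| * |H z - H y| ≤ |η| * (C * ‖z - y‖) := mul_le_mul_of_nonneg_left h hη0
      _ = (|η| * C) * ‖z - y‖ := by ring
      _ ≤ _ := mul_le_mul_of_nonneg_right k2 (norm_nonneg _)
  · have hC : 0 ≤ C := (norm_nonneg _).trans (h1 0)
    have h := (convex_closedBall y ‖z - y‖).norm_image_sub_le_of_norm_fderiv_le' (f := H)
      (φ := fderiv ℝ H y) (C := C * ‖z - y‖) (fun w _ => hdiff w)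
      (fun w hw => (h2 y w).trans
        (mul_le_mul_of_nonneg_left (mem_closedBall_iff_norm.1 hw) hC))
      (Metric.mem_closedBall_self (norm_nonneg _)) (mem_closedBall_iff_norm.2 le_rfl)
    rw [abs_mul, inner_gradient_left]
    calc |η| * |H z - H y - fderiv ℝ H y (z - y)|
        ≤ |η| * (C * ‖z - y‖ * ‖z - y‖) := mul_le_mul_of_nonneg_left h hη0
      _ = (|η| * C) * ‖z - y‖ ^ 2 := by ring
      _ ≤ 1 / 100 * ‖z - y‖ ^ 2 := mul_le_mul_of_nonneg_right k3 (sq_nonneg _)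
      _ = _ := by ring

theorem exists_forall_isTame (hH : ContDiff ℝ ∞ H) (hc : HasCompactSupport H) (hR : 0 < R) :
    ∃ η₀ > 0, ∀ η, |η| < η₀ → IsTame H R η := by
  obtain ⟨C, hC, h0, h1, h2⟩ := exists_bound_fderiv hH hc
  have hCpos : 0 < C := zero_lt_one.trans_le hC
  have k1 : min (R ^ 2 / 100) (min (R / 100) (1 / 100)) ≤ R ^ 2 / 100 := min_le_left _ _
  have k2 : min (R ^ 2 / 100) (min (R / 100) (1 / 100)) ≤ R / 100 :=
    (min_le_right _ _).trans (min_le_left _ _)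
  have k3 : min (R ^ 2 / 100) (min (R / 100) (1 / 100)) ≤ (1 / 100 : ℝ) :=
    (min_le_right _ _).trans (min_le_right _ _)
  refine ⟨min (R ^ 2 / 100) (min (R / 100) (1 / 100)) / C, by positivity, fun η hη => ?_⟩
  rw [lt_div_iff₀ hCpos] at hη
  exact isTame_of_bounds hH hR h0 h1 h2 (hη.le.trans k1) (hη.le.trans k2) (hη.le.trans k3)

theorem isTame_zero (hR : 0 < R) (η : ℝ) : IsTame (0 : Space D → ℝ) R η where
  pos := hR
  smooth := contDiff_const
  bound y := by simp; positivity
  grad y := by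
    have : ∇ (0 : Space D → ℝ) y = 0 := gradient_fun_const y 0
    rw [this]
    simp
    positivity
  lip y z := by simp; positivity
  taylor y z := by
    have : ∇ (0 : Space D → ℝ) y = 0 := gradient_fun_const y 0
    rw [this]
    simp
    positivity

theorem normalVec_zero (H : Space D → ℝ) (x : Space D) : normalVec d H 0 x = x := by
  simp [normalVec]

theorem normalVec_mem {x : Space D} (hx : x ∈ coordSubspace d D) :
    normalVec d H η x ∈ coordSubspace d D :=
  Submodule.sub_mem _ hx (Submodule.smul_mem _ _ (Submodule.starProjection_apply_mem _ _))

/-- On the coordinate subspace, `2 • normalVec` represents the differential of the defining function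
`‖y‖² - η H(y)`. -/
theorem inner_normalVec {v : Space D} (hv : v ∈ coordSubspace d D) (x : Space D) :
    2 * ⟪normalVec d H η x, v⟫ = 2 * ⟪x, v⟫ - η * ⟪∇ H x, v⟫ := by
  have h : ⟪(coordSubspace d D).starProjection (∇ H x), v⟫ = ⟪∇ H x, v⟫ := by
    rw [Submodule.inner_starProjection_left_eq_right,
      Submodule.starProjection_eq_self_iff.2 hv]
  rw [normalVec, inner_sub_left, real_inner_smul_left, h]
  ring

theorem IsTame.norm_sub_normalVec_le (h : IsTame H R η) (x : Space D) :
    ‖x - normalVec d H η x‖ ≤ R / 200 := by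
  have h1 : x - normalVec d H η x = (η / 2) • (coordSubspace d D).starProjection (∇ H x) := by
    rw [normalVec]
    abel
  have h2 := Submodule.norm_starProjection_apply_le (coordSubspace d D) (∇ H x)
  rw [h1, norm_smul, Real.norm_eq_abs, abs_div, abs_two]
  have h3 := h.grad x
  have h4 := mul_le_mul_of_nonneg_left h2 (abs_nonneg η)
  linarith

theorem IsTame.norm_bounds (h : IsTame H R η) {x : Space D} (hx : x ∈ perturbedSphere d H R η) :
    99 / 100 * R ≤ ‖x‖ ∧ ‖x‖ ≤ 101 / 100 * R := by
  have h1 := abs_le.1 (h.bound x)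
  have h2 := hx.2
  have h3 := h.pos
  have h4 := norm_nonneg x
  constructor <;> nlinarith

/-- The level function along the normal direction. -/
def normalLevel (d : ℕ) (H : Space D → ℝ) (R : ℝ) :
    ((Space D × ℝ) × Space D) × ℝ → ℝ := fun z =>
  ‖z.1.1.1 + z.1.2 - z.2 • normalVec d H z.1.1.2 z.1.1.1‖ ^ 2 - R ^ 2 -
    z.1.1.2 * H (z.1.1.1 + z.1.2 - z.2 • normalVec d H z.1.1.2 z.1.1.1)

/-- The domain of the parameters (base point, size of the perturbation, tangent vector). -/
def paramDomain (D : ℕ) (R η₀ : ℝ) : Set ((Space D × ℝ) × Space D) :=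
  {p | 9 / 10 * R < ‖p.1.1‖ ∧ ‖p.1.1‖ < 11 / 10 * R ∧ |p.1.2| < η₀ ∧ ‖p.2‖ < R / 8}

theorem isOpen_paramDomain (R η₀ : ℝ) : IsOpen (paramDomain D R η₀) := by
  have h1 : IsOpen {p : (Space D × ℝ) × Space D | 9 / 10 * R < ‖p.1.1‖} :=
    isOpen_lt (by fun_prop) (by fun_prop)
  have h2 : IsOpen {p : (Space D × ℝ) × Space D | ‖p.1.1‖ < 11 / 10 * R} :=
    isOpen_lt (by fun_prop) (by fun_prop)
  have h3 : IsOpen {p : (Space D × ℝ) × Space D | |p.1.2| < η₀} :=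
    isOpen_lt (by fun_prop) (by fun_prop)
  have h4 : IsOpen {p : (Space D × ℝ) × Space D | ‖p.2‖ < R / 8} :=
    isOpen_lt (by fun_prop) (by fun_prop)
  exact h1.inter (h2.inter (h3.inter h4))

theorem contDiff_normalVec (hH : ContDiff ℝ ∞ H) :
    ContDiff ℝ ∞ (fun p : Space D × ℝ => normalVec d H p.2 p.1) := by
  have h := contDiff_gradient hH
  have h2 : ContDiff ℝ ∞ (fun p : Space D × ℝ =>
      (coordSubspace d D).starProjection (∇ H p.1)) :=
    (coordSubspace d D).starProjection.contDiff.comp (h.comp contDiff_fst)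
  unfold normalVec
  fun_prop

theorem contDiff_normalLevel (hH : ContDiff ℝ ∞ H) : ContDiff ℝ ∞ (normalLevel d H R) := by
  have h : ContDiff ℝ ∞ (fun z : ((Space D × ℝ) × Space D) × ℝ =>
      normalVec d H z.1.1.2 z.1.1.1) :=
    (contDiff_normalVec hH).comp (contDiff_fst.comp contDiff_fst)
  have h2 : ContDiff ℝ ∞ (fun z : ((Space D × ℝ) × Space D) × ℝ =>
      z.1.1.1 + z.1.2 - z.2 • normalVec d H z.1.1.2 z.1.1.1) := by fun_prop
  unfold normalLevel
  exact ((h2.norm_sq ℝ).sub contDiff_const).sub (ContDiff.mul (by fun_prop) (hH.comp h2))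

theorem IsTame.hasDerivAt_normalLevel (h : IsTame H R η) (x u : Space D) (t : ℝ) :
    HasDerivAt (fun s => normalLevel d H R (((x, η), u), s))
      (-(2 * ⟪x + u - t • normalVec d H η x, normalVec d H η x⟫) +
        η * ⟪∇ H (x + u - t • normalVec d H η x), normalVec d H η x⟫) t := by
  set ν := normalVec d H η x
  have h1 : HasDerivAt (fun s : ℝ => x + u - s • ν) (-ν) t := by
    have := ((hasDerivAt_id t).smul_const ν).const_sub (x + u)
    simpa using this
  have h2 := (h.smooth.differentiable (by simp) (x + u - t • ν)).hasFDerivAt.comp_hasDerivAt t h1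
  have h3 := (h1.norm_sq.sub_const (R ^ 2)).sub (h2.const_mul η)
  refine h3.congr_deriv ?_
  rw [map_neg, inner_neg_right, inner_gradient_left]
  ring

/-- The moved point is `(1 - t) x` up to an error of about `R / 8`, so the derivative is dominated
by `-2 (1 - t) ‖x‖²` with `1 - t ≥ 1/2`. The vector `u` need not be tangent, nor `x` on the surface,
which keeps the parameter domain open. -/
theorem IsTame.deriv_normalLevel_neg (h : IsTame H R η) {x u : Space D} {t : ℝ}
    (hx1 : 9 / 10 * R < ‖x‖) (hx2 : ‖x‖ < 11 / 10 * R) (hu : ‖u‖ < R / 8)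
    (ht : t ∈ Icc (-(1 / 2) : ℝ) (1 / 2)) :
    deriv (fun s => normalLevel d H R (((x, η), u), s)) t < 0 := by
  rw [(h.hasDerivAt_normalLevel x u t).deriv]
  have hR := h.pos
  have hw := h.norm_sub_normalVec_le (d := d) x
  set ν := normalVec d H η x with hν
  set w := x - ν with hw'
  have hνw : ν = x - w := by rw [hw']; abel
  set y := x + u - t • ν with hy
  have hyw : y = (1 - t) • x + (u + t • w) := by
    rw [hy, hνw]
    module
  have htabs : |t| ≤ 1 / 2 := abs_le.2 ht
  have htw : ‖t • w‖ ≤ R / 400 := by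
    rw [norm_smul, Real.norm_eq_abs]
    nlinarith [norm_nonneg w, abs_nonneg t]
  have huw : ‖u + t • w‖ ≤ R / 8 + R / 400 := (norm_add_le _ _).trans (by linarith)
  have h1t : ‖(1 - t) • x‖ ≤ 3 / 2 * (11 / 10 * R) := by
    rw [norm_smul, Real.norm_eq_abs, abs_of_nonneg (by linarith [ht.2])]
    have : 1 - t ≤ 3 / 2 := by linarith [ht.1]
    gcongr
  have hyn : ‖y‖ ≤ 9 / 5 * R := by
    rw [hyw]
    exact (norm_add_le _ _).trans (by linarith)
  have hνn : ‖ν‖ ≤ 6 / 5 * R := by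
    rw [hνw]
    exact (norm_sub_le _ _).trans (by linarith)
  have e1 : ⟪y, ν⟫ = (1 - t) * ‖x‖ ^ 2 + ⟪u + t • w, x⟫ - ⟪y, w⟫ := by
    rw [hνw, inner_sub_right]
    congr 1
    rw [hyw, inner_add_left, real_inner_smul_left, real_inner_self_eq_norm_sq]
  have b1 : |⟪u + t • w, x⟫| ≤ (R / 8 + R / 400) * (11 / 10 * R) :=
    (abs_real_inner_le_norm _ _).trans (by gcongr)
  have b2 : |⟪y, w⟫| ≤ (9 / 5 * R) * (R / 200) :=
    (abs_real_inner_le_norm _ _).trans (by gcongr)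
  have b3 : |η * ⟪∇ H y, ν⟫| ≤ R / 100 * (6 / 5 * R) := by
    rw [abs_mul]
    calc |η| * |⟪∇ H y, ν⟫| ≤ |η| * (‖∇ H y‖ * ‖ν‖) := by
          gcongr
          exact abs_real_inner_le_norm _ _
      _ = |η| * ‖∇ H y‖ * ‖ν‖ := by ring
      _ ≤ _ := by
          gcongr
          exact h.grad y
  have b4 : 1 / 2 * (9 / 10 * R) ^ 2 ≤ (1 - t) * ‖x‖ ^ 2 := by
    have : 1 / 2 ≤ 1 - t := by linarith [ht.2]
    gcongr
  rw [e1]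
  have c1 := (abs_le.1 b1).1
  have c2 := (abs_le.1 b2).2
  have c3 := (abs_le.1 b3).2
  nlinarith [sq_nonneg R, mul_pos hR hR]

/-- At `t = -1/2` the point is near `(3/2) x`, well outside the sphere; at `t = 1/2` it is near `x /
2`, well inside. -/
theorem IsTame.normalLevel_endpoints (h : IsTame H R η) {x u : Space D}
    (hx1 : 9 / 10 * R < ‖x‖) (hx2 : ‖x‖ < 11 / 10 * R) (hu : ‖u‖ < R / 8) :
    0 < normalLevel d H R (((x, η), u), -(1 / 2)) ∧
      normalLevel d H R (((x, η), u), 1 / 2) < 0 := by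
  have hR := h.pos
  have hw := h.norm_sub_normalVec_le (d := d) x
  simp only [normalLevel]
  set ν := normalVec d H η x with hν
  set w := x - ν with hw'
  have hνw : ν = x - w := by rw [hw']; abel
  constructor
  · set y := x + u - (-(1 / 2) : ℝ) • ν with hy
    have hyw : (3 / 2 : ℝ) • x = y + ((1 / 2 : ℝ) • w - u) := by
      rw [hy, hνw]
      module
    have h1 : 3 / 2 * ‖x‖ ≤ ‖y‖ + (1 / 2 * ‖w‖ + ‖u‖) := by
      have e : 3 / 2 * ‖x‖ = ‖(3 / 2 : ℝ) • x‖ := by rw [norm_smul]; norm_num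
      have e2 : 1 / 2 * ‖w‖ = ‖(1 / 2 : ℝ) • w‖ := by rw [norm_smul]; norm_num
      rw [e, e2, hyw]
      exact (norm_add_le _ _).trans (by gcongr; exact norm_sub_le _ _)
    have h2 : 6 / 5 * R ≤ ‖y‖ := by linarith
    have h3 := (abs_le.1 (h.bound y)).2
    nlinarith [mul_pos hR hR]
  · set y := x + u - (1 / 2 : ℝ) • ν with hy
    have hyw : y = (1 / 2 : ℝ) • x + (u + (1 / 2 : ℝ) • w) := by
      rw [hy, hνw]
      module
    have h1 : ‖y‖ ≤ 1 / 2 * ‖x‖ + (‖u‖ + 1 / 2 * ‖w‖) := by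
      have e : 1 / 2 * ‖x‖ = ‖(1 / 2 : ℝ) • x‖ := by rw [norm_smul]; norm_num
      have e2 : 1 / 2 * ‖w‖ = ‖(1 / 2 : ℝ) • w‖ := by rw [norm_smul]; norm_num
      rw [e, e2, hyw]
      exact (norm_add_le _ _).trans (by gcongr; exact norm_add_le _ _)
    have h2 : ‖y‖ ≤ 7 / 10 * R := by linarith
    have h3 := (abs_le.1 (h.bound y)).1
    nlinarith [mul_pos hR hR, norm_nonneg y]

/-- `t` gives the height of the perturbed spheres over their tangent planes. -/
structure IsHeight (d : ℕ) (H : Space D → ℝ) (R η₀ : ℝ) (t : (Space D × ℝ) × Space D → ℝ) :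
    Prop where
  smooth : ContDiffOn ℝ ∞ t (paramDomain D R η₀)
  mem : ∀ p ∈ paramDomain D R η₀, t p ∈ Ioo (-(1 / 2) : ℝ) (1 / 2)
  zero : ∀ p ∈ paramDomain D R η₀, normalLevel d H R (p, t p) = 0
  unique : ∀ p ∈ paramDomain D R η₀, ∀ s ∈ Icc (-(1 / 2) : ℝ) (1 / 2),
    normalLevel d H R (p, s) = 0 → s = t p

/-- Base point and perturbation size are parameters of the implicit equation along with the tangent
vector. The joint smoothness is what later carries derivative bounds from `η = 0` to small `η`. -/
theorem exists_isHeight (d : ℕ) (hH : ContDiff ℝ ∞ H) {η₀ : ℝ}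
    (h : ∀ η, |η| < η₀ → IsTame H R η) : ∃ t, IsHeight d H R η₀ t := by
  obtain ⟨t, ht, ht'⟩ := exists_contDiffOn_root (contDiff_normalLevel (d := d) (R := R) hH)
    (isOpen_paramDomain R η₀) (a := -(1 / 2)) (b := 1 / 2) (by norm_num)
    (fun p hp => ((h _ hp.2.2.1).normalLevel_endpoints hp.1 hp.2.1 hp.2.2.2).1)
    (fun p hp => ((h _ hp.2.2.1).normalLevel_endpoints hp.1 hp.2.1 hp.2.2.2).2)
    (fun p hp t ht => (h _ hp.2.2.1).deriv_normalLevel_neg hp.1 hp.2.1 hp.2.2.2 ht)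
  exact ⟨t, ht, fun p hp => (ht' p hp).1, fun p hp => (ht' p hp).2.1,
    fun p hp => (ht' p hp).2.2⟩

end

/-! ### Tangent planes, local parametrizations and reach -/

noncomputable section

variable {d D : ℕ} {H : Space D → ℝ} {R η η₀ : ℝ} {t : (Space D × ℝ) × Space D → ℝ}

/-- The parametrization of the perturbed sphere as a graph over its tangent plane. -/
def graphMap (d : ℕ) (H : Space D → ℝ) (t : (Space D × ℝ) × Space D → ℝ)
    (p : (Space D × ℝ) × Space D) : Space D :=
  p.1.1 + p.2 - t p • normalVec d H p.1.2 p.1.1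

theorem IsHeight.contDiffOn_graphMap (ht : IsHeight d H R η₀ t) (hH : ContDiff ℝ ∞ H) :
    ContDiffOn ℝ ∞ (graphMap d H t) (paramDomain D R η₀) := by
  have h1 : ContDiff ℝ ∞ (fun p : (Space D × ℝ) × Space D => normalVec d H p.1.2 p.1.1) :=
    (contDiff_normalVec hH).comp contDiff_fst
  unfold graphMap
  exact ContDiffOn.sub (by fun_prop) (ht.smooth.smul h1.contDiffOn)

theorem IsTame.mem_paramDomain (h : IsTame H R η) (hη : |η| < η₀) {x u : Space D}
    (hx : x ∈ perturbedSphere d H R η) (hu : ‖u‖ < R / 8) :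
    ((x, η), u) ∈ paramDomain D R η₀ := by
  have h1 := h.norm_bounds hx
  have h2 := h.pos
  exact ⟨by simp only; linarith, by simp only; linarith, hη, hu⟩

theorem IsHeight.graphMap_mem (ht : IsHeight d H R η₀ t) {x u : Space D}
    (hx : x ∈ coordSubspace d D) (hu : u ∈ coordSubspace d D)
    (hp : ((x, η), u) ∈ paramDomain D R η₀) :
    graphMap d H t ((x, η), u) ∈ perturbedSphere d H R η := by
  refine ⟨Submodule.sub_mem _ (Submodule.add_mem _ hx hu)
    (Submodule.smul_mem _ _ (normalVec_mem hx)), ?_⟩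
  have h := ht.zero _ hp
  simp only [normalLevel] at h
  simp only [graphMap]
  linarith

theorem IsHeight.zero_eq (ht : IsHeight d H R η₀ t) (h : IsTame H R η) (hη : |η| < η₀)
    {x : Space D} (hx : x ∈ perturbedSphere d H R η) : t ((x, η), 0) = 0 := by
  have hp := h.mem_paramDomain hη hx (u := 0) (by simpa using h.pos)
  refine (ht.unique _ hp 0 ⟨by norm_num, by norm_num⟩ ?_).symm
  simp [normalLevel, hx.2]

theorem IsTame.normalVec_pos (h : IsTame H R η) {x : Space D}
    (hx : x ∈ perturbedSphere d H R η) : 9 / 10 * R ≤ ‖normalVec d H η x‖ := by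
  have h1 := h.norm_bounds hx
  have h2 := h.norm_sub_normalVec_le (d := d) x
  have h3 := norm_sub_norm_le x (normalVec d H η x)
  have h4 := h.pos
  linarith

theorem hasDerivAt_level (hH : ContDiff ℝ ∞ H) {c : ℝ → Space D} {c' : Space D} {s : ℝ}
    (hc : HasDerivAt c c' s) :
    HasDerivAt (fun s => ‖c s‖ ^ 2 - η * H (c s)) (2 * ⟪c s, c'⟫ - η * ⟪∇ H (c s), c'⟫) s := by
  have h2 := (hH.differentiable (by simp) (c s)).hasFDerivAt.comp_hasDerivAt s hc
  rw [inner_gradient_left]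
  exact hc.norm_sq.sub (h2.const_mul η)

/-- The curve is the graph map along the line `s ↦ s • v`. Its velocity is `v - τ ν`; since the
defining function is constant along it, `⟪ν, v - τ ν⟫ = 0`, and `v ⊥ ν` forces `τ = 0`. -/
theorem IsHeight.exists_curve (ht : IsHeight d H R η₀ t) (h : IsTame H R η) (hη : |η| < η₀)
    {x v : Space D} (hx : x ∈ perturbedSphere d H R η) (hv : v ∈ coordSubspace d D)
    (hvν : ⟪normalVec d H η x, v⟫ = 0) :
    ∃ c : ℝ → Space D, c 0 = x ∧ HasDerivAt c v 0 ∧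
      ∀ᶠ s in 𝓝 (0 : ℝ), c s ∈ perturbedSphere d H R η := by
  set ν := normalVec d H η x with hν
  have hp0 := h.mem_paramDomain hη hx (u := (0 : ℝ) • v) (by simpa using h.pos)
  have hline : Continuous fun s : ℝ => (((x, η), s • v) : (Space D × ℝ) × Space D) := by fun_prop
  have hev : ∀ᶠ s in 𝓝 (0 : ℝ), ((x, η), s • v) ∈ paramDomain D R η₀ :=
    hline.continuousAt.eventually_mem ((isOpen_paramDomain R η₀).mem_nhds hp0)
  have hmem : ∀ᶠ s in 𝓝 (0 : ℝ), graphMap d H t ((x, η), s • v) ∈ perturbedSphere d H R η :=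
    hev.mono fun s hs => ht.graphMap_mem hx.1 (Submodule.smul_mem _ _ hv) hs
  have hdt : DifferentiableAt ℝ (fun s : ℝ => t ((x, η), s • v)) 0 := by
    have h1 : DifferentiableAt ℝ t ((x, η), (0 : ℝ) • v) :=
      ((ht.smooth _ hp0).contDiffAt ((isOpen_paramDomain R η₀).mem_nhds hp0)).differentiableAt
        (by simp)
    exact h1.comp (0 : ℝ) (f := fun s : ℝ => (((x, η), s • v) : (Space D × ℝ) × Space D))
      (by fun_prop)
  set τ := deriv (fun s : ℝ => t ((x, η), s • v)) 0
  have hc : HasDerivAt (fun s : ℝ => graphMap d H t ((x, η), s • v)) (v - τ • ν) 0 := by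
    have h1 : HasDerivAt (fun s : ℝ => x + s • v) v 0 := by
      simpa using ((hasDerivAt_id (0 : ℝ)).smul_const v).const_add x
    exact h1.sub (hdt.hasDerivAt.smul_const ν)
  have hc0 : graphMap d H t ((x, η), (0 : ℝ) • v) = x := by
    simp [graphMap, ht.zero_eq h hη hx]
  have hlev := hasDerivAt_level (η := η) h.smooth hc
  have hconst : HasDerivAt (fun s : ℝ => ‖graphMap d H t ((x, η), s • v)‖ ^ 2 -
      η * H (graphMap d H t ((x, η), s • v))) 0 0 := by
    refine (hasDerivAt_const (0 : ℝ) (R ^ 2)).congr_of_eventuallyEq ?_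
    filter_upwards [hmem] with s hs
    rw [hs.2]
    ring
  have hzero := hlev.unique hconst
  have hE : v - τ • ν ∈ coordSubspace d D :=
    Submodule.sub_mem _ hv (Submodule.smul_mem _ _ (normalVec_mem hx.1))
  rw [hc0, ← inner_normalVec hE, inner_sub_right, ← hν, hvν, inner_smul_right,
    real_inner_self_eq_norm_sq] at hzero
  have hνpos : 0 < ‖ν‖ := (by have := h.pos; positivity : 0 < 9 / 10 * R).trans_le (h.normalVec_pos hx)
  have hτ : τ = 0 := by
    have : τ * ‖ν‖ ^ 2 = 0 := by linarith
    rcases mul_eq_zero.1 this with h0 | h0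
    · exact h0
    · exact absurd h0 (by positivity)
  exact ⟨_, hc0, by simpa [hτ] using hc, hmem⟩

/-- The tangent plane of the perturbed sphere. -/
theorem IsHeight.mem_tangentPlane (ht : IsHeight d H R η₀ t) (h : IsTame H R η) (hη : |η| < η₀)
    {x : Space D} (hx : x ∈ perturbedSphere d H R η) {v : Space D} :
    v ∈ tangentPlane (perturbedSphere d H R η) x ↔
      v ∈ coordSubspace d D ∧ ⟪normalVec d H η x, v⟫ = 0 := by
  constructor
  · intro hv
    have hle : tangentPlane (perturbedSphere d H R η) x ≤
        coordSubspace d D ⊓ (LinearMap.ker (innerSL ℝ (normalVec d H η x)).toLinearMap) := by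
      refine Submodule.span_le.2 fun w hw => ?_
      -- Two maps that agree on the surface have derivatives that agree on its tangent cone: here
      -- the projection to the subspace and the identity, below the defining function and a
      -- constant.
      have hwE : w ∈ coordSubspace d D := by
        have h1 : HasFDerivWithinAt (fun y : Space D => (coordSubspace d D).starProjection y)
            (coordSubspace d D).starProjection (perturbedSphere d H R η) x :=
          (coordSubspace d D).starProjection.hasFDerivWithinAt
        have h2 : HasFDerivWithinAt (fun y : Space D => (coordSubspace d D).starProjection y)
            (ContinuousLinearMap.id ℝ (Space D)) (perturbedSphere d H R η) x :=
          (hasFDerivWithinAt_id x _).congr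
            (fun y hy => Submodule.starProjection_eq_self_iff.2 hy.1)
            (Submodule.starProjection_eq_self_iff.2 hx.1)
        exact Submodule.starProjection_eq_self_iff.1 (h1.unique_on h2 hw)
      refine ⟨hwE, ?_⟩
      have h1 : HasFDerivWithinAt (fun y : Space D => ‖y‖ ^ 2 - η * H y)
          (2 • innerSL ℝ x - η • fderiv ℝ H x) (perturbedSphere d H R η) x :=
        ((hasStrictFDerivAt_norm_sq x).hasFDerivAt.sub
          ((h.smooth.differentiable (by simp) x).hasFDerivAt.const_mul η)).hasFDerivWithinAt
      have h2 : HasFDerivWithinAt (fun y : Space D => ‖y‖ ^ 2 - η * H y)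
          (0 : Space D →L[ℝ] ℝ) (perturbedSphere d H R η) x :=
        (hasFDerivWithinAt_const (R ^ 2) x _).congr
          (fun y hy => by rw [hy.2]; ring) (by rw [hx.2]; ring)
      have h3 := h1.unique_on h2 hw
      have h4 : 2 * ⟪x, w⟫ - η * fderiv ℝ H x w = 0 := by simpa using h3
      rw [← inner_gradient_left, ← inner_normalVec hwE] at h4
      simpa using h4
    have := hle hv
    exact ⟨this.1, by simpa using this.2⟩
  · rintro ⟨hv, hvν⟩
    obtain ⟨c, hc0, hc, hmem⟩ := ht.exists_curve h hη hx hv hvν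
    refine Submodule.subset_span ?_
    have h1 := hc.hasFDerivAt.hasFDerivWithinAt (s := {s | c s ∈ perturbedSphere d H R η})
    have h1' : (1 : ℝ) ∈ tangentConeAt ℝ {s | c s ∈ perturbedSphere d H R η} 0 := by
      rw [tangentConeAt_of_mem_nhds hmem]
      trivial
    have h2 := h1.mapsTo_tangent_cone h1'
    rw [hc0] at h2
    have h3 := tangentConeAt_mono (𝕜 := ℝ) (x := x)
      (image_subset_iff.2 fun s (hs : s ∈ {s | c s ∈ perturbedSphere d H R η}) => hs) h2
    simpa using h3

/-- The tangent plane is the hyperplane `ν^⊥` of the coordinate subspace, so `w` minus its component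
along `ν` is tangent and orthogonal to itself. -/
theorem IsHeight.exists_smul_normalVec (ht : IsHeight d H R η₀ t) (h : IsTame H R η)
    (hη : |η| < η₀) {x : Space D} (hx : x ∈ perturbedSphere d H R η) {w : Space D}
    (hw : w ∈ coordSubspace d D)
    (hwT : ∀ v ∈ tangentPlane (perturbedSphere d H R η) x, ⟪w, v⟫ = 0) :
    ∃ s : ℝ, w = s • normalVec d H η x := by
  set ν := normalVec d H η x with hν
  have hνpos : 0 < ‖ν‖ := (by have := h.pos; positivity : 0 < 9 / 10 * R).trans_le (h.normalVec_pos hx)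
  refine ⟨⟪ν, w⟫ / ‖ν‖ ^ 2, ?_⟩
  have h1 : ⟪ν, w - (⟪ν, w⟫ / ‖ν‖ ^ 2) • ν⟫ = 0 := by
    rw [inner_sub_right, inner_smul_right, real_inner_self_eq_norm_sq]
    field_simp
    ring
  have h2 : ⟪w, w - (⟪ν, w⟫ / ‖ν‖ ^ 2) • ν⟫ = 0 :=
    hwT _ ((ht.mem_tangentPlane h hη hx).2
      ⟨Submodule.sub_mem _ hw (Submodule.smul_mem _ _ (normalVec_mem hx.1)), h1⟩)
  have h3 : ⟪w - (⟪ν, w⟫ / ‖ν‖ ^ 2) • ν, w - (⟪ν, w⟫ / ‖ν‖ ^ 2) • ν⟫ = 0 := by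
    rw [inner_sub_left, h2, real_inner_smul_left, h1]
    ring
  exact sub_eq_zero.1 (inner_self_eq_zero.1 h3)

/-- The graph map is a local parametrization by the inverse of the tangent projection. -/
theorem IsHeight.isLocalParam (ht : IsHeight d H R η₀ t) (h : IsTame H R η) (hη : |η| < η₀)
    {x : Space D} (hx : x ∈ perturbedSphere d H R η) {r : ℝ} (hr : r ≤ R / 8) :
    IsLocalParam (perturbedSphere d H R η) x r (fun u => graphMap d H t ((x, η), u)) := by
  set M := perturbedSphere d H R η with hM
  set ν := normalVec d H η x with hν
  have hT : ∀ u : tangentPlane M x, (u : Space D) ∈ coordSubspace d D ∧ ⟪ν, (u : Space D)⟫ = 0 :=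
    fun u => (ht.mem_tangentPlane h hη hx).1 u.2
  have hdom : ∀ u ∈ Metric.ball (0 : tangentPlane M x) r,
      ((x, η), (u : Space D)) ∈ paramDomain D R η₀ := fun u hu => by
    refine h.mem_paramDomain hη hx ?_
    have : ‖u‖ < r := mem_ball_zero_iff.1 hu
    exact this.trans_le hr
  have hmem : ∀ u ∈ Metric.ball (0 : tangentPlane M x) r, graphMap d H t ((x, η), u) ∈ M :=
    fun u hu => ht.graphMap_mem hx.1 (hT u).1 (hdom u hu)
  have hνT : (tangentPlane M x).orthogonalProjectionOnto ν = 0 := by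
    rw [Submodule.orthogonalProjectionOnto_eq_zero_iff, Submodule.mem_orthogonal']
    exact fun u hu => ((ht.mem_tangentPlane h hη hx).1 hu).2
  have hsub : ∀ u : tangentPlane M x,
      graphMap d H t ((x, η), u) - x = u - t ((x, η), u) • ν := fun u => by
    simp only [graphMap]
    abel
  have hproj : ∀ u : tangentPlane M x,
      (tangentPlane M x).orthogonalProjectionOnto (graphMap d H t ((x, η), u) - x) = u := fun u => by
    rw [hsub, map_sub, map_smul, hνT, smul_zero, sub_zero,
      Submodule.orthogonalProjectionOnto_mem_subspace_eq_self]
  have hνpos : 0 < ‖ν‖ := (by have := h.pos; positivity : 0 < 9 / 10 * R).trans_le (h.normalVec_pos hx)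
  refine ⟨?_, ?_, hmem, fun u _ => hproj u, ?_⟩
  · simp [graphMap, ht.zero_eq h hη hx]
  · have h1 : ContDiff ℝ ∞ (fun u : tangentPlane M x => ((x, η), (u : Space D))) :=
      contDiff_const.prodMk (tangentPlane M x).subtypeL.contDiff
    exact (ht.contDiffOn_graphMap h.smooth).comp h1.contDiffOn hdom
  -- The bound on the normal component confines `y` to the heights below `1/2` in absolute value,
  -- where the root is unique; it excludes the far side of the sphere.
  · refine ⟨{y | ‖(tangentPlane M x).orthogonalProjectionOnto (y - x)‖ < r ∧
      |⟪ν, y - x⟫| < 1 / 2 * ‖ν‖ ^ 2}, ?_, ?_⟩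
    · have o1 : IsOpen {y | ‖(tangentPlane M x).orthogonalProjectionOnto (y - x)‖ < r} :=
        isOpen_lt (by fun_prop) (by fun_prop)
      have o2 : IsOpen {y | |⟪ν, y - x⟫| < 1 / 2 * ‖ν‖ ^ 2} :=
        isOpen_lt (by fun_prop) (by fun_prop)
      exact o1.inter o2
    · ext y
      constructor
      · rintro ⟨u, hu, rfl⟩
        refine ⟨hmem u hu, ?_, ?_⟩
        · rw [hproj]
          exact mem_ball_zero_iff.1 hu
        · change |⟪ν, graphMap d H t ((x, η), u) - x⟫| < _
          rw [hsub, inner_sub_right, (hT u).2, inner_smul_right, real_inner_self_eq_norm_sq,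
            zero_sub, abs_neg, abs_mul, abs_of_nonneg (sq_nonneg ‖ν‖)]
          gcongr
          exact abs_lt.2 (ht.mem _ (hdom u hu))
      · rintro ⟨hyM, hy1, hy2⟩
        set u := (tangentPlane M x).orthogonalProjectionOnto (y - x) with hu
        have hub : u ∈ Metric.ball (0 : tangentPlane M x) r := mem_ball_zero_iff.2 hy1
        refine ⟨u, hub, ?_⟩
        obtain ⟨s, hs⟩ := ht.exists_smul_normalVec h hη hx (w := y - x - u)
          (Submodule.sub_mem _ (Submodule.sub_mem _ hyM.1 hx.1) (hT u).1)
          fun v hv => Submodule.starProjection_inner_eq_zero (K := tangentPlane M x) (y - x) v hv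
        rw [← hν] at hs
        have hyeq : y = x + u - (-s) • ν := by
          rw [neg_smul, ← hs]
          abel
        have hyx : y - x = u + s • ν := by
          rw [← hs]
          abel
        rw [hyx, inner_add_right, (hT u).2, inner_smul_right, real_inner_self_eq_norm_sq,
          zero_add, abs_mul, abs_of_nonneg (sq_nonneg ‖ν‖)] at hy2
        have hs2 : |s| < 1 / 2 := lt_of_mul_lt_mul_right hy2 (sq_nonneg _)
        have hs3 : -s = t ((x, η), u) := by
          refine ht.unique _ (hdom u hub) _ ?_ ?_
          · rw [abs_lt] at hs2
            constructor <;> linarith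
          · simp only [normalLevel]
            rw [← hν, ← hyeq, hyM.2]
            ring
        simp only [graphMap]
        rw [← hs3, ← hν, ← hyeq]

/-- The perturbed sphere has reach at least half of the radius. -/
theorem IsHeight.le_reach (ht : IsHeight d H R η₀ t) (h : IsTame H R η) (hη : |η| < η₀) :
    ENNReal.ofReal (R / 2) ≤ reach (perturbedSphere d H R η) := by
  set M := perturbedSphere d H R η with hM
  refine le_iInf₂ fun y hy => ?_
  obtain ⟨a, haM, b, hbM, hab, hya, hyb⟩ := hy
  have hne : M.Nonempty := ⟨a, haM⟩
  have hinf : Metric.infEDist y M = ENNReal.ofReal (dist y a) := by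
    rw [hya, Metric.infDist, ENNReal.ofReal_toReal (Metric.infEDist_ne_top hne)]
  rw [hinf]
  refine ENNReal.ofReal_le_ofReal ?_
  set ν := normalVec d H η a with hν
  -- First-order condition at the nearest point `a`, tested along a curve in every tangent
  -- direction.
  have horth : ∀ v ∈ tangentPlane M a, ⟪y - a, v⟫ = 0 := by
    intro v hv
    obtain ⟨hvE, hvν⟩ := (ht.mem_tangentPlane h hη haM).1 hv
    obtain ⟨c, hc0, hc, hmem⟩ := ht.exists_curve h hη haM hvE hvν
    have hmin : IsLocalMin (fun s => ‖y - c s‖ ^ 2) 0 := by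
      filter_upwards [hmem] with s hs
      have h1 : dist y a ≤ dist y (c s) := by
        rw [hya]
        exact Metric.infDist_le_dist_of_mem hs
      rw [dist_eq_norm, dist_eq_norm] at h1
      rw [hc0]
      gcongr
    have hd := hmin.hasDerivAt_eq_zero (hc.const_sub y).norm_sq
    rw [hc0, inner_neg_right] at hd
    linarith
  -- The point `y` may lie off the coordinate subspace; only its projected displacement is a
  -- multiple `s • ν`, and projecting does not increase norms.
  set P := (coordSubspace d D).starProjection with hP
  have hPE : ∀ w, w ∈ coordSubspace d D → ⟪P (y - a), w⟫ = ⟪y - a, w⟫ := fun w hw => by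
    rw [hP, Submodule.inner_starProjection_left_eq_right,
      Submodule.starProjection_eq_self_iff.2 hw]
  obtain ⟨s, hs⟩ := ht.exists_smul_normalVec h hη haM (w := P (y - a))
    (Submodule.starProjection_apply_mem _ _) fun v hv => by
      rw [hPE v ((ht.mem_tangentPlane h hη haM).1 hv).1, horth v hv]
  rw [← hν] at hs
  have hbaE : b - a ∈ coordSubspace d D := Submodule.sub_mem _ hbM.1 haM.1
  have hbapos : 0 < ‖b - a‖ := norm_pos_iff.2 (sub_ne_zero.2 (Ne.symm hab))
  have e1 : 2 * ⟪y - a, b - a⟫ = ‖b - a‖ ^ 2 := by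
    have h1 : ‖y - b‖ ^ 2 = ‖y - a‖ ^ 2 := by
      rw [← dist_eq_norm, ← dist_eq_norm, hya, hyb]
    have h2 : y - b = (y - a) - (b - a) := by abel
    rw [h2, norm_sub_sq_real] at h1
    linarith
  have e2 : ⟪y - a, b - a⟫ = s * ⟪ν, b - a⟫ := by
    rw [← hPE _ hbaE, hs, real_inner_smul_left]
  have e3 := inner_normalVec (H := H) (η := η) hbaE a
  have e4 : 2 * ⟪a, b - a⟫ + ‖b - a‖ ^ 2 = η * (H b - H a) := by
    have h1 : b = a + (b - a) := by abel
    have h2 := hbM.2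
    rw [h1, norm_add_sq_real, haM.2, ← h1] at h2
    linarith
  have e5 := abs_le.1 (h.taylor a b)
  -- By the defining equations at `a` and `b`, `2⟪ν, b - a⟫` is `-‖b - a‖²` plus a Taylor remainder.
  -- Equidistance gives `s * (2⟪ν, b - a⟫) = ‖b - a‖²`, so `|s|` is nearly at least `1`, and `‖ν‖`
  -- is nearly `R`.
  have e6 : |2 * ⟪ν, b - a⟫| ≤ 101 / 100 * ‖b - a‖ ^ 2 := by
    rw [e3, abs_le]
    constructor <;> nlinarith
  have e7 : ‖b - a‖ ^ 2 ≤ |s| * (101 / 100 * ‖b - a‖ ^ 2) := by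
    calc ‖b - a‖ ^ 2 = s * (2 * ⟪ν, b - a⟫) := by rw [← e1, e2]; ring
      _ ≤ |s * (2 * ⟪ν, b - a⟫)| := le_abs_self _
      _ ≤ _ := by rw [abs_mul]; gcongr
  have e8 : 100 / 101 ≤ |s| := by
    have : 0 < ‖b - a‖ ^ 2 := by positivity
    nlinarith
  have e9 : |s| * ‖ν‖ ≤ dist y a := by
    rw [← Real.norm_eq_abs, ← norm_smul, ← hs, dist_eq_norm]
    exact Submodule.norm_starProjection_apply_le _ _
  have e10 := h.normalVec_pos haM
  have hR := h.pos
  nlinarith [abs_nonneg s]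

end

/-! ### Submanifold charts, closedness and connectedness -/

noncomputable section

variable {d D : ℕ} {H : Space D → ℝ} {R η η₀ : ℝ} {t : (Space D × ℝ) × Space D → ℝ}

/-- Inverse function theorem; in finite dimension an injective derivative suffices. -/
theorem exists_openPartialHomeomorph {E : Type*} [NormedAddCommGroup E] [NormedSpace ℝ E]
    [FiniteDimensional ℝ E] {φ : E → E} (hφ : ContDiff ℝ ∞ φ) {x : E}
    (hinj : ∀ v, fderiv ℝ φ x v = 0 → v = 0) :
    ∃ Φ : OpenPartialHomeomorph E E, x ∈ Φ.source ∧ (Φ : E → E) = φ ∧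
      ContDiffOn ℝ ∞ Φ.symm Φ.target := by
  have : CompleteSpace E := FiniteDimensional.complete ℝ E
  have hdiff : Differentiable ℝ φ := hφ.differentiable (by simp)
  set e : E ≃L[ℝ] E := (LinearEquiv.ofInjectiveEndo (fderiv ℝ φ x).toLinearMap
    ((injective_iff_map_eq_zero _).2 hinj)).toContinuousLinearEquiv with he
  have hex : (e : E →L[ℝ] E) = fderiv ℝ φ x := by
    ext v
    rfl
  -- Shrinking the source to points with invertible derivative makes the inverse smooth on its whole
  -- target, not merely at the image of `x`.
  set U : Set E := fderiv ℝ φ ⁻¹' range ((↑) : (E ≃L[ℝ] E) → E →L[ℝ] E) with hU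
  have hUo : IsOpen U :=
    ContinuousLinearEquiv.isOpen.preimage (hφ.continuous_fderiv (by simp))
  have hder : HasFDerivAt φ (e : E →L[ℝ] E) x := by
    rw [hex]
    exact (hdiff x).hasFDerivAt
  set Φ := (hφ.contDiffAt (x := x)).toOpenPartialHomeomorph φ hder (by simp) with hΦ
  refine ⟨Φ.restrOpen U hUo, ?_, rfl, ?_⟩
  · rw [OpenPartialHomeomorph.restrOpen_source]
    exact ⟨ContDiffAt.mem_toOpenPartialHomeomorph_source _ _ _, ⟨e, hex⟩⟩
  · intro z hz
    have hz1 := (Φ.restrOpen U hUo).map_target hz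
    rw [OpenPartialHomeomorph.restrOpen_source] at hz1
    obtain ⟨e', he'⟩ := hz1.2
    refine ((Φ.restrOpen U hUo).contDiffAt_symm hz (f₀' := e') ?_ hφ.contDiffAt).contDiffWithinAt
    rw [he']
    exact (hdiff _).hasFDerivAt

/-- The chart that straightens the perturbed sphere. -/
def levelChart (e i₀ : Fin D) (H : Space D → ℝ) (R η : ℝ) (y : Space D) : Space D :=
  WithLp.toLp 2 fun i => if i = e then ‖y‖ ^ 2 - η * H y - R ^ 2 else if i = i₀ then y e else y i

theorem contDiff_levelChart (hH : ContDiff ℝ ∞ H) (e i₀ : Fin D) :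
    ContDiff ℝ ∞ (levelChart e i₀ H R η) := by
  rw [contDiff_euclidean]
  intro i
  simp only [levelChart]
  split_ifs
  · exact ((contDiff_norm_sq ℝ).sub (contDiff_const.mul hH)).sub contDiff_const
  · exact (EuclideanSpace.proj (𝕜 := ℝ) e).contDiff
  · exact (EuclideanSpace.proj (𝕜 := ℝ) i).contDiff

theorem fderiv_levelChart_apply (hH : ContDiff ℝ ∞ H) (e i₀ i : Fin D) (x v : Space D) :
    fderiv ℝ (levelChart e i₀ H R η) x v i =
      if i = e then 2 * ⟪x, v⟫ - η * ⟪∇ H x, v⟫ else if i = i₀ then v e else v i := by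
  have h1 := ((contDiff_levelChart (R := R) (η := η) hH e i₀).differentiable
    (by simp) x).hasFDerivAt
  have h2 := (EuclideanSpace.proj (𝕜 := ℝ) i).hasFDerivAt.comp x h1
  have h3 : HasFDerivAt (fun y => levelChart e i₀ H R η y i)
      ((EuclideanSpace.proj (𝕜 := ℝ) i).comp (fderiv ℝ (levelChart e i₀ H R η) x)) x := h2
  have h4 : fderiv ℝ (levelChart e i₀ H R η) x v i =
      ((EuclideanSpace.proj (𝕜 := ℝ) i).comp (fderiv ℝ (levelChart e i₀ H R η) x)) v := rfl
  rw [h4]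
  simp only [levelChart] at h3
  split_ifs with hi hi'
  · simp only [hi, if_true] at h3
    have h5 : HasFDerivAt (fun y : Space D => ‖y‖ ^ 2 - η * H y - R ^ 2)
        (2 • innerSL ℝ x - η • fderiv ℝ H x) x :=
      ((hasStrictFDerivAt_norm_sq x).hasFDerivAt.sub
        ((hH.differentiable (by simp) x).hasFDerivAt.const_mul η)).sub_const _
    rw [hi, h3.unique h5, inner_gradient_left]
    simp
  · rw [hi'] at hi ⊢
    simp only [hi', hi, if_true, if_false] at h3
    rw [h3.unique (EuclideanSpace.proj (𝕜 := ℝ) e).hasFDerivAt]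
    rfl
  · simp only [hi, hi', if_false] at h3
    rw [h3.unique (EuclideanSpace.proj (𝕜 := ℝ) i).hasFDerivAt]
    rfl

theorem single_mem_coordSubspace {i : Fin D} (hi : (i : ℕ) ≤ d) (a : ℝ) :
    EuclideanSpace.single i a ∈ coordSubspace d D := by
  intro j hj
  have : j ≠ i := fun h => by omega
  simp [this]

/-- The defining function replaces coordinate `d`, and the displaced coordinate goes to a slot `i₀`
where `ν` is nonzero. A vector killed by the derivative is then supported on `i₀`, and `ν i₀ * v i₀
= 0` kills it. Coordinates beyond `d` already cut out the subspace. -/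
theorem IsTame.isSmoothSubmanifold (h : IsTame H R η) (hdD : d < D) :
    IsSmoothSubmanifold d (perturbedSphere d H R η) := by
  intro x hx
  set ν := normalVec d H η x with hν
  have hνpos : 0 < ‖ν‖ :=
    (by have := h.pos; positivity : 0 < 9 / 10 * R).trans_le (h.normalVec_pos hx)
  obtain ⟨i₀, hi₀⟩ : ∃ i, ν i ≠ 0 := by
    by_contra hcon
    push Not at hcon
    exact (norm_pos_iff.1 hνpos) (PiLp.ext hcon)
  have hi₀d : (i₀ : ℕ) ≤ d := by
    by_contra hcon
    exact hi₀ (normalVec_mem hx.1 i₀ (not_le.1 hcon))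
  set e : Fin D := ⟨d, hdD⟩ with he
  obtain ⟨Φ, hxΦ, hΦ, hΦs⟩ := exists_openPartialHomeomorph
    (contDiff_levelChart (R := R) (η := η) h.smooth e i₀) (x := x) (by
      intro v hv
      have hvi : ∀ i, fderiv ℝ (levelChart e i₀ H R η) x v i = 0 := fun i => by rw [hv]; rfl
      simp only [fderiv_levelChart_apply h.smooth] at hvi
      have hz : ∀ i, i ≠ i₀ → v i = 0 := by
        intro i hi
        by_cases hie : i = e
        · have h1 := hvi i₀
          have h2 : i₀ ≠ e := fun h => hi (hie.trans h.symm)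
          simpa [h2, hie] using h1
        · simpa [hi, hie] using hvi i
      have hve : v = EuclideanSpace.single i₀ (v i₀) := by
        ext i
        by_cases hi : i = i₀
        · simp [hi]
        · simp [hi, hz i hi]
      have h1 := hvi e
      rw [if_pos rfl, ← inner_normalVec (d := d)
        (by rw [hve]; exact single_mem_coordSubspace hi₀d _), ← hν, hve,
        EuclideanSpace.inner_single_right] at h1
      have h3 : v i₀ = 0 := by simpa [hi₀] using h1
      rw [hve, h3]
      simp)
  refine ⟨Φ, hxΦ, ?_, hΦs, fun y _ => ?_⟩
  · rw [hΦ]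
    exact (contDiff_levelChart h.smooth e i₀).contDiffOn
  · rw [hΦ]
    constructor
    · rintro ⟨hyE, hy⟩ i hi
      simp only [levelChart]
      split_ifs with h1 h2
      · rw [hy]; ring
      · subst h2
        exact absurd (Fin.ext (le_antisymm hi₀d hi)) h1
      · exact hyE i (lt_of_le_of_ne hi fun h => h1 (Fin.ext h.symm))
    · intro hy
      refine ⟨fun i hi => ?_, ?_⟩
      · have h1 := hy i hi.le
        have h2 : i ≠ e := fun h => by rw [h] at hi; exact lt_irrefl _ hi
        have h3 : i ≠ i₀ := fun h => by rw [h] at hi; omega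
        simpa [levelChart, h2, h3] using h1
      · have h1 := hy e le_rfl
        simp only [levelChart, if_true] at h1
        linarith

theorem isClosed_perturbedSphere (hH : Continuous H) : IsClosed (perturbedSphere d H R η) := by
  have h1 : IsClosed (coordSubspace d D : Set (Space D)) := Submodule.closed_of_finiteDimensional _
  exact h1.inter (isClosed_eq (by fun_prop) (by fun_prop))

/-! ### Radial projection -/

/-- The radial projection to the sphere of radius `R`. -/
def radialProj (R : ℝ) (y : Space D) : Space D := (R / ‖y‖) • y

theorem norm_radialProj (hR : 0 < R) {y : Space D} (hy : y ≠ 0) : ‖radialProj R y‖ = R := by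
  have := norm_pos_iff.2 hy
  rw [radialProj, norm_smul, Real.norm_of_nonneg (by positivity)]
  field_simp

theorem smul_radialProj (hR : 0 < R) {y : Space D} (hy : y ≠ 0) :
    (‖y‖ / R) • radialProj R y = y := by
  have := norm_pos_iff.2 hy
  rw [radialProj, smul_smul]
  have h : ‖y‖ / R * (R / ‖y‖) = 1 := by field_simp
  rw [h, one_smul]

theorem radialProj_smul (hR : 0 < R) {z : Space D} (hz : ‖z‖ = R) {s : ℝ} (hs : 0 < s) :
    radialProj R (s • z) = z := by
  rw [radialProj, norm_smul, Real.norm_of_nonneg hs.le, hz, smul_smul]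
  have h : R / (s * R) * s = 1 := by field_simp
  rw [h, one_smul]

/-- With `a = α p`, `b = β q` and `α, β ≥ 1`, the difference of the squared distances is `(α - β)²
R² + 2 (αβ - 1)(R² - ⟪p, q⟫) ≥ 0`. -/
theorem norm_radialProj_sub_le (hR : 0 < R) {a b : Space D} (ha : R ≤ ‖a‖) (hb : R ≤ ‖b‖) :
    ‖radialProj R a - radialProj R b‖ ≤ ‖a - b‖ := by
  have ha0 : a ≠ 0 := norm_pos_iff.1 (hR.trans_le ha)
  have hb0 : b ≠ 0 := norm_pos_iff.1 (hR.trans_le hb)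
  set p := radialProj R a
  set q := radialProj R b
  have hp : ‖p‖ = R := norm_radialProj hR ha0
  have hq : ‖q‖ = R := norm_radialProj hR hb0
  have hα : 1 ≤ ‖a‖ / R := (one_le_div hR).2 ha
  have hβ : 1 ≤ ‖b‖ / R := (one_le_div hR).2 hb
  rw [← smul_radialProj hR ha0, ← smul_radialProj hR hb0]
  change ‖p - q‖ ≤ ‖(‖a‖ / R) • p - (‖b‖ / R) • q‖
  set α := ‖a‖ / R
  set β := ‖b‖ / R
  refine le_of_sq_le_sq ?_ (norm_nonneg _)
  rw [norm_sub_sq_real, norm_sub_sq_real, norm_smul, norm_smul, real_inner_smul_left,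
    real_inner_smul_right, Real.norm_of_nonneg (by linarith), Real.norm_of_nonneg (by linarith),
    hp, hq]
  have hpq : ⟪p, q⟫ ≤ R * R := by
    have := real_inner_le_norm p q
    rwa [hp, hq] at this
  have hαβ : 0 ≤ α * β - 1 := by nlinarith
  nlinarith [mul_nonneg hαβ (sub_nonneg.2 hpq), sq_nonneg ((α - β) * R)]

/-- Since `(‖a‖ - ‖b‖)(‖a‖ + ‖b‖) = η (H a - H b)`, the radii differ by at most a hundredth of the
distance; the angular part carries the rest. So the inverse of the radial projection is
`2`-Lipschitz, which gives connectedness and the volume bound. -/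
theorem IsTame.norm_sub_le_radialProj (h : IsTame H R η) {a b : Space D}
    (ha : a ∈ perturbedSphere d H R η) (hb : b ∈ perturbedSphere d H R η) :
    ‖a - b‖ ≤ 2 * ‖radialProj R a - radialProj R b‖ := by
  have hR := h.pos
  obtain ⟨ha1, ha2⟩ := h.norm_bounds ha
  obtain ⟨hb1, hb2⟩ := h.norm_bounds hb
  have ha0 : a ≠ 0 := norm_pos_iff.1 (by linarith)
  have hb0 : b ≠ 0 := norm_pos_iff.1 (by linarith)
  have hq : ‖radialProj R b‖ = R := norm_radialProj hR hb0
  have e1 : a - b = (‖a‖ / R) • (radialProj R a - radialProj R b) +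
      ((‖a‖ - ‖b‖) / R) • radialProj R b := by
    conv_lhs => rw [← smul_radialProj hR ha0, ← smul_radialProj hR hb0]
    rw [sub_div]
    module
  have e2 : |‖a‖ - ‖b‖| * (‖a‖ + ‖b‖) ≤ R / 100 * ‖a - b‖ := by
    have h1 := h.lip b a
    have h2 : η * (H a - H b) = (‖a‖ - ‖b‖) * (‖a‖ + ‖b‖) := by
      have := ha.2
      have := hb.2
      nlinarith
    rw [h2, abs_mul, abs_of_nonneg (by positivity : 0 ≤ ‖a‖ + ‖b‖)] at h1
    exact h1
  have e3 : |‖a‖ - ‖b‖| ≤ 1 / 100 * ‖a - b‖ := by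
    have h1 : |‖a‖ - ‖b‖| * R ≤ R / 100 * ‖a - b‖ :=
      le_trans (by gcongr; linarith) e2
    refine le_of_mul_le_mul_right ?_ hR
    linarith
  have e4 : ‖a - b‖ ≤ 101 / 100 * ‖radialProj R a - radialProj R b‖ + |‖a‖ - ‖b‖| := by
    calc ‖a - b‖ ≤ ‖(‖a‖ / R) • (radialProj R a - radialProj R b)‖ +
          ‖((‖a‖ - ‖b‖) / R) • radialProj R b‖ := by
          conv_lhs => rw [e1]
          exact norm_add_le _ _
      _ = ‖a‖ / R * ‖radialProj R a - radialProj R b‖ + |‖a‖ - ‖b‖| := by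
          rw [norm_smul, norm_smul, hq, Real.norm_of_nonneg (by positivity), Real.norm_eq_abs,
            abs_div, abs_of_pos hR]
          congr 1
          field_simp
      _ ≤ _ := by
          have : ‖a‖ / R ≤ 101 / 100 := (div_le_iff₀ hR).2 ha2
          gcongr
  have := norm_nonneg (radialProj R a - radialProj R b)
  linarith

theorem IsTame.exists_smul_mem (h : IsTame H R η) {z : Space D} (hz : z ∈ coordSubspace d D)
    (hzR : ‖z‖ = R) : ∃ s : ℝ, 0 < s ∧ s • z ∈ perturbedSphere d H R η := by
  have hR := h.pos
  have hc : ContinuousOn (fun s : ℝ => ‖s • z‖ ^ 2 - η * H (s • z)) (Icc (1 / 2) 2) := by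
    have := h.smooth.continuous
    fun_prop
  have e1 : ‖(1 / 2 : ℝ) • z‖ ^ 2 - η * H ((1 / 2 : ℝ) • z) ≤ R ^ 2 := by
    rw [norm_smul, hzR, Real.norm_of_nonneg (by norm_num)]
    have := (abs_le.1 (h.bound ((1 / 2 : ℝ) • z))).1
    nlinarith
  have e2 : R ^ 2 ≤ ‖(2 : ℝ) • z‖ ^ 2 - η * H ((2 : ℝ) • z) := by
    rw [norm_smul, hzR, Real.norm_of_nonneg (by norm_num)]
    have := (abs_le.1 (h.bound ((2 : ℝ) • z))).2
    nlinarith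
  obtain ⟨s, hs, hs'⟩ := intermediate_value_Icc (by norm_num) hc ⟨e1, e2⟩
  refine ⟨s, by linarith [hs.1], Submodule.smul_mem _ _ hz, ?_⟩
  simp only at hs'
  linarith

theorem perturbedSphere_zero_left (R η : ℝ) : perturbedSphere d (0 : Space D → ℝ) R η =
    {y | y ∈ coordSubspace d D ∧ ‖y‖ ^ 2 = R ^ 2} := by
  simp [perturbedSphere]

theorem IsTame.radialProj_image (h : IsTame H R η) :
    radialProj R '' perturbedSphere d H R η = perturbedSphere d (0 : Space D → ℝ) R 0 := by
  have hR := h.pos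
  ext z
  constructor
  · rintro ⟨y, hy, rfl⟩
    have hy0 : y ≠ 0 := norm_pos_iff.1 (by linarith [(h.norm_bounds hy).1])
    exact ⟨Submodule.smul_mem _ _ hy.1, by simp [norm_radialProj hR hy0]⟩
  · rintro ⟨hz, hzR⟩
    have hz' : ‖z‖ = R := by
      simp only [zero_mul, add_zero] at hzR
      exact (sq_eq_sq₀ (norm_nonneg _) hR.le).1 hzR
    obtain ⟨s, hs, hsM⟩ := h.exists_smul_mem hz hz'
    exact ⟨_, hsM, radialProj_smul hR hz' hs⟩

/-- Coordinates on the coordinate subspace. -/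
def coordSubspaceEquiv (hdD : d < D) : coordSubspace d D ≃ₗ[ℝ] (Fin (d + 1) → ℝ) where
  toFun y j := (y : Space D) ⟨j, by omega⟩
  map_add' a b := by ext; simp
  map_smul' c a := by ext; simp
  invFun f := ⟨WithLp.toLp 2 fun i => if hi : (i : ℕ) < d + 1 then f ⟨i, hi⟩ else 0, fun i hi => by
    simp; omega⟩
  left_inv y := by
    ext i
    simp only
    split_ifs with hi
    · rfl
    · exact (y.2 i (by omega)).symm
  right_inv f := by
    ext j
    exact dif_pos j.2

theorem finrank_coordSubspace (hdD : d < D) : Module.finrank ℝ (coordSubspace d D) = d + 1 := by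
  rw [(coordSubspaceEquiv hdD).finrank_eq]
  simp

theorem perturbedSphere_zero_eq_image (hR : 0 < R) :
    perturbedSphere d (0 : Space D → ℝ) R 0 =
      (Subtype.val : coordSubspace d D → Space D) '' Metric.sphere 0 R := by
  ext y
  rw [perturbedSphere_zero_left]
  constructor
  · rintro ⟨hy, hyR⟩
    refine ⟨⟨y, hy⟩, ?_, rfl⟩
    rw [mem_sphere_zero_iff_norm]
    exact (sq_eq_sq₀ (norm_nonneg _) hR.le).1 hyR
  · rintro ⟨y, hy, rfl⟩
    rw [mem_sphere_zero_iff_norm] at hy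
    refine ⟨y.2, ?_⟩
    rw [← Submodule.coe_norm, hy]

theorem isConnected_sphere_coordSubspace (hd : 1 ≤ d) (hdD : d < D) (hR : 0 < R) :
    IsConnected (perturbedSphere d (0 : Space D → ℝ) R 0) := by
  have h1 : 1 < Module.rank ℝ (coordSubspace d D) := by
    rw [← Module.finrank_eq_rank, finrank_coordSubspace hdD]
    exact_mod_cast (by omega : 1 < d + 1)
  rw [perturbedSphere_zero_eq_image hR]
  exact (isConnected_sphere h1 (0 : coordSubspace d D) hR.le).image _
    continuous_subtype_val.continuousOn

/-- The surface is the image of the connected round sphere under the Lipschitz inverse of the radial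
projection. -/
theorem IsTame.isConnected (h : IsTame H R η) (hd : 1 ≤ d) (hdD : d < D) :
    IsConnected (perturbedSphere d H R η) := by
  have hS := isConnected_sphere_coordSubspace (R := R) hd hdD h.pos
  have hex : ∀ z ∈ perturbedSphere d (0 : Space D → ℝ) R 0,
      ∃ y ∈ perturbedSphere d H R η, radialProj R y = z := fun z hz => by
    rw [← h.radialProj_image] at hz
    exact hz
  choose! f hfM hf using hex
  have hlip : LipschitzOnWith 2 f (perturbedSphere d (0 : Space D → ℝ) R 0) := by
    refine LipschitzOnWith.of_dist_le_mul fun a ha b hb => ?_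
    have h1 := h.norm_sub_le_radialProj (hfM a ha) (hfM b hb)
    rw [hf a ha, hf b hb] at h1
    simpa [dist_eq_norm] using h1
  have himg : f '' perturbedSphere d (0 : Space D → ℝ) R 0 = perturbedSphere d H R η := by
    ext y
    constructor
    · rintro ⟨z, hz, rfl⟩
      exact hfM z hz
    · intro hy
      have hz : radialProj R y ∈ perturbedSphere d (0 : Space D → ℝ) R 0 := by
        rw [← h.radialProj_image]
        exact ⟨y, hy, rfl⟩
      refine ⟨_, hz, ?_⟩
      have h1 := h.norm_sub_le_radialProj (hfM _ hz) hy
      rw [hf _ hz, sub_self, norm_zero, mul_zero] at h1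
      exact sub_eq_zero.1 (norm_le_zero_iff.1 h1)
  rw [← himg]
  exact hS.image f hlip.continuousOn

end

/-! ### Uniform derivative bounds and membership in the manifold class -/

noncomputable section

variable {d D : ℕ} {H : Space D → ℝ} {R η η₀ : ℝ} {t : (Space D × ℝ) × Space D → ℝ}

/-- The sum of the norms of the partial derivatives of order at most `k` of the graph map. -/
def graphDerivSum (d k : ℕ) (H : Space D → ℝ) (t : (Space D × ℝ) × Space D → ℝ)
    (p : (Space D × ℝ) × Space D) : ℝ :=
  ∑ i ∈ Finset.range (k + 1), ‖iteratedFDeriv ℝ i (fun u => graphMap d H t (p.1, u)) p.2‖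

theorem IsHeight.continuousOn_graphDerivSum (ht : IsHeight d H R η₀ t) (hH : ContDiff ℝ ∞ H)
    (k : ℕ) : ContinuousOn (graphDerivSum d k H t) (paramDomain D R η₀) :=
  continuousOn_finsetSum _ fun i _ => (contDiffOn_iteratedFDeriv_partial
    (isOpen_paramDomain R η₀) (ht.contDiffOn_graphMap hH) i).continuousOn.norm

/-- The parameters of the tangent balls of radius `r` of the round sphere. -/
def roundParams (D : ℕ) (R r : ℝ) : Set ((Space D × ℝ) × Space D) :=
  (Metric.sphere (0 : Space D) R ×ˢ {0}) ×ˢ Metric.closedBall (0 : Space D) r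

theorem isCompact_roundParams (R r : ℝ) : IsCompact (roundParams D R r) :=
  ((isCompact_sphere _ _).prod isCompact_singleton).prod (isCompact_closedBall _ _)

theorem roundParams_subset (hR : 0 < R) (hη₀ : 0 < η₀) :
    roundParams D R (R / 16) ⊆ paramDomain D R η₀ := by
  rintro ⟨⟨x, η⟩, u⟩ ⟨⟨hx, hη⟩, hu⟩
  rw [mem_sphere_zero_iff_norm] at hx
  rw [mem_closedBall_zero_iff] at hu
  simp only [mem_singleton_iff] at hη
  simp only at hx hu
  refine ⟨?_, ?_, ?_, ?_⟩ <;> simp only [hx, hη, abs_zero]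
  · linarith
  · linarith
  · exact hη₀
  · linarith

/-- Over the round sphere, the graph map does not depend on the perturbation. -/
theorem IsHeight.graphDerivSum_round {η₁ : ℝ} {t' : (Space D × ℝ) × Space D → ℝ}
    (ht : IsHeight d H R η₀ t) (ht' : IsHeight d (0 : Space D → ℝ) R η₁ t') (hR : 0 < R)
    (h₀ : 0 < η₀) (h₁ : 0 < η₁) (k : ℕ) {p : (Space D × ℝ) × Space D}
    (hp : p ∈ roundParams D R (R / 16)) :
    graphDerivSum d k H t p = graphDerivSum d k 0 t' p := by
  obtain ⟨⟨x, η⟩, u⟩ := p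
  have hη : η = 0 := hp.1.2
  subst hη
  have hline : Continuous fun v : Space D => (((x, 0), v) : (Space D × ℝ) × Space D) := by fun_prop
  have hev : (fun v => graphMap d H t ((x, 0), v)) =ᶠ[𝓝 u]
      fun v => graphMap d (0 : Space D → ℝ) t' ((x, 0), v) := by
    filter_upwards [hline.continuousAt.eventually_mem
        ((isOpen_paramDomain R η₀).mem_nhds (roundParams_subset hR h₀ hp)),
      hline.continuousAt.eventually_mem
        ((isOpen_paramDomain R η₁).mem_nhds (roundParams_subset hR h₁ hp))] with v hv hv'
    have h1 : t ((x, 0), v) = t' ((x, 0), v) := by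
      refine ht'.unique _ hv' _ (Ioo_subset_Icc_self (ht.mem _ hv)) ?_
      have := ht.zero _ hv
      simp only [normalLevel, normalVec_zero, zero_mul] at this ⊢
      exact this
    simp only [graphMap, h1, normalVec_zero]
  refine Finset.sum_congr rfl fun i _ => ?_
  exact congrArg norm (hev.iteratedFDeriv ℝ i).self_of_nhds

/-- For small perturbations, the derivatives of the graph maps are bounded by a constant that only
depends on the round sphere. -/
theorem exists_graphDerivSum_le (d D k : ℕ) (hR : 0 < R) :
    ∃ C : ℝ, ∀ H : Space D → ℝ, ContDiff ℝ ∞ H → HasCompactSupport H →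
      ∃ η₁ > 0, ∀ η, |η| < η₁ → IsTame H R η ∧ ∃ η₀ t, IsHeight d H R η₀ t ∧ |η| < η₀ ∧
        ∀ x ∈ perturbedSphere d H R η, ∀ u, ‖u‖ < R / 16 →
          graphDerivSum d k H t ((x, η), u) ≤ C := by
  -- The constant is read off the height for `H = 0`, before any bump is given, so it cannot depend
  -- on the bump.
  obtain ⟨t₀, ht₀⟩ := exists_isHeight d (H := (0 : Space D → ℝ)) (R := R) (η₀ := 1) contDiff_const
    fun η _ => isTame_zero hR η
  obtain ⟨C, hC⟩ := (isCompact_roundParams R (R / 16)).exists_bound_of_continuousOn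
    ((ht₀.continuousOn_graphDerivSum contDiff_const k).mono (roundParams_subset hR zero_lt_one))
  refine ⟨C + 1, fun H hH hc => ?_⟩
  obtain ⟨η₀, hη₀, htame⟩ := exists_forall_isTame hH hc hR
  obtain ⟨t, ht⟩ := exists_isHeight d hH htame
  -- The parameters where the sum is below `C + 1` form an open set around the compact set of round
  -- parameters, hence contain a uniform neighbourhood of it.
  have hopen : IsOpen (paramDomain D R η₀ ∩ graphDerivSum d k H t ⁻¹' Iio (C + 1)) :=
    (ht.continuousOn_graphDerivSum hH k).isOpen_inter_preimage (isOpen_paramDomain R η₀) isOpen_Iio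
  have hsub : roundParams D R (R / 16) ⊆
      paramDomain D R η₀ ∩ graphDerivSum d k H t ⁻¹' Iio (C + 1) := by
    intro p hp
    refine ⟨roundParams_subset hR hη₀ hp, ?_⟩
    rw [mem_preimage, ht.graphDerivSum_round ht₀ hR hη₀ zero_lt_one k hp, mem_Iio]
    have h1 := (le_abs_self _).trans (hC p hp)
    linarith
  obtain ⟨δ, hδ, hthick⟩ := (isCompact_roundParams R (R / 16)).exists_thickening_subset_open
    hopen hsub
  obtain ⟨B, hB⟩ := hc.exists_bound_of_continuous hH.continuous
  have hBpos : 0 < |B| + 1 := by positivity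
  -- The last bound keeps `x` within `δ` of its radial projection, because `|‖x‖ - R| * R ≤ |η * H
  -- x|`.
  refine ⟨min η₀ (min δ (δ * R / (|B| + 1))), by positivity, fun η hη => ?_⟩
  have hη1 : |η| < η₀ := hη.trans_le (min_le_left _ _)
  have hη2 : |η| < δ := hη.trans_le ((min_le_right _ _).trans (min_le_left _ _))
  have hη3 : |η| * (|B| + 1) < δ * R :=
    (lt_div_iff₀ hBpos).1 (hη.trans_le ((min_le_right _ _).trans (min_le_right _ _)))
  have h := htame η hη1
  refine ⟨h, η₀, t, ht, hη1, fun x hx u hu => ?_⟩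
  obtain ⟨hx1, hx2⟩ := h.norm_bounds hx
  have hx0 : x ≠ 0 := norm_pos_iff.1 (by linarith)
  have hp₀ : ((radialProj R x, (0 : ℝ)), u) ∈ roundParams D R (R / 16) :=
    ⟨⟨mem_sphere_zero_iff_norm.2 (norm_radialProj hR hx0), rfl⟩,
      mem_closedBall_zero_iff.2 hu.le⟩
  have hdx : dist x (radialProj R x) < δ := by
    have e1 : x - radialProj R x = ((‖x‖ - R) / ‖x‖) • x := by
      have : ‖x‖ ≠ 0 := norm_ne_zero_iff.2 hx0
      rw [radialProj, sub_div, div_self this]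
      module
    have e2 : ‖x - radialProj R x‖ = |‖x‖ - R| := by
      rw [e1, norm_smul, Real.norm_eq_abs, abs_div, abs_norm]
      field_simp
    have e3 : |‖x‖ - R| * (‖x‖ + R) = |η * H x| := by
      rw [← abs_of_nonneg (by positivity : 0 ≤ ‖x‖ + R), ← abs_mul]
      congr 1
      have := hx.2
      nlinarith
    have e4 : |η * H x| ≤ |η| * (|B| + 1) := by
      rw [abs_mul]
      gcongr
      have h1 : |H x| ≤ B := hB x
      linarith [le_abs_self B]
    have e5 : |‖x‖ - R| * R ≤ |‖x‖ - R| * (‖x‖ + R) := by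
      gcongr
      linarith [norm_nonneg x]
    rw [dist_eq_norm, e2]
    refine lt_of_mul_lt_mul_right ?_ hR.le
    linarith
  have hmem : ((x, η), u) ∈ Metric.thickening δ (roundParams D R (R / 16)) := by
    refine Metric.mem_thickening_iff.2 ⟨_, hp₀, ?_⟩
    rw [Prod.dist_eq, Prod.dist_eq, dist_self]
    refine max_lt (max_lt hdx ?_) hδ
    simpa using hη2
  exact (hthick hmem).2.le

/-- Small perturbations of the round sphere of radius `4 τ` belong to the class of manifolds, with a
bound on the derivatives that does not depend on the shape of the perturbation. -/
theorem exists_eventually_mem_manifoldClass {d D : ℕ} (k : ℕ) {τ : ℝ} (hd : 1 ≤ d) (hdD : d < D)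
    (hτ : 0 < τ) :
    ∃ Λ : ℝ, ∀ H : Space D → ℝ, ContDiff ℝ ∞ H → HasCompactSupport H →
      ∀ᶠ η in 𝓝[>] (0 : ℝ), IsTame H (4 * τ) η ∧
        ∀ L ≥ Λ, perturbedSphere d H (4 * τ) η ∈ manifoldClass D d k τ L := by
  have hR : 0 < 4 * τ := by positivity
  obtain ⟨C, hC⟩ := exists_graphDerivSum_le (R := 4 * τ) d D k hR
  -- `L ≥ τ` makes the required radius `min τ L / 4` equal to `τ / 4`, which is `R / 16` for `R = 4
  -- τ`. The reach is at least `R / 2 = 2 τ > τ`.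
  refine ⟨max τ C, fun H hH hc => ?_⟩
  obtain ⟨η₁, hη₁, hη⟩ := hC H hH hc
  filter_upwards [Ioo_mem_nhdsGT hη₁] with η hηmem
  have habs : |η| < η₁ := by
    rw [abs_of_pos hηmem.1]
    exact hηmem.2
  obtain ⟨h, η₀, t, ht, hη₀, hbound⟩ := hη η habs
  refine ⟨h, fun L hL => ?_⟩
  have hmin : min τ L / 4 = 4 * τ / 16 := by
    rw [min_eq_left ((le_max_left _ _).trans hL)]
    ring
  refine ⟨h.isSmoothSubmanifold hdD, h.isConnected hd hdD,
    isClosed_perturbedSphere hH.continuous, ?_, fun x hx => ?_⟩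
  · refine lt_of_lt_of_le ?_ (ht.le_reach h hη₀)
    rw [ENNReal.ofReal_lt_ofReal_iff (by positivity)]
    linarith
  · rw [hmin]
    refine ⟨_, ht.isLocalParam h hη₀ hx (by linarith), fun i hi u hu => ?_⟩
    have hu' : ‖(u : Space D)‖ < 4 * τ / 16 := mem_ball_zero_iff.1 hu
    have hopen : IsOpen {v : Space D | ((x, η), v) ∈ paramDomain D (4 * τ) η₀} :=
      (isOpen_paramDomain _ _).preimage (by fun_prop)
    have hsmooth : ContDiffOn ℝ ∞ (fun v => graphMap d H t ((x, η), v))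
        {v : Space D | ((x, η), v) ∈ paramDomain D (4 * τ) η₀} :=
      (ht.contDiffOn_graphMap hH).comp (by fun_prop) fun v hv => hv
    refine (norm_iteratedFDeriv_comp_subtype_le (tangentPlane _ x) hopen hsmooth i
      (h.mem_paramDomain hη₀ hx (by linarith))).trans ?_
    refine le_trans ?_ ((hbound x hx u hu').trans ((le_max_right _ _).trans hL))
    exact Finset.single_le_sum
      (f := fun i => ‖iteratedFDeriv ℝ i (fun v => graphMap d H t ((x, η), v)) (u : Space D)‖)
      (fun i _ => norm_nonneg _) (Finset.mem_range.2 (by omega))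

end

/-! ### Volumes of round and perturbed spheres -/

noncomputable section

theorem euclideanHausdorffMeasure_image_le {X Y : Type*} [MetricSpace X] [MeasurableSpace X]
    [BorelSpace X] [MetricSpace Y] [MeasurableSpace Y] [BorelSpace Y] {f : X → Y} {s : Set X}
    {K : ℝ≥0} (hf : LipschitzOnWith K f s) (d : ℕ) :
    μHE[d] (f '' s) ≤ (K : ℝ≥0∞) ^ d * μHE[d] s := by
  have h := hf.hausdorffMeasure_image_le (d := d) (by positivity)
  simp only [Measure.euclideanHausdorffMeasure_def, Measure.smul_apply, ENNReal.smul_def,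
    smul_eq_mul]
  rw [ENNReal.rpow_natCast] at h
  calc _ ≤ _ * ((K : ℝ≥0∞) ^ d * μH[d] s) := by gcongr
    _ = _ := by ring

theorem euclideanHausdorffMeasure_le_image {X Y : Type*} [MetricSpace X] [MeasurableSpace X]
    [BorelSpace X] [MetricSpace Y] [MeasurableSpace Y] [BorelSpace Y] {f : X → Y} {s : Set X}
    {K : ℝ≥0} (hf : ∀ a ∈ s, ∀ b ∈ s, dist a b ≤ K * dist (f a) (f b)) (d : ℕ) :
    μHE[d] s ≤ (K : ℝ≥0∞) ^ d * μHE[d] (f '' s) := by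
  rcases s.eq_empty_or_nonempty with rfl | ⟨x₀, -⟩
  · simp
  have : Nonempty X := ⟨x₀⟩
  have hex : ∀ y ∈ f '' s, ∃ x ∈ s, f x = y := fun y hy => hy
  choose! g hgs hg using hex
  have hlip : LipschitzOnWith K g (f '' s) := LipschitzOnWith.of_dist_le_mul fun a ha b hb => by
    have := hf _ (hgs a ha) _ (hgs b hb)
    rwa [hg a ha, hg b hb] at this
  have himg : s ⊆ g '' (f '' s) := by
    intro x hx
    refine ⟨f x, mem_image_of_mem f hx, ?_⟩
    have h1 := hf _ (hgs _ (mem_image_of_mem f hx)) _ hx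
    rw [hg _ (mem_image_of_mem f hx), dist_self, mul_zero] at h1
    exact dist_le_zero.1 h1
  exact (measure_mono himg).trans (euclideanHausdorffMeasure_image_le hlip d)

section Sphere

variable {V : Type*} [NormedAddCommGroup V] [InnerProductSpace ℝ V] {R : ℝ}

/-- The orthogonal projection to the hyperplane orthogonal to a vector of norm `R`. -/
def hyperplaneProj (R : ℝ) (x : V) (hx : ‖x‖ = R) (hR : 0 < R) (v : V) : (ℝ ∙ x)ᗮ :=
  ⟨v - (⟪x, v⟫ / R ^ 2) • x, by
    rw [Submodule.mem_orthogonal_singleton_iff_inner_right, inner_sub_right, inner_smul_right,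
      real_inner_self_eq_norm_sq, hx]
    field_simp
    ring⟩

theorem dist_hyperplaneProj_sq (x : V) (hx : ‖x‖ = R) (hR : 0 < R) (a b : V) :
    dist (hyperplaneProj R x hx hR a) (hyperplaneProj R x hx hR b) ^ 2 =
      ‖a - b‖ ^ 2 - ⟪x, a - b⟫ ^ 2 / R ^ 2 := by
  have h : dist (hyperplaneProj R x hx hR a) (hyperplaneProj R x hx hR b) =
      ‖(a - b) - (⟪x, a - b⟫ / R ^ 2) • x‖ := by
    rw [Subtype.dist_eq, dist_eq_norm]
    congr 1
    simp only [hyperplaneProj, inner_sub_right, sub_div]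
    module
  rw [h, norm_sub_sq_real, norm_smul, inner_smul_right, hx, mul_pow, Real.norm_eq_abs, sq_abs,
    real_inner_comm]
  field_simp
  ring

theorem dist_hyperplaneProj_le (x : V) (hx : ‖x‖ = R) (hR : 0 < R) (a b : V) :
    dist (hyperplaneProj R x hx hR a) (hyperplaneProj R x hx hR b) ≤ dist a b := by
  refine le_of_sq_le_sq ?_ dist_nonneg
  rw [dist_hyperplaneProj_sq, dist_eq_norm]
  have : 0 ≤ ⟪x, a - b⟫ ^ 2 / R ^ 2 := by positivity
  linarith

/-- Chords near `x` are almost orthogonal to `x`: as `⟪a + b, a - b⟫ = 0`, one may replace `x` by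
`-((a - x) + (b - x)) / 2`, of norm at most `R / 2`. The projection keeps three quarters of the
squared length. -/
theorem dist_le_hyperplaneProj (x : V) (hx : ‖x‖ = R) (hR : 0 < R) {a b : V}
    (ha : ‖a‖ = R) (hb : ‖b‖ = R) (hax : ‖a - x‖ ≤ R / 2) (hbx : ‖b - x‖ ≤ R / 2) :
    dist a b ≤ 2 * dist (hyperplaneProj R x hx hR a) (hyperplaneProj R x hx hR b) := by
  refine le_of_sq_le_sq ?_ (by positivity)
  rw [mul_pow, dist_hyperplaneProj_sq, dist_eq_norm]
  have e1 : ⟪a + b, a - b⟫ = 0 := by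
    rw [real_inner_add_sub_eq_zero_iff, ha, hb]
  have e2 : ⟪x, a - b⟫ = -(1 / 2) * ⟪(a - x) + (b - x), a - b⟫ := by
    have : (a - x) + (b - x) = (a + b) - (2 : ℝ) • x := by module
    rw [this, inner_sub_left, e1, real_inner_smul_left]
    ring
  have e3 : |⟪(a - x) + (b - x), a - b⟫| ≤ R * ‖a - b‖ :=
    (abs_real_inner_le_norm _ _).trans (by gcongr; exact (norm_add_le _ _).trans (by linarith))
  have e4 : ⟪x, a - b⟫ ^ 2 / R ^ 2 ≤ 1 / 4 * ‖a - b‖ ^ 2 := by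
    rw [div_le_iff₀ (by positivity), e2]
    have := sq_le_sq' (abs_le.1 e3).1 (abs_le.1 e3).2
    nlinarith
  nlinarith [sq_nonneg ‖a - b‖]

variable [MeasurableSpace V] [BorelSpace V]

/-- By compactness it suffices to bound the measure near each point `x`, where the projection to the
hyperplane `x^⊥` has a Lipschitz inverse and bounded image, and the measure on `x^⊥` is Lebesgue. -/
theorem euclideanHausdorffMeasure_sphere_lt_top [FiniteDimensional ℝ V] {d : ℕ}
    (hV : Module.finrank ℝ V = d + 1) (hR : 0 < R) :
    μHE[d] (Metric.sphere (0 : V) R) < ⊤ := by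
  refine (isCompact_sphere (0 : V) R).measure_lt_top_of_nhdsWithin fun x hx => ?_
  have hxR := mem_sphere_zero_iff_norm.1 hx
  refine ⟨Metric.sphere 0 R ∩ Metric.closedBall x (R / 2),
    inter_mem_nhdsWithin _ (Metric.closedBall_mem_nhds x (by positivity)), ?_⟩
  have hfin : Module.finrank ℝ (ℝ ∙ x)ᗮ = d := by
    have : Fact (Module.finrank ℝ V = d + 1) := ⟨hV⟩
    exact Submodule.finrank_orthogonal_span_singleton (norm_pos_iff.1 (hxR ▸ hR))
  have hmeas : (μHE[d] : Measure (ℝ ∙ x)ᗮ) = volume := by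
    rw [← hfin]
    exact InnerProductSpace.euclideanHausdorffMeasure_eq_volume
  refine (euclideanHausdorffMeasure_le_image (f := hyperplaneProj R x hxR hR) (K := 2)
    (fun a ha b hb => ?_) d).trans_lt (ENNReal.mul_lt_top (by simp) ?_)
  · exact dist_le_hyperplaneProj x hxR hR (mem_sphere_zero_iff_norm.1 ha.1)
      (mem_sphere_zero_iff_norm.1 hb.1) (mem_closedBall_iff_norm.1 ha.2)
      (mem_closedBall_iff_norm.1 hb.2)
  · rw [hmeas]
    refine lt_of_le_of_lt (measure_mono ?_)
      (isCompact_closedBall (hyperplaneProj R x hxR hR x) (R / 2)).measure_lt_top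
    rintro _ ⟨a, ha, rfl⟩
    exact (dist_hyperplaneProj_le x hxR hR a x).trans ha.2

/-- The contracting projection to `x^⊥` maps the sphere onto a set containing the ball of radius
`R`. -/
theorem euclideanHausdorffMeasure_sphere_pos [FiniteDimensional ℝ V] {d : ℕ}
    (hV : Module.finrank ℝ V = d + 1) (hR : 0 < R) :
    0 < μHE[d] (Metric.sphere (0 : V) R) := by
  have : Nontrivial V := Module.nontrivial_of_finrank_pos (R := ℝ) (by omega)
  obtain ⟨x, hxR⟩ := exists_norm_eq V hR.le
  have hfin : Module.finrank ℝ (ℝ ∙ x)ᗮ = d := by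
    have : Fact (Module.finrank ℝ V = d + 1) := ⟨hV⟩
    exact Submodule.finrank_orthogonal_span_singleton (norm_pos_iff.1 (hxR ▸ hR))
  have hmeas : (μHE[d] : Measure (ℝ ∙ x)ᗮ) = volume := by
    rw [← hfin]
    exact InnerProductSpace.euclideanHausdorffMeasure_eq_volume
  have hlip : LipschitzOnWith 1 (hyperplaneProj R x hxR hR) (Metric.sphere 0 R) :=
    LipschitzOnWith.of_dist_le_mul fun a _ b _ => by
      simpa using dist_hyperplaneProj_le x hxR hR a b
  have h1 := euclideanHausdorffMeasure_image_le hlip d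
  rw [ENNReal.coe_one, one_pow, one_mul, hmeas] at h1
  refine lt_of_lt_of_le ?_ h1
  refine lt_of_lt_of_le (Metric.measure_ball_pos volume (0 : (ℝ ∙ x)ᗮ) hR) (measure_mono ?_)
  intro w hw
  have hwn : ‖w‖ < R := mem_ball_zero_iff.1 hw
  have hwx : ⟪x, (w : V)⟫ = 0 := Submodule.mem_orthogonal_singleton_iff_inner_right.1 w.2
  have hnn : 0 ≤ R ^ 2 - ‖w‖ ^ 2 := by nlinarith [norm_nonneg w]
  refine ⟨(w : V) + (√(R ^ 2 - ‖w‖ ^ 2) / R) • x, ?_, ?_⟩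
  · rw [mem_sphere_zero_iff_norm, ← sq_eq_sq₀ (norm_nonneg _) hR.le, norm_add_sq_real,
      inner_smul_right, real_inner_comm, hwx, norm_smul, hxR, mul_pow, Real.norm_eq_abs, sq_abs,
      div_pow, Real.sq_sqrt hnn, Submodule.coe_norm]
    field_simp
    ring
  · ext
    simp only [hyperplaneProj]
    rw [inner_add_right, hwx, inner_smul_right, real_inner_self_eq_norm_sq, hxR]
    have : (0 + √(R ^ 2 - ‖w‖ ^ 2) / R * R ^ 2) / R ^ 2 = √(R ^ 2 - ‖w‖ ^ 2) / R := by
      field_simp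
      ring
    rw [this]
    abel

end Sphere

variable {d D : ℕ} {H : Space D → ℝ} {R η : ℝ}

theorem volume_roundSphere_lt_top (hdD : d < D) (hR : 0 < R) :
    μHE[d] (perturbedSphere d (0 : Space D → ℝ) R 0) < ⊤ := by
  rw [perturbedSphere_zero_eq_image hR, isometry_subtype_coe.euclideanHausdorffMeasure_image]
  exact euclideanHausdorffMeasure_sphere_lt_top (finrank_coordSubspace hdD) hR

theorem volume_roundSphere_pos (hdD : d < D) (hR : 0 < R) :
    0 < μHE[d] (perturbedSphere d (0 : Space D → ℝ) R 0) := by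
  rw [perturbedSphere_zero_eq_image hR, isometry_subtype_coe.euclideanHausdorffMeasure_image]
  exact euclideanHausdorffMeasure_sphere_pos (finrank_coordSubspace hdD) hR

theorem IsTame.volume_le (h : IsTame H R η) :
    μHE[d] (perturbedSphere d H R η) ≤
      2 ^ d * μHE[d] (perturbedSphere d (0 : Space D → ℝ) R 0) := by
  rw [← h.radialProj_image]
  refine euclideanHausdorffMeasure_le_image (K := 2) (fun a ha b hb => ?_) d
  rw [dist_eq_norm, dist_eq_norm]
  exact h.norm_sub_le_radialProj ha hb

/-- On a cone, an outward perturbation increases the volume. -/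
theorem IsTame.volume_inter_cone_le (h : IsTame H R η) {U : Set (Space D)}
    (hU : ∀ y ∈ U, ∀ s : ℝ, 0 < s → s • y ∈ U) (hpos : ∀ y, 0 ≤ η * H y) :
    μHE[d] (perturbedSphere d (0 : Space D → ℝ) R 0 ∩ U) ≤
      μHE[d] (perturbedSphere d H R η ∩ U) := by
  have hR := h.pos
  have hout : ∀ y ∈ perturbedSphere d H R η, R ≤ ‖y‖ := fun y hy => by
    refine le_of_sq_le_sq ?_ (norm_nonneg _)
    rw [hy.2]
    linarith [hpos y]
  -- An outward perturbation stays outside the ball, where radial projection contracts. Scaling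
  -- preserves the cone, so the part of the round sphere in it is covered.
  have hlip : LipschitzOnWith 1 (radialProj R) (perturbedSphere d H R η ∩ U) :=
    LipschitzOnWith.of_dist_le_mul fun a ha b hb => by
      rw [NNReal.coe_one, one_mul, dist_eq_norm, dist_eq_norm]
      exact norm_radialProj_sub_le hR (hout a ha.1) (hout b hb.1)
  have h1 := euclideanHausdorffMeasure_image_le hlip d
  rw [ENNReal.coe_one, one_pow, one_mul] at h1
  refine (measure_mono ?_).trans h1
  rintro z ⟨⟨hz, hzR⟩, hzU⟩
  have hzR' : ‖z‖ = R := by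
    simp only [zero_mul, add_zero] at hzR
    exact (sq_eq_sq₀ (norm_nonneg _) hR.le).1 hzR
  obtain ⟨s, hs, hsM⟩ := h.exists_smul_mem hz hzR'
  exact ⟨_, ⟨hsM, hU z hzU s hs⟩, radialProj_smul hR hzR' hs⟩

end

noncomputable section

/-! ### Rotations in the plane of the first two coordinates -/

section Rotation

variable {d D : ℕ}

/-- The first two coordinates, as a complex number. -/
def planeCoord (hD : 1 < D) : Space D →ₗ[ℝ] ℂ where
  toFun y := ⟨y ⟨0, by omega⟩, y ⟨1, hD⟩⟩
  map_add' a b := by apply Complex.ext <;> simp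
  map_smul' c a := by apply Complex.ext <;> simp

theorem continuous_planeCoord (hD : 1 < D) : Continuous (planeCoord hD) :=
  (planeCoord hD).continuous_of_finiteDimensional

/-- The rotation of angle `θ`, as a linear map. -/
def rotLinear (hD : 1 < D) (θ : ℝ) : Space D →ₗ[ℝ] Space D where
  toFun y := WithLp.toLp 2 fun i =>
    if (i : ℕ) = 0 then (Complex.exp (θ * Complex.I) * planeCoord hD y).re
    else if (i : ℕ) = 1 then (Complex.exp (θ * Complex.I) * planeCoord hD y).im else y i
  map_add' a b := by
    ext i
    simp only [map_add, mul_add, Complex.add_re, Complex.add_im, PiLp.add_apply]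
    split_ifs <;> rfl
  map_smul' c a := by
    ext i
    simp only [map_smul, PiLp.smul_apply, smul_eq_mul, RingHom.id_apply, mul_smul_comm,
      Complex.smul_re, Complex.smul_im]
    split_ifs <;> rfl

theorem planeCoord_rotLinear (hD : 1 < D) (θ : ℝ) (y : Space D) :
    planeCoord hD (rotLinear hD θ y) = Complex.exp (θ * Complex.I) * planeCoord hD y := by
  apply Complex.ext <;> simp [planeCoord, rotLinear]

theorem rotLinear_apply_of_two_le (hD : 1 < D) (θ : ℝ) (y : Space D) {i : Fin D}
    (hi : 2 ≤ (i : ℕ)) : rotLinear hD θ y i = y i := by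
  have h0 : (i : ℕ) ≠ 0 := by omega
  have h1 : (i : ℕ) ≠ 1 := by omega
  simp [rotLinear, h0, h1]

theorem eq_of_planeCoord_eq (hD : 1 < D) {y z : Space D} (h : planeCoord hD y = planeCoord hD z)
    (h2 : ∀ i : Fin D, 2 ≤ (i : ℕ) → y i = z i) : y = z := by
  ext i
  rcases Nat.lt_or_ge i 2 with hi | hi
  · have hre := congrArg Complex.re h
    have him := congrArg Complex.im h
    rcases (by omega : (i : ℕ) = 0 ∨ (i : ℕ) = 1) with h0 | h1
    · have : i = ⟨0, by omega⟩ := Fin.ext h0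
      rw [this]
      exact hre
    · have : i = ⟨1, hD⟩ := Fin.ext h1
      rw [this]
      exact him
  · exact h2 i hi

theorem norm_sq_eq_planeCoord (hD : 1 < D) (y : Space D) :
    ‖y‖ ^ 2 = ‖planeCoord hD y‖ ^ 2 +
      ∑ i ∈ Finset.univ.filter (fun i : Fin D => 2 ≤ (i : ℕ)), y i ^ 2 := by
  classical
  rw [EuclideanSpace.norm_sq_eq, Complex.sq_norm, Complex.normSq_apply,
    ← Finset.sum_filter_add_sum_filter_not _ (fun i : Fin D => 2 ≤ (i : ℕ)), add_comm]
  have hset : Finset.univ.filter (fun i : Fin D => ¬ 2 ≤ (i : ℕ)) =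
      {⟨0, by omega⟩, ⟨1, hD⟩} := by
    ext i
    simp only [Finset.mem_filter, Finset.mem_univ, true_and, Finset.mem_insert,
      Finset.mem_singleton, Fin.ext_iff]
    omega
  rw [hset, Finset.sum_pair (by simp [Fin.ext_iff])]
  simp [planeCoord, sq]

theorem norm_rotLinear (hD : 1 < D) (θ : ℝ) (y : Space D) : ‖rotLinear hD θ y‖ = ‖y‖ := by
  rw [← sq_eq_sq₀ (norm_nonneg _) (norm_nonneg _), norm_sq_eq_planeCoord hD,
    norm_sq_eq_planeCoord hD, planeCoord_rotLinear, norm_mul, Complex.norm_exp_ofReal_mul_I, one_mul]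
  congr 1
  refine Finset.sum_congr rfl fun i hi => ?_
  rw [rotLinear_apply_of_two_le hD θ y (Finset.mem_filter.1 hi).2]

theorem rotLinear_rotLinear (hD : 1 < D) (θ θ' : ℝ) (y : Space D) :
    rotLinear hD θ (rotLinear hD θ' y) = rotLinear hD (θ + θ') y := by
  refine eq_of_planeCoord_eq hD ?_ fun i hi => ?_
  · rw [planeCoord_rotLinear, planeCoord_rotLinear, planeCoord_rotLinear, ← mul_assoc,
      ← Complex.exp_add]
    push_cast
    ring_nf
  · simp only [rotLinear_apply_of_two_le hD _ _ hi]

theorem rotLinear_zero (hD : 1 < D) (y : Space D) : rotLinear hD 0 y = y := by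
  refine eq_of_planeCoord_eq hD ?_ fun i hi => ?_
  · rw [planeCoord_rotLinear]
    simp
  · simp only [rotLinear_apply_of_two_le hD _ _ hi]

/-- The rotation of angle `θ` in the plane of the first two coordinates. -/
def rot (hD : 1 < D) (θ : ℝ) : Space D ≃ₗᵢ[ℝ] Space D where
  toLinearEquiv := LinearEquiv.ofLinearMap (rotLinear hD θ) (rotLinear hD (-θ))
    (by ext1 y; simp [rotLinear_rotLinear, rotLinear_zero])
    (by ext1 y; simp [rotLinear_rotLinear, rotLinear_zero])
  norm_map' y := norm_rotLinear hD θ y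

theorem planeCoord_rot (hD : 1 < D) (θ : ℝ) (y : Space D) :
    planeCoord hD (rot hD θ y) = Complex.exp (θ * Complex.I) * planeCoord hD y :=
  planeCoord_rotLinear hD θ y

theorem rot_rot (hD : 1 < D) (θ θ' : ℝ) (y : Space D) :
    rot hD θ (rot hD θ' y) = rot hD (θ + θ') y := rotLinear_rotLinear hD θ θ' y

theorem rot_neg_rot (hD : 1 < D) (θ : ℝ) (y : Space D) : rot hD (-θ) (rot hD θ y) = y := by
  rw [rot_rot, neg_add_cancel]
  exact rotLinear_zero hD y

theorem rot_rot_neg (hD : 1 < D) (θ : ℝ) (y : Space D) : rot hD θ (rot hD (-θ) y) = y := by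
  rw [rot_rot, add_neg_cancel]
  exact rotLinear_zero hD y

theorem rot_mem_coordSubspace (hD : 1 < D) (hd : 1 ≤ d) (θ : ℝ) {y : Space D} :
    rot hD θ y ∈ coordSubspace d D ↔ y ∈ coordSubspace d D := by
  have h : ∀ i : Fin D, d < (i : ℕ) → rot hD θ y i = y i := fun i hi =>
    rotLinear_apply_of_two_le hD θ y (by omega)
  exact ⟨fun hy i hi => (h i hi).symm.trans (hy i hi), fun hy i hi => (h i hi).trans (hy i hi)⟩

end Rotation

/-! ### Sectors -/

section Sector

variable {d D : ℕ}

/-- The open sector of half-angle `a` around the positive first axis. -/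
def sector (hD : 1 < D) (a : ℝ) : Set (Space D) :=
  {y | planeCoord hD y ∈ Complex.slitPlane ∧ |(planeCoord hD y).arg| < a}

theorem isOpen_sector (hD : 1 < D) (a : ℝ) : IsOpen (sector hD a) := by
  have h1 : IsOpen (Complex.slitPlane ∩ Complex.arg ⁻¹' {x | |x| < a}) := by
    refine ContinuousOn.isOpen_inter_preimage (fun z hz => ?_) Complex.isOpen_slitPlane
      (isOpen_lt continuous_abs continuous_const)
    exact (Complex.continuousAt_arg hz).continuousWithinAt
  exact h1.preimage (continuous_planeCoord hD)

theorem smul_mem_sector (hD : 1 < D) {a : ℝ} {y : Space D} (hy : y ∈ sector hD a) {s : ℝ}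
    (hs : 0 < s) : s • y ∈ sector hD a := by
  obtain ⟨h1, h2⟩ := hy
  have h3 : planeCoord hD (s • y) = (s : ℂ) * planeCoord hD y := by
    rw [map_smul, Complex.real_smul]
  have h4 : (planeCoord hD (s • y)).arg = (planeCoord hD y).arg := by
    rw [h3, Complex.arg_real_mul _ hs]
  rw [Complex.mem_slitPlane_iff_arg] at h1
  refine ⟨Complex.mem_slitPlane_iff_arg.2 ⟨by rw [h4]; exact h1.1, ?_⟩, by rwa [h4]⟩
  rw [h3]
  exact mul_ne_zero (by exact_mod_cast hs.ne') h1.2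

/-- The rotated sectors: `2π j / K` is the angle of the axis, and `2π / K` the half-angle. -/
def rotSector (hD : 1 < D) (K j : ℕ) : Set (Space D) :=
  rot hD (-(2 * Real.pi * j / K)) ⁻¹' sector hD (2 * Real.pi / K)

theorem isOpen_rotSector (hD : 1 < D) (K j : ℕ) : IsOpen (rotSector hD K j) :=
  (isOpen_sector hD _).preimage (rot hD _).continuous

theorem exists_of_mem_rotSector (hD : 1 < D) {K j : ℕ} {y : Space D}
    (hy : y ∈ rotSector hD K j) : planeCoord hD y ≠ 0 ∧ ∃ s : ℝ, |s| < 2 * Real.pi / K ∧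
      planeCoord hD y = ‖planeCoord hD y‖ * Complex.exp ((2 * Real.pi * j / K + s : ℝ) * Complex.I) := by
  obtain ⟨h1, h2⟩ := hy
  set θ : ℝ := 2 * Real.pi * j / K with hθ
  have h3 : planeCoord hD y = Complex.exp (θ * Complex.I) * planeCoord hD (rot hD (-θ) y) := by
    rw [← planeCoord_rot, rot_rot_neg]
  have h4 : ‖planeCoord hD (rot hD (-θ) y)‖ = ‖planeCoord hD y‖ := by
    rw [h3, norm_mul, Complex.norm_exp_ofReal_mul_I, one_mul]
  refine ⟨?_, (planeCoord hD (rot hD (-θ) y)).arg, h2, ?_⟩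
  · rw [h3]
    exact mul_ne_zero (Complex.exp_ne_zero _) (Complex.slitPlane_ne_zero h1)
  · conv_lhs => rw [h3, ← Complex.norm_mul_exp_arg_mul_I (planeCoord hD (rot hD (-θ) y)), h4]
    rw [mul_left_comm, ← Complex.exp_add]
    push_cast
    ring_nf

/-- A common point gives `|j - l - n K| < 2` for some integer `n`. All terms being even, this
integer is `0`, and `j, l < K` then forces `n = 0`. Evenness of `K` handles the wrap-around. -/
theorem disjoint_rotSector (hD : 1 < D) {K j l : ℕ} (hK : Even K) (hj : Even j) (hl : Even l)
    (hjK : j < K) (hlK : l < K) (hjl : j ≠ l) :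
    Disjoint (rotSector hD K j) (rotSector hD K l) := by
  refine Set.disjoint_left.2 fun y hyj hyl => hjl ?_
  obtain ⟨h0, s, hs, h1⟩ := exists_of_mem_rotSector hD hyj
  obtain ⟨-, s', hs', h2⟩ := exists_of_mem_rotSector hD hyl
  rw [h1] at h2
  have hKpos : (0 : ℝ) < K := by exact_mod_cast (by omega : 0 < K)
  have hn : ((‖planeCoord hD y‖ : ℝ) : ℂ) ≠ 0 := by
    exact_mod_cast norm_ne_zero_iff.2 h0
  have hnorm : ‖(‖planeCoord hD y‖ : ℂ) *
      Complex.exp ((2 * Real.pi * j / K + s : ℝ) * Complex.I)‖ = ‖planeCoord hD y‖ := by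
    rw [← h1]
  rw [hnorm] at h2
  obtain ⟨n, hn'⟩ := Complex.exp_eq_exp_iff_exists_int.1 (mul_left_cancel₀ hn h2)
  have h3 : 2 * Real.pi * j / K + s = 2 * Real.pi * l / K + s' + n * (2 * Real.pi) := by
    have h4 : ((2 * Real.pi * j / K + s : ℝ) : ℂ) * Complex.I =
        ((2 * Real.pi * l / K + s' + n * (2 * Real.pi) : ℝ) : ℂ) * Complex.I := by
      rw [hn']
      push_cast
      ring
    exact_mod_cast mul_right_cancel₀ Complex.I_ne_zero h4
  have h5 : 2 * Real.pi * ((j : ℝ) - l - n * K) = (s' - s) * K := by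
    field_simp at h3
    linarith
  have h6 : |s' - s| * K < 2 * Real.pi * 2 := by
    rw [lt_div_iff₀ hKpos] at hs hs'
    have := abs_sub s' s
    nlinarith
  have h7 : |(j : ℝ) - l - n * K| < 2 := by
    have hpi : 0 < 2 * Real.pi := by positivity
    have h8 := congrArg abs h5
    rw [abs_mul (2 * Real.pi), abs_mul (s' - s), abs_of_pos hpi, abs_of_pos hKpos] at h8
    rw [← h8] at h6
    exact lt_of_mul_lt_mul_left h6 hpi.le
  have h9 : |(j : ℤ) - l - n * K| < 2 := by exact_mod_cast h7
  obtain ⟨K', rfl⟩ := hK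
  obtain ⟨j', rfl⟩ := hj
  obtain ⟨l', rfl⟩ := hl
  rw [abs_lt] at h9
  have h10 : (j' : ℤ) - l' = n * K' := by
    push_cast at h9
    have h11 : n * ((K' : ℤ) + K') = n * K' + n * K' := by ring
    rw [h11] at h9
    omega
  have hn0 : n = 0 := by
    by_contra hne
    rcases lt_or_gt_of_ne hne with h | h
    · have : n * (K' : ℤ) ≤ -1 * K' := by gcongr; omega
      omega
    · have : 1 * (K' : ℤ) ≤ n * K' := by gcongr; omega
      omega
  rw [hn0] at h10
  omega

/-- The index is the integer part of the angle in units of `2π / K`; `K > 2` keeps the remaining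
angle below `π`, away from the branch cut of `arg`. -/
theorem exists_mem_rotSector (hD : 1 < D) {K : ℕ} (hK : 2 < K) {y : Space D}
    (hy : planeCoord hD y ≠ 0) : ∃ j < K, y ∈ rotSector hD K j := by
  have hpi := Real.pi_pos
  have hKpos : (0 : ℝ) < K := by exact_mod_cast (by omega : 0 < K)
  obtain ⟨a, ha0, ha1, ha⟩ : ∃ a : ℝ, 0 ≤ a ∧ a < 2 * Real.pi ∧
      planeCoord hD y = ‖planeCoord hD y‖ * Complex.exp (a * Complex.I) := by
    have h1 := Complex.norm_mul_exp_arg_mul_I (planeCoord hD y)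
    rcases le_or_gt 0 (planeCoord hD y).arg with h | h
    · exact ⟨_, h, by linarith [Complex.arg_le_pi (planeCoord hD y)], h1.symm⟩
    · refine ⟨(planeCoord hD y).arg + 2 * Real.pi, ?_, by linarith, ?_⟩
      · linarith [Complex.neg_pi_lt_arg (planeCoord hD y)]
      · conv_lhs => rw [← h1]
        rw [Complex.ofReal_add, add_mul, Complex.exp_add]
        push_cast
        rw [Complex.exp_two_pi_mul_I, mul_one]
  set j := ⌊a * K / (2 * Real.pi)⌋₊ with hj
  have hj1 : (j : ℝ) ≤ a * K / (2 * Real.pi) := Nat.floor_le (by positivity)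
  have hj2 : a * K / (2 * Real.pi) < j + 1 := Nat.lt_floor_add_one _
  rw [le_div_iff₀ (by positivity)] at hj1
  rw [div_lt_iff₀ (by positivity)] at hj2
  refine ⟨j, ?_, ?_⟩
  · have h1 : (j : ℝ) * (2 * Real.pi) < K * (2 * Real.pi) := by nlinarith
    exact_mod_cast lt_of_mul_lt_mul_right h1 (by positivity)
  · set b : ℝ := a - 2 * Real.pi * j / K with hb
    have hb0 : 0 ≤ b := by
      rw [hb, sub_nonneg, div_le_iff₀ hKpos]
      linarith
    have hb1 : b < 2 * Real.pi / K := by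
      rw [hb, sub_lt_iff_lt_add, ← add_div, lt_div_iff₀ hKpos]
      linarith
    have hb2 : b < Real.pi := by
      refine hb1.trans ?_
      rw [div_lt_iff₀ hKpos]
      have : (2 : ℝ) < K := by exact_mod_cast hK
      nlinarith
    have hz : planeCoord hD (rot hD (-(2 * Real.pi * j / K)) y) =
        ‖planeCoord hD y‖ * (Complex.cos b + Complex.sin b * Complex.I) := by
      rw [planeCoord_rot, ← Complex.exp_mul_I]
      conv_lhs => rw [ha]
      rw [mul_left_comm, ← Complex.exp_add, hb]
      push_cast
      ring_nf
    have harg : (planeCoord hD (rot hD (-(2 * Real.pi * j / K)) y)).arg = b := by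
      rw [hz]
      exact Complex.arg_mul_cos_add_sin_mul_I (norm_pos_iff.2 hy) ⟨by linarith, hb2.le⟩
    refine ⟨Complex.mem_slitPlane_iff_arg.2 ⟨by rw [harg]; exact hb2.ne, ?_⟩, ?_⟩
    · rw [planeCoord_rot]
      exact mul_ne_zero (Complex.exp_ne_zero _) hy
    · rwa [harg, abs_of_nonneg hb0]

theorem perturbedSphere_rot_inter (hD : 1 < D) (hd : 1 ≤ d) (H : Space D → ℝ) (R η θ : ℝ)
    (U : Set (Space D)) :
    perturbedSphere d (fun y => H (rot hD (-θ) y)) R η ∩ rot hD (-θ) ⁻¹' U =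
      rot hD θ '' (perturbedSphere d H R η ∩ U) := by
  ext y
  constructor
  · rintro ⟨⟨hy, hyR⟩, hyU⟩
    refine ⟨rot hD (-θ) y, ⟨⟨(rot_mem_coordSubspace hD hd _).2 hy, ?_⟩, hyU⟩, rot_rot_neg hD θ y⟩
    rwa [LinearIsometryEquiv.norm_map]
  · rintro ⟨y, ⟨⟨hy, hyR⟩, hyU⟩, rfl⟩
    refine ⟨⟨(rot_mem_coordSubspace hD hd _).2 hy, ?_⟩, ?_⟩
    · simp only [LinearIsometryEquiv.norm_map, rot_neg_rot]
      exact hyR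
    · rwa [mem_preimage, rot_neg_rot]

theorem volume_rot_inter (hD : 1 < D) (hd : 1 ≤ d) (H : Space D → ℝ) (R η θ : ℝ)
    (U : Set (Space D)) :
    μHE[d] (perturbedSphere d (fun y => H (rot hD (-θ) y)) R η ∩ rot hD (-θ) ⁻¹' U) =
      μHE[d] (perturbedSphere d H R η ∩ U) := by
  rw [perturbedSphere_rot_inter hD hd]
  exact (rot hD θ).isometry.euclideanHausdorffMeasure_image _

/-- Two independent linear conditions cut the dimension from `d + 1` to below `d`, where
`d`-dimensional Hausdorff measure vanishes. -/
theorem volume_axis_eq_zero (hD : 1 < D) (hd : 1 ≤ d) (hdD : d < D) :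
    μHE[d] {y : Space D | y ∈ coordSubspace d D ∧ planeCoord hD y = 0} = 0 := by
  set i₀ : Fin D := ⟨0, by omega⟩ with hi₀
  set i₁ : Fin D := ⟨1, hD⟩ with hi₁
  set E₁ := coordSubspace d D ⊓ LinearMap.ker (EuclideanSpace.proj (𝕜 := ℝ) i₀).toLinearMap
  set E₂ := coordSubspace d D ⊓ LinearMap.ker (planeCoord hD)
  have h1 : E₁ < coordSubspace d D := by
    refine lt_of_le_of_ne inf_le_left fun h => ?_
    have : EuclideanSpace.single i₀ (1 : ℝ) ∈ E₁ := by
      rw [h]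
      exact single_mem_coordSubspace (Nat.zero_le d) 1
    have h2 := this.2
    simp at h2
  have h2 : E₂ < E₁ := by
    refine lt_of_le_of_ne (fun y hy => ⟨hy.1, congrArg Complex.re hy.2⟩) fun h => ?_
    have hne : i₀ ≠ i₁ := by simp [hi₀, hi₁, Fin.ext_iff]
    have : EuclideanSpace.single i₁ (1 : ℝ) ∈ E₂ := by
      rw [h]
      refine ⟨single_mem_coordSubspace hd 1, ?_⟩
      simp [hne]
    have h2 : (planeCoord hD (EuclideanSpace.single i₁ (1 : ℝ))).im = 0 := by
      rw [this.2]
      rfl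
    have h3 : (EuclideanSpace.single i₁ (1 : ℝ) : Space D) i₁ = 0 := h2
    simp at h3
  have h3 := Submodule.finrank_lt_finrank_of_lt h1
  have h4 := Submodule.finrank_lt_finrank_of_lt h2
  rw [finrank_coordSubspace hdD] at h3
  have hdim : dimH (E₂ : Set (Space D)) = Module.finrank ℝ E₂ := by
    have h5 : (E₂ : Set (Space D)) = E₂.subtypeₗᵢ '' univ := by simp
    rw [h5, E₂.subtypeₗᵢ.isometry.dimH_image]
    exact Real.dimH_univ_eq_finrank E₂
  have h6 : μH[d] (E₂ : Set (Space D)) = 0 := by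
    have := hausdorffMeasure_of_dimH_lt (s := (E₂ : Set (Space D))) (d := d) (by
      rw [hdim]
      exact_mod_cast (by omega : Module.finrank ℝ E₂ < d))
    simpa using this
  have h7 : {y : Space D | y ∈ coordSubspace d D ∧ planeCoord hD y = 0} = (E₂ : Set (Space D)) :=
    rfl
  rw [h7, Measure.euclideanHausdorffMeasure_def, Measure.smul_apply, h6, smul_zero]

/-- The sectors of half-angle `2π / K` carry at least the fraction `1 / K` of the round sphere. -/
theorem volume_roundSphere_le (hD : 1 < D) (hd : 1 ≤ d) (hdD : d < D) {K : ℕ} (hK : 2 < K)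
    (R : ℝ) :
    μHE[d] (perturbedSphere d (0 : Space D → ℝ) R 0) ≤
      K * μHE[d] (perturbedSphere d (0 : Space D → ℝ) R 0 ∩ sector hD (2 * Real.pi / K)) := by
  set S := perturbedSphere d (0 : Space D → ℝ) R 0 with hS
  have hcov : S ⊆ {y : Space D | y ∈ coordSubspace d D ∧ planeCoord hD y = 0} ∪
      ⋃ j ∈ Finset.range K, S ∩ rotSector hD K j := by
    intro y hy
    by_cases h0 : planeCoord hD y = 0
    · exact Or.inl ⟨hy.1, h0⟩
    · obtain ⟨j, hj, hyj⟩ := exists_mem_rotSector hD hK h0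
      exact Or.inr (mem_iUnion₂.2 ⟨j, Finset.mem_range.2 hj, hy, hyj⟩)
  calc μHE[d] S ≤ μHE[d] {y : Space D | y ∈ coordSubspace d D ∧ planeCoord hD y = 0} +
        μHE[d] (⋃ j ∈ Finset.range K, S ∩ rotSector hD K j) :=
        (measure_mono hcov).trans (measure_union_le _ _)
    _ ≤ 0 + ∑ j ∈ Finset.range K, μHE[d] (S ∩ rotSector hD K j) := by
        rw [volume_axis_eq_zero hD hd hdD]
        gcongr
        exact measure_biUnion_finset_le _ _
    _ = ∑ _j ∈ Finset.range K, μHE[d] (S ∩ sector hD (2 * Real.pi / K)) := by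
        rw [zero_add]
        exact Finset.sum_congr rfl fun j _ => volume_rot_inter hD hd 0 R 0 _ _
    _ = _ := by simp

end Sector

end

noncomputable section

variable {d D m : ℕ} {R η : ℝ} {H₀ : Space D → ℝ}

/-! ### Bumps with signs -/

/-- The index of the sector chosen by the sign `b` in the `j`-th cell. -/
def sectorIndex (j : Fin m) (b : Bool) : ℕ := 4 * j + 2 * b.toNat

/-- The sector chosen by the sign `b` in the `j`-th cell. -/
def signSector (hD : 1 < D) (j : Fin m) (b : Bool) : Set (Space D) :=
  rotSector hD (4 * m) (sectorIndex j b)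

/-- The rotation that maps the sector chosen by the sign `b` in the `j`-th cell to the sector around
the first axis. -/
def signRot (hD : 1 < D) (j : Fin m) (b : Bool) : Space D ≃ₗᵢ[ℝ] Space D :=
  rot hD (-(2 * Real.pi * (sectorIndex j b : ℕ) / (4 * m : ℕ)))

/-- The sum of the rotated copies of the bump `H₀` chosen by the signs. -/
def signedBump (hD : 1 < D) (H₀ : Space D → ℝ) (ε : Fin m → Bool) (y : Space D) : ℝ :=
  ∑ j, H₀ (signRot hD j (ε j) y)

/-- `H₀` is a smooth bump that is positive exactly on a part of the sector of half-angle `a` that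
contains all the points of norm in `(R / 2, 2 R)`. -/
structure IsSectorBump (hD : 1 < D) (a R : ℝ) (H₀ : Space D → ℝ) : Prop where
  smooth : ContDiff ℝ ∞ H₀
  compact : HasCompactSupport H₀
  nonneg : ∀ y, 0 ≤ H₀ y
  eq_zero : ∀ y, y ∉ sector hD a → H₀ y = 0
  pos : ∀ y ∈ sector hD a, R / 2 < ‖y‖ → ‖y‖ < 2 * R → 0 < H₀ y

/-- Any open set is the support of a nonnegative smooth function; the sector is truncated to a shell
to make the support bounded. -/
theorem exists_isSectorBump (hD : 1 < D) (a R : ℝ) :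
    ∃ H₀ : Space D → ℝ, IsSectorBump hD a R H₀ := by
  have hopen : IsOpen (sector hD a ∩ {y | R / 2 < ‖y‖ ∧ ‖y‖ < 2 * R}) :=
    (isOpen_sector hD a).inter ((isOpen_lt continuous_const continuous_norm).inter
      (isOpen_lt continuous_norm continuous_const))
  obtain ⟨f, hsupp, hf, hrange⟩ := hopen.exists_contDiff_support_eq (n := ⊤)
  have hnn : ∀ y, 0 ≤ f y := fun y => (hrange ⟨y, rfl⟩).1
  refine ⟨f, hf, ?_, hnn, fun y hy => ?_, fun y hy h1 h2 => ?_⟩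
  · refine HasCompactSupport.of_support_subset_isCompact
      (isCompact_closedBall (0 : Space D) (2 * R)) ?_
    rw [hsupp]
    exact fun y hy => mem_closedBall_zero_iff.2 hy.2.2.le
  · by_contra h0
    have : y ∈ Function.support f := h0
    rw [hsupp] at this
    exact hy this.1
  · have : y ∈ Function.support f := by
      rw [hsupp]
      exact ⟨hy, h1, h2⟩
    exact lt_of_le_of_ne (hnn y) (Ne.symm this)

theorem isOpen_signSector (hD : 1 < D) (j : Fin m) (b : Bool) : IsOpen (signSector hD j b) :=
  isOpen_rotSector hD _ _

/-- The indices `4 j + 2 b` are even, below `4 m`, and determine `(j, b)`. -/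
theorem disjoint_signSector (hD : 1 < D) {j l : Fin m} {b c : Bool} (h : (j, b) ≠ (l, c)) :
    Disjoint (signSector hD j b) (signSector hD l c) := by
  have heven : ∀ (j : Fin m) (b : Bool), Even (sectorIndex j b) := fun j b =>
    ⟨2 * j + b.toNat, by rw [sectorIndex]; ring⟩
  have hlt : ∀ (j : Fin m) (b : Bool), sectorIndex j b < 4 * m := fun j b => by
    have := j.2
    have := b.toNat_le
    rw [sectorIndex]
    omega
  refine disjoint_rotSector hD ⟨2 * m, by ring⟩ (heven j b) (heven l c) (hlt j b) (hlt l c) ?_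
  intro heq
  refine h ?_
  have h1 := b.toNat_le
  have h2 := c.toNat_le
  simp only [sectorIndex] at heq
  have h3 : j = l := Fin.ext (by omega)
  have h4 : b.toNat = c.toNat := by omega
  refine Prod.ext h3 ?_
  cases b <;> cases c <;> simp_all

theorem smooth_signedBump (hD : 1 < D) (hH : ContDiff ℝ ∞ H₀) (ε : Fin m → Bool) :
    ContDiff ℝ ∞ (signedBump hD H₀ ε) :=
  ContDiff.sum fun j _ => hH.comp (signRot hD j (ε j)).contDiff

theorem hasCompactSupport_signedBump (hD : 1 < D) (hH : HasCompactSupport H₀)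
    (ε : Fin m → Bool) : HasCompactSupport (signedBump hD H₀ ε) := by
  have h : ∀ s : Finset (Fin m),
      HasCompactSupport fun y => ∑ j ∈ s, H₀ (signRot hD j (ε j) y) := by
    intro s
    induction s using Finset.cons_induction with
    | empty =>
      simp only [Finset.sum_empty]
      exact HasCompactSupport.zero
    | cons j s hj ih =>
      simp only [Finset.sum_cons]
      exact (hH.comp_homeomorph (signRot hD j (ε j)).toHomeomorph).add ih
  exact h Finset.univ

theorem IsSectorBump.term_eq_zero {hD : 1 < D}
    (h₀ : IsSectorBump hD (2 * Real.pi / (4 * m : ℕ)) R H₀)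
    {j : Fin m} {b : Bool} {y : Space D} (hy : y ∉ signSector hD j b) :
    H₀ (signRot hD j b y) = 0 :=
  h₀.eq_zero _ hy

theorem IsSectorBump.signedBump_eq {hD : 1 < D}
    (h₀ : IsSectorBump hD (2 * Real.pi / (4 * m : ℕ)) R H₀) {ε : Fin m → Bool} {j : Fin m}
    {y : Space D} (hy : y ∈ signSector hD j (ε j)) :
    signedBump hD H₀ ε y = H₀ (signRot hD j (ε j) y) := by
  refine Finset.sum_eq_single j (fun l _ hl => h₀.term_eq_zero fun hyl => ?_) (by simp)
  refine Set.disjoint_left.1 (disjoint_signSector hD ?_) hyl hy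
  exact fun h => hl (Prod.ext_iff.1 h).1

theorem IsSectorBump.signedBump_eq_zero {hD : 1 < D}
    (h₀ : IsSectorBump hD (2 * Real.pi / (4 * m : ℕ)) R H₀) {ε : Fin m → Bool}
    {y : Space D} (hy : ∀ j, y ∉ signSector hD j (ε j)) : signedBump hD H₀ ε y = 0 :=
  Finset.sum_eq_zero fun j _ => h₀.term_eq_zero (hy j)

theorem IsSectorBump.inter_signSector {hD : 1 < D}
    (h₀ : IsSectorBump hD (2 * Real.pi / (4 * m : ℕ)) R H₀) (ε : Fin m → Bool) (j : Fin m) :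
    perturbedSphere d (signedBump hD H₀ ε) R η ∩ signSector hD j (ε j) =
      perturbedSphere d (fun y => H₀ (signRot hD j (ε j) y)) R η ∩ signSector hD j (ε j) := by
  ext y
  refine and_congr_left fun hy => ?_
  simp only [perturbedSphere, mem_ofPred_eq, h₀.signedBump_eq hy]

/-- All the bumps have the same volume. -/
theorem IsSectorBump.volume_inter_signSector {hD : 1 < D}
    (h₀ : IsSectorBump hD (2 * Real.pi / (4 * m : ℕ)) R H₀) (hd : 1 ≤ d) (ε : Fin m → Bool)
    (j : Fin m) :
    μHE[d] (perturbedSphere d (signedBump hD H₀ ε) R η ∩ signSector hD j (ε j)) =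
      μHE[d] (perturbedSphere d H₀ R η ∩ sector hD (2 * Real.pi / (4 * m : ℕ))) := by
  rw [h₀.inter_signSector]
  exact volume_rot_inter hD hd H₀ R η _ _

theorem pairwise_disjoint_signSector (hD : 1 < D) (ε : Fin m → Bool) :
    Pairwise (Function.onFun Disjoint fun j => signSector hD j (ε j)) := fun _ _ hjl =>
  disjoint_signSector hD fun h => hjl (Prod.ext_iff.1 h).1

theorem measure_eq_diff_add_sum_signSector (hD : 1 < D) (μ : Measure (Space D))
    (ε : Fin m → Bool) (M : Set (Space D)) :
    μ M = μ (M \ ⋃ j, signSector hD j (ε j)) + ∑ j, μ (M ∩ signSector hD j (ε j)) := by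
  have hopen : ∀ j, MeasurableSet (signSector hD j (ε j)) := fun j =>
    (isOpen_signSector hD j (ε j)).measurableSet
  rw [← measure_inter_add_sdiff M (MeasurableSet.iUnion hopen), add_comm]
  congr 1
  rw [inter_comm, ← Measure.restrict_apply (MeasurableSet.iUnion hopen),
    measure_iUnion (pairwise_disjoint_signSector hD ε) hopen, tsum_fintype]
  exact Finset.sum_congr rfl fun j _ => by rw [Measure.restrict_apply (hopen j), inter_comm]

/-- The volume of the sphere with signed bumps does not depend on the signs. -/
theorem IsSectorBump.volume_add {hD : 1 < D}
    (h₀ : IsSectorBump hD (2 * Real.pi / (4 * m : ℕ)) R H₀) (hd : 1 ≤ d) (ε : Fin m → Bool) :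
    μHE[d] (perturbedSphere d (signedBump hD H₀ ε) R η) +
        m * μHE[d] (perturbedSphere d (0 : Space D → ℝ) R 0 ∩
          sector hD (2 * Real.pi / (4 * m : ℕ))) =
      μHE[d] (perturbedSphere d (0 : Space D → ℝ) R 0) +
        m * μHE[d] (perturbedSphere d H₀ R η ∩ sector hD (2 * Real.pi / (4 * m : ℕ))) := by
  -- Off the chosen sectors both spheres coincide; in each of them the piece is a rotated copy of
  -- the one around the first axis. The additive form avoids subtraction in `ℝ≥0∞`.
  rw [measure_eq_diff_add_sum_signSector hD μHE[d] ε (perturbedSphere d (signedBump hD H₀ ε) R η),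
    measure_eq_diff_add_sum_signSector hD μHE[d] ε (perturbedSphere d (0 : Space D → ℝ) R 0)]
  have h1 : perturbedSphere d (signedBump hD H₀ ε) R η \ ⋃ j, signSector hD j (ε j) =
      perturbedSphere d (0 : Space D → ℝ) R 0 \ ⋃ j, signSector hD j (ε j) := by
    ext y
    refine and_congr_left fun hy => ?_
    have hy' : ∀ j, y ∉ signSector hD j (ε j) := fun j hj => hy (mem_iUnion.2 ⟨j, hj⟩)
    simp [perturbedSphere, h₀.signedBump_eq_zero hy']
  have h2 : ∀ j, μHE[d] (perturbedSphere d (0 : Space D → ℝ) R 0 ∩ signSector hD j (ε j)) =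
      μHE[d] (perturbedSphere d (0 : Space D → ℝ) R 0 ∩
        sector hD (2 * Real.pi / (4 * m : ℕ))) := fun j =>
    volume_rot_inter hD hd 0 R 0 _ _
  simp only [h1, h2, h₀.volume_inter_signSector hd, Finset.sum_const, Finset.card_univ,
    Fintype.card_fin, nsmul_eq_mul]
  ring

theorem perturbedSphere_congr {H H' : Space D → ℝ} {B : Set (Space D)}
    (h : ∀ y ∈ B, H y = H' y) : B ∩ perturbedSphere d H R η = B ∩ perturbedSphere d H' R η := by
  ext y
  refine and_congr_right fun hy => ?_
  simp only [perturbedSphere, mem_ofPred_eq, h y hy]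

theorem IsSectorBump.signedBump_congr {hD : 1 < D}
    (h₀ : IsSectorBump hD (2 * Real.pi / (4 * m : ℕ)) R H₀) {J : Finset (Fin m)}
    {ε ε' : Fin m → Bool} (h : ∀ j ∈ J, ε j = ε' j) {y : Space D}
    (hy : y ∉ ⋃ j ∈ Jᶜ, signSector hD j false ∪ signSector hD j true) :
    signedBump hD H₀ ε y = signedBump hD H₀ ε' y := by
  refine Finset.sum_congr rfl fun j _ => ?_
  by_cases hj : j ∈ J
  · rw [h j hj]
  · have hb : ∀ b : Bool, y ∉ signSector hD j b := fun b hyb => by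
      refine hy (mem_iUnion₂.2 ⟨j, Finset.mem_compl.2 hj, ?_⟩)
      cases b
      · exact Or.inl hyb
      · exact Or.inr hyb
    rw [h₀.term_eq_zero (hb _), h₀.term_eq_zero (hb _)]

/-- A bump is disjoint from the spheres on which it is switched off. -/
theorem IsSectorBump.notMem_of_ne {hD : 1 < D}
    (h₀ : IsSectorBump hD (2 * Real.pi / (4 * m : ℕ)) R H₀) (hη : 0 < η) {ε ε' : Fin m → Bool}
    (h : IsTame (signedBump hD H₀ ε) R η) {j : Fin m} (hj : ε j ≠ ε' j) {y : Space D}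
    (hy : y ∈ perturbedSphere d (signedBump hD H₀ ε) R η) (hyj : y ∈ signSector hD j (ε j)) :
    y ∉ perturbedSphere d (signedBump hD H₀ ε') R η := by
  intro hy'
  have hR := h.pos
  obtain ⟨h1, h2⟩ := h.norm_bounds hy
  -- Over an active bump the first surface lies strictly outside radius `R`, while the second has
  -- radius exactly `R` there.
  have hpos : 0 < signedBump hD H₀ ε y := by
    rw [h₀.signedBump_eq hyj]
    refine h₀.pos _ hyj ?_ ?_ <;> rw [LinearIsometryEquiv.norm_map] <;> linarith
  have hzero : signedBump hD H₀ ε' y = 0 := by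
    refine h₀.signedBump_eq_zero fun l hl => ?_
    refine Set.disjoint_left.1 (disjoint_signSector hD ?_) hyj hl
    intro heq
    obtain ⟨rfl, h3⟩ := Prod.ext_iff.1 heq
    exact hj h3
  have e1 := hy.2
  have e2 := hy'.2
  rw [hzero] at e2
  nlinarith

/-! ### Uniform measures -/

/-- The uniform distribution on a set of controlled volume belongs to the model. -/
theorem exists_uniform_mem_modelOn (d k : ℕ) {D : ℕ} {s p : ℝ} {q : ℝ≥0∞} (hsk : s < k)
    (hq : 1 ≤ q) {v₀ v₁ : ℝ≥0∞} (hv₀ : 0 < v₀) (hv₁ : v₁ < ⊤) :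
    ∃ f₀ F₀ Λ : ℝ, 0 < f₀ ∧ ∀ fmin fmax Ls : ℝ, 0 < fmin → fmin ≤ f₀ → F₀ ≤ fmax → Λ ≤ Ls →
      ∀ M : Set (Space D), v₀ ≤ μHE[d] M → μHE[d] M ≤ v₁ →
        ∃ μ ∈ modelOn d k s p q Ls fmin fmax M,
          (μ : Measure (Space D)) = (μHE[d] M)⁻¹ • volM d M := by
  obtain ⟨N, hN, hbesov⟩ : ∃ N : ℝ≥0∞, N < ⊤ ∧ (0 < s → ∀ (M : Set (Space D)) (a : ℝ)
      [IsFiniteMeasure (volM d M)], besovNorm d k s p q M (fun _ => a) ≤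
        eLpNorm (fun _ : Space D => a) (ENNReal.ofReal p) (volM d M) * N) := by
    by_cases hs : 0 < s
    · obtain ⟨N, hN, h⟩ := exists_besovNorm_const_le hs hsk hq
      exact ⟨N, hN, fun _ M a _ => h d p M a⟩
    · exact ⟨0, by simp, fun h => absurd h hs⟩
  -- The `L_p` norm of the density `V⁻¹` is `V⁻¹ V^{1/p}`, bounded through `v₀ ≤ V ≤ v₁`.
  set A : ℝ≥0∞ := v₀⁻¹ * v₁ ^ (1 / (ENNReal.ofReal p).toReal) * N with hA
  have hv₀' : v₀⁻¹ < ⊤ := ENNReal.inv_lt_top.2 hv₀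
  have hAtop : A < ⊤ := ENNReal.mul_lt_top (ENNReal.mul_lt_top hv₀'
    (ENNReal.rpow_lt_top_of_nonneg (by positivity) hv₁.ne)) hN
  rcases eq_or_ne v₁ 0 with hz | hv₁0
  · refine ⟨1, 0, 0, one_pos, fun _ _ _ _ _ _ _ M h0 h1 => ?_⟩
    rw [hz] at h1
    exact absurd (h0.trans h1) (not_le.2 hv₀)
  refine ⟨(v₁⁻¹).toReal, (v₀⁻¹).toReal, A.toReal,
    ENNReal.toReal_pos (ENNReal.inv_ne_zero.2 hv₁.ne) (ENNReal.inv_ne_top.2 hv₁0), ?_⟩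
  intro fmin fmax Ls _ hfmin hfmax hLs M h0 h1
  set V := μHE[d] M with hV
  have hVtop : V ≠ ⊤ := (h1.trans_lt hv₁).ne
  have hV0 : V ≠ 0 := (hv₀.trans_le h0).ne'
  have hVi : V⁻¹ ≠ ⊤ := ENNReal.inv_ne_top.2 hV0
  have huniv : volM d M univ = V := by rw [volM, Measure.restrict_apply_univ]
  have hfin : IsFiniteMeasure (volM d M) := ⟨by rw [huniv]; exact hVtop.lt_top⟩
  have hprob : IsProbabilityMeasure (V⁻¹ • volM d M) := ⟨by
    rw [Measure.smul_apply, huniv, smul_eq_mul, ENNReal.inv_mul_cancel hV0 hVtop]⟩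
  refine ⟨⟨V⁻¹ • volM d M, hprob⟩, ⟨fun _ => (V⁻¹).toReal, measurable_const, ?_, ?_, ?_⟩, rfl⟩
  · change V⁻¹ • volM d M = (volM d M).withDensity fun _ => ENNReal.ofReal (V⁻¹).toReal
    rw [ENNReal.ofReal_toReal hVi, withDensity_const]
  · refine Eventually.of_forall fun _ => ⟨hfmin.trans ?_, le_trans ?_ hfmax⟩
    · exact ENNReal.toReal_mono hVi (ENNReal.inv_le_inv.2 h1)
    · exact ENNReal.toReal_mono hv₀'.ne (ENNReal.inv_le_inv.2 h0)
  · intro hs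
    refine (hbesov hs M _).trans ?_
    have h2 : A ≤ ENNReal.ofReal Ls := by
      rw [← ENNReal.ofReal_toReal hAtop.ne]
      exact ENNReal.ofReal_le_ofReal hLs
    refine le_trans ?_ h2
    rw [hA]
    refine mul_le_mul_left ?_ N
    rcases le_or_gt p 0 with hp | hp
    · rw [ENNReal.ofReal_of_nonpos hp, eLpNorm_exponent_zero]
      exact zero_le
    · rw [eLpNorm_const _ (by simpa using hp) (by
        intro h
        rw [h, Measure.coe_zero, Pi.zero_apply] at huniv
        exact hV0 huniv.symm), huniv]
      have h3 : ‖(V⁻¹).toReal‖ₑ = V⁻¹ := by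
        rw [← ofReal_norm, Real.norm_of_nonneg ENNReal.toReal_nonneg, ENNReal.ofReal_toReal hVi]
      rw [h3]
      gcongr

end

noncomputable section

variable {d D m : ℕ} {R η : ℝ} {H₀ : Space D → ℝ}

/-! ### The lower bound -/

theorem IsTame.mul_volume_lt_top (hD : 1 < D) (hdD : d < D) (h : IsTame H₀ R η) (m : ℕ) :
    (m : ℝ≥0∞) * μHE[d] (perturbedSphere d H₀ R η ∩ sector hD (2 * Real.pi / (4 * m : ℕ))) < ⊤ := by
  refine ENNReal.mul_lt_top (ENNReal.natCast_lt_top m) ?_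
  refine (measure_mono inter_subset_left).trans_lt (h.volume_le.trans_lt ?_)
  exact ENNReal.mul_lt_top (by simp) (volume_roundSphere_lt_top hdD h.pos)

/-- The bumps increase the volume of the sphere, and make up a fifth of the total volume. -/
theorem IsSectorBump.volume_bounds {hD : 1 < D}
    (h₀ : IsSectorBump hD (2 * Real.pi / (4 * m : ℕ)) R H₀) (hd : 1 ≤ d) (hdD : d < D)
    (hm : 0 < m) (hη : 0 < η) (h : IsTame H₀ R η) (ε : Fin m → Bool) :
    μHE[d] (perturbedSphere d (0 : Space D → ℝ) R 0) ≤
        μHE[d] (perturbedSphere d (signedBump hD H₀ ε) R η) ∧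
      μHE[d] (perturbedSphere d (signedBump hD H₀ ε) R η) ≤
        5 * (m * μHE[d] (perturbedSphere d H₀ R η ∩ sector hD (2 * Real.pi / (4 * m : ℕ)))) := by
  have hadd := h₀.volume_add (η := η) hd ε
  -- There are `4 m` sectors in the cover but only `m` bumps, hence the factor `4`; the bumps
  -- themselves make it `5`.
  have hle : μHE[d] (perturbedSphere d (0 : Space D → ℝ) R 0) ≤
      4 * (m * μHE[d] (perturbedSphere d (0 : Space D → ℝ) R 0 ∩
        sector hD (2 * Real.pi / (4 * m : ℕ)))) := by
    rw [← mul_assoc]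
    exact_mod_cast volume_roundSphere_le hD hd hdD (by omega : 2 < 4 * m) R
  have hσβ := mul_le_mul_right (h.volume_inter_cone_le (d := d)
    (fun y hy s hs => smul_mem_sector hD (a := 2 * Real.pi / (4 * m : ℕ)) hy hs)
    fun y => mul_nonneg hη.le (h₀.nonneg y)) (m : ℝ≥0∞)
  have hβ := h.mul_volume_lt_top hD hdD m
  set V := μHE[d] (perturbedSphere d (signedBump hD H₀ ε) R η)
  set a := μHE[d] (perturbedSphere d (0 : Space D → ℝ) R 0)
  set β := (m : ℝ≥0∞) * μHE[d] (perturbedSphere d H₀ R η ∩ sector hD (2 * Real.pi / (4 * m : ℕ)))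
  constructor
  · refine (ENNReal.add_le_add_iff_right hβ.ne).1 ?_
    rw [← hadd]
    gcongr
  · calc V ≤ a + β := by rw [← hadd]; exact le_self_add
      _ ≤ 4 * β + β := by
        gcongr
        exact hle.trans (by gcongr)
      _ = 5 * β := by ring

theorem IsSectorBump.volume_eq {hD : 1 < D}
    (h₀ : IsSectorBump hD (2 * Real.pi / (4 * m : ℕ)) R H₀) (hd : 1 ≤ d) (hdD : d < D)
    (hR : 0 < R) (ε ε' : Fin m → Bool) :
    μHE[d] (perturbedSphere d (signedBump hD H₀ ε) R η) =
      μHE[d] (perturbedSphere d (signedBump hD H₀ ε') R η) := by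
  have hσ : (m : ℝ≥0∞) * μHE[d] (perturbedSphere d (0 : Space D → ℝ) R 0 ∩
      sector hD (2 * Real.pi / (4 * m : ℕ))) ≠ ⊤ :=
    (ENNReal.mul_lt_top (ENNReal.natCast_lt_top m)
      ((measure_mono inter_subset_left).trans_lt (volume_roundSphere_lt_top hdD hR))).ne
  exact (ENNReal.add_left_inj hσ).1 ((h₀.volume_add hd ε).trans (h₀.volume_add hd ε').symm)

theorem measureReal_sub_le_tvDist {X : Type*} [MeasurableSpace X] (μ ν : ProbabilityMeasure X)
    {A : Set X} (hA : MeasurableSet A) :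
    (μ : Measure X).real A - (ν : Measure X).real A ≤
      tvDist μ.toFiniteMeasure ν.toFiniteMeasure :=
  (le_abs_self _).trans
    (le_ciSup (tvDist_bddAbove μ.toFiniteMeasure ν.toFiniteMeasure) ⟨A, hA⟩)

/-- Two uniform distributions whose signs differ on at least half of the cells are far apart in
total variation. -/
theorem IsSectorBump.tvDist_ge {hD : 1 < D}
    (h₀ : IsSectorBump hD (2 * Real.pi / (4 * m : ℕ)) R H₀) (hd : 1 ≤ d) (hdD : d < D)
    (hm : 0 < m) (hη : 0 < η) (h : IsTame H₀ R η) (J : Finset (Fin m)) (hJ : m ≤ 2 * Jᶜ.card)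
    (ε : Fin m → Bool) {ε' : Fin m → Bool} (hε : ∀ j ∉ J, ε j ≠ ε' j)
    (ht : IsTame (signedBump hD H₀ ε) R η) (μ ν : ProbabilityMeasure (Space D))
    (hμ : (μ : Measure (Space D)) = (μHE[d] (perturbedSphere d (signedBump hD H₀ ε) R η))⁻¹ •
      volM d (perturbedSphere d (signedBump hD H₀ ε) R η))
    (hν : (ν : Measure (Space D)) = (μHE[d] (perturbedSphere d (signedBump hD H₀ ε') R η))⁻¹ •
      volM d (perturbedSphere d (signedBump hD H₀ ε') R η)) :
    1 / 10 ≤ tvDist μ.toFiniteMeasure ν.toFiniteMeasure := by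
  set M := perturbedSphere d (signedBump hD H₀ ε) R η with hM
  set M' := perturbedSphere d (signedBump hD H₀ ε') R η with hM'
  have hMm : MeasurableSet M :=
    (isClosed_perturbedSphere (smooth_signedBump hD h₀.smooth ε).continuous).measurableSet
  have hmeas : ∀ j, MeasurableSet (M ∩ signSector hD j (ε j)) := fun j =>
    hMm.inter (isOpen_signSector hD j (ε j)).measurableSet
  -- The test set is the union of the bumps of `ε` in the switched cells, which the second surface
  -- does not meet.
  set A := ⋃ j ∈ Jᶜ, M ∩ signSector hD j (ε j) with hA
  have hAm : MeasurableSet A := Finset.measurableSet_biUnion _ fun j _ => hmeas j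
  have hAM : A ⊆ M := iUnion₂_subset fun j _ => inter_subset_left
  have hνA : (ν : Measure (Space D)) A = 0 := by
    have hemp : A ∩ M' = ∅ := by
      refine Set.eq_empty_of_forall_notMem fun y hy => ?_
      obtain ⟨j, hj, hyM, hyj⟩ := mem_iUnion₂.1 hy.1
      exact h₀.notMem_of_ne hη ht (hε j (Finset.mem_compl.1 hj)) hyM hyj hy.2
    rw [hν, Measure.smul_apply, volM, Measure.restrict_apply hAm, hemp, measure_empty, smul_zero]
  set β := μHE[d] (perturbedSphere d H₀ R η ∩ sector hD (2 * Real.pi / (4 * m : ℕ))) with hβ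
  have hvA : μHE[d] A = Jᶜ.card * β := by
    rw [hA, measure_biUnion_finset (fun i _ j _ hij => ?_) fun j _ => hmeas j]
    · simp only [hM, h₀.volume_inter_signSector hd, Finset.sum_const, nsmul_eq_mul, hβ]
    · exact (pairwise_disjoint_signSector hD ε hij).mono inter_subset_right inter_subset_right
  have hV := (h₀.volume_bounds hd hdD hm hη h ε).2
  have hV0 : μHE[d] M ≠ 0 := ((volume_roundSphere_pos hdD h.pos).trans_le
    (h₀.volume_bounds hd hdD hm hη h ε).1).ne'
  have hVtop : μHE[d] M ≠ ⊤ := (ht.volume_le.trans_lt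
    (ENNReal.mul_lt_top (by simp) (volume_roundSphere_lt_top hdD h.pos))).ne
  have hμA : ENNReal.ofReal (1 / 10) ≤ (μ : Measure (Space D)) A := by
    rw [hμ, Measure.smul_apply, volM, Measure.restrict_apply hAm, inter_eq_self_of_subset_left hAM,
      hvA, smul_eq_mul, mul_comm, ← div_eq_mul_inv,
      ENNReal.le_div_iff_mul_le (Or.inl hV0) (Or.inl hVtop)]
    -- The constant `1/10` comes from a total volume of at most `5 m β` with `m ≤ 2 * Jᶜ.card`.
    have hc : (m : ℝ≥0∞) ≤ 2 * Jᶜ.card := by exact_mod_cast hJ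
    calc ENNReal.ofReal (1 / 10) * μHE[d] M
        ≤ ENNReal.ofReal (1 / 10) * (5 * (2 * Jᶜ.card * β)) := by
          gcongr
          exact hV.trans (by gcongr)
      _ = (ENNReal.ofReal (1 / 10) * 10) * (Jᶜ.card * β) := by ring
      _ = Jᶜ.card * β := by
          have h10 : (10 : ℝ≥0∞) = ENNReal.ofReal 10 := by simp
          rw [h10, ← ENNReal.ofReal_mul (by norm_num)]
          norm_num
  have h1 := measureReal_sub_le_tvDist μ ν hAm
  rw [measureReal_def, measureReal_def, hνA, ENNReal.toReal_zero, sub_zero] at h1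
  refine le_trans ?_ h1
  exact (ENNReal.ofReal_le_iff_le_toReal (measure_ne_top _ _)).1 hμA

/-- The uniform distributions for two families of signs agree outside the cells on which the signs
differ. -/
theorem IsSectorBump.restrict_eq {hD : 1 < D}
    (h₀ : IsSectorBump hD (2 * Real.pi / (4 * m : ℕ)) R H₀) (hd : 1 ≤ d) (hdD : d < D)
    (hR : 0 < R) {J : Finset (Fin m)} {ε ε' : Fin m → Bool} (hε : ∀ j ∈ J, ε j = ε' j) :
    ((μHE[d] (perturbedSphere d (signedBump hD H₀ ε) R η))⁻¹ •
        volM d (perturbedSphere d (signedBump hD H₀ ε) R η)).restrict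
          (⋃ j ∈ Jᶜ, signSector hD j false ∪ signSector hD j true)ᶜ =
      ((μHE[d] (perturbedSphere d (signedBump hD H₀ ε') R η))⁻¹ •
        volM d (perturbedSphere d (signedBump hD H₀ ε') R η)).restrict
          (⋃ j ∈ Jᶜ, signSector hD j false ∪ signSector hD j true)ᶜ := by
  have hB : MeasurableSet (⋃ j ∈ Jᶜ, signSector hD j false ∪ signSector hD j true)ᶜ :=
    (Finset.measurableSet_biUnion _ fun j _ =>
      ((isOpen_signSector hD j false).union (isOpen_signSector hD j true)).measurableSet).compl
  have hcongr := perturbedSphere_congr (d := d) (R := R) (η := η)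
    (B := (⋃ j ∈ Jᶜ, signSector hD j false ∪ signSector hD j true)ᶜ)
    fun y hy => h₀.signedBump_congr hε hy
  rw [h₀.volume_eq hd hdD hR ε ε', Measure.restrict_smul, Measure.restrict_smul, volM, volM,
    Measure.restrict_restrict hB, Measure.restrict_restrict hB, hcongr]

end

end ManifoldModel

theorem mainTheorem1 (d : ℕ) (hd : 1 ≤ d) :
    ∃ c : ℝ, 0 < c ∧
      ∀ (D k : ℕ) (s p : ℝ) (q : ℝ≥0∞) (τ : ℝ),
        d < D → 2 ≤ k → 0 ≤ s → s < k → 1 ≤ p → 1 ≤ q → 0 < τ →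
        ∃ f₀ F₀ Λk Λs : ℝ, 0 < f₀ ∧
          ∀ fmin fmax Lk Ls : ℝ,
            0 < fmin → fmin ≤ f₀ → F₀ ≤ fmax → Λk ≤ Lk → Λs ≤ Ls →
            ∀ (g : ℝ → ℝ≥0∞) (ℓ : FiniteMeasure (Space D) → FiniteMeasure (Space D) → ℝ≥0∞),
              ConvexOn ℝ≥0 Set.univ g → Monotone g → g 0 = 0 →
              Measurable[tvBorel]
                (fun z : FiniteMeasure (Space D) × FiniteMeasure (Space D) => ℓ z.1 z.2) →
              (∀ μ ν : FiniteMeasure (Space D), g (tvDist μ ν) ≤ ℓ μ ν) →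
              ∀ n : ℕ,
                g c ≤ minimaxRisk n (noiseFreeModel D d k s p q τ Lk Ls fmin fmax)
                  ProbabilityMeasure.toFiniteMeasure ℓ := by
  -- Half of the separation `1/10`.
  refine ⟨1 / 20, by norm_num, fun D k s p q τ hdD _ _ hsk _ hq hτ => ?_⟩
  have hD : 1 < D := by omega
  have hR : 0 < 4 * τ := by positivity
  have hStop := volume_roundSphere_lt_top (d := d) hdD hR
  obtain ⟨Λk, hclass⟩ := exists_eventually_mem_manifoldClass k hd hdD hτ
  -- The volume range, from the round sphere to `2 ^ d` times it, is free of `n` and of the bumps,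
  -- so all thresholds are fixed before `n`.
  obtain ⟨f₀, F₀, Λs, hf₀, hunif⟩ := exists_uniform_mem_modelOn (D := D) (p := p) d k hsk hq
    (volume_roundSphere_pos hdD hR)
    (ENNReal.mul_lt_top (by simp) hStop :
      (2 : ℝ≥0∞) ^ d * μHE[d] (perturbedSphere d (0 : Space D → ℝ) (4 * τ) 0) < ⊤)
  refine ⟨f₀, F₀, Λk, Λs, hf₀, fun fmin fmax Lk Ls h1 h2 h3 hLk h4 g ℓ hg hmono _ _ hℓ n => ?_⟩
  -- The extra cell keeps `m` positive when `n = 0`.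
  obtain ⟨m, hm, hmn⟩ : ∃ m, 0 < m ∧ 2 * n ≤ m := ⟨2 * n + 1, by omega, by omega⟩
  obtain ⟨H₀, h₀⟩ := exists_isSectorBump hD (2 * Real.pi / (4 * m : ℕ)) (4 * τ)
  -- One `η` serves all of the finitely many sign vectors and the single bump; it depends on `n`
  -- through `m`, harmlessly.
  obtain ⟨η, ⟨hall, htame₀, -⟩, hη⟩ := (((eventually_all.2 fun ε : Fin m → Bool =>
    hclass _ (smooth_signedBump hD h₀.smooth ε) (hasCompactSupport_signedBump hD h₀.compact ε)).and
      (hclass H₀ h₀.smooth h₀.compact)).and self_mem_nhdsWithin).exists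
  have hη : 0 < η := hη
  choose μ hμ hμeq using fun ε : Fin m → Bool => hunif fmin fmax Ls h1 h2 h3 h4
    (perturbedSphere d (signedBump hD H₀ ε) (4 * τ) η)
    (h₀.volume_bounds hd hdD hm hη htame₀ ε).1 (hall ε).1.volume_le
  refine le_minimaxRisk_of_cells hmn (noiseFreeModel D d k s p q τ Lk Ls fmin fmax) μ
    (fun ε => mem_iUnion₂.2 ⟨_, (hall ε).2 Lk hLk, hμ ε⟩)
    (fun j => signSector hD j false ∪ signSector hD j true)
    (fun j => ((isOpen_signSector hD j false).union (isOpen_signSector hD j true)).measurableSet)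
    (fun j l hjl => ?_) (fun J ε ε' hε => ?_) (fun J ε hJ => ?_) g ℓ hg hmono hℓ
  · have hne : ∀ b c : Bool, (j, b) ≠ (l, c) := fun b c h => hjl (Prod.ext_iff.1 h).1
    exact Disjoint.union_left
      (Disjoint.union_right (disjoint_signSector hD (hne _ _)) (disjoint_signSector hD (hne _ _)))
      (Disjoint.union_right (disjoint_signSector hD (hne _ _)) (disjoint_signSector hD (hne _ _)))
  · rw [hμeq, hμeq]
    exact h₀.restrict_eq hd hdD hR hε
  · refine le_trans (by norm_num) (h₀.tvDist_ge hd hdD hm hη htame₀ J hJ ε (fun j hj => ?_)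
      (hall ε).1 (μ ε) (μ (flipOff J ε)) (hμeq ε) (hμeq _))
    simp [flipOff, hj]
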